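/- **Notation.** For $\omega\in\mathbb R$ write $\theta=(\cos\omega,\sin\omega)$ and $\theta^\perp=(-\sin\omega,\cos\omega)$. The line with parameters $(s,\theta)$ is $\{s\theta^\perp+t\theta: t\in\mathbb R\}$. The attenuated Radon transform is $$R_af(s,\theta)=\int_{-\infty}^{\infty} f(s\theta^\perp+t\theta)\,e^{-Da(s\theta^\perp+t\theta,\theta)}\,dt,\qquad Da(x,\theta)=\int_0^\infty a(x+t\theta)\,dt .$$ **Multi-bang.** The function $a:\mathbb R^2\to\mathbb R$ is multi-bang with sets $\Omega_1,\dots,\Omega_n$ if $a=\sum_{j=1}^n a_j\chi_{\Omega_j}$, where the $a_j$ are nonzero, pairwise distinct real numbers and the $\Omega_j$ are pairwise disjoint bounded open sets, each equal to the interior of its closure. The boundaries are smooth, possibly with corners: near each boundary point, $\Omega_j$ consists of finitely many disjoint pieces, each of which is mapped by a local $C^\infty$ diffeomorphism either to a half plane or, in which case the point is called a corner, to a sector of angle in $(0,\pi)\cup(\pi,2\pi)$. Every line meets $\bigcup_j\partial\Omega_j$ in a union of finitely many points and closed segments. The set $\Omega_0=\mathbb R^2\setminus\bigcup_{j\ge1}\overline{\Omega_j}$,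 on which $a=0$, is called the background. A line through a corner is tangent to the boundary there if it is tangent to one of the branches of the boundary at that corner. **Theorem.** Let $f\in C^1_c(\mathbb R^2)$ be non-negative and let $a$ be multi-bang with sets $\Omega_1,\dots,\Omega_n$. (i) Let $x\in\partial\Omega_j$, $j\geq 1$, be a point near which $\partial\Omega_j$ is a single smooth curve, with nonzero curvature at $x$. Let $(s^*,\theta^*)$, $\theta^*=(\cos\omega^*,\sin\omega^*)$, be the parameters (for either orientation) of the line tangent to $\partial\Omega_j$ at $x$. Suppose that this line is tangent to no $\partial\Omega_l$ at any point other than $x$, that every $\partial\Omega_l$ to which it is tangent at $x$ coincides with $\partial\Omega_j$ near $x$, and that the ray $\{x+t\theta^*: t<0\}$ meets $\{f>0\}$. Then $\partial_sR_af(s,\theta^*)$ has a singularity of order $1/2$ at $s=s^*$: the derivative exists for all $s\ne s^*$ near $s^*$, and the one-sided limits of $|s-s^*|^{1/2}\,\partial_sR_af(s,\theta^*)$ as $s\to s^*$ from the left and from the right exist, are finite, and are not both zero. Moreover, for every point $y$ on the line, $\partial_\omega\big(R_af(y\cdot\theta^\perp,\theta)\big)$ exists for all $\omega\neq\omega^*$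 near $\omega^*$, and $x$ is the unique point $y$ on the line with $$\lim_{\omega\to\omega^*}|\sin(\omega-\omega^*)|^{1/2}\,\partial_\omega\big( R_af(y\cdot\theta^\perp,\theta)\big)=0 .$$ (ii) Let $x$ be a corner shared by exactly two components, the background being counted: that is, there are $j\ge1$ and $l\ge 0$ with $l\neq j$ such that near $x$ each of $\Omega_j$ and $\Omega_l$ is a single sector with a corner at $x$ (in the above sense), and $x$ lies on the boundary of no other set among $\Omega_0,\dots,\Omega_n$. Let $(s^*,\theta^*)$ be the parameters of a line through $x$ that passes through no other corner, is tangent to no $\partial\Omega_m$ at any point, and is such that the ray $\{x+t\theta^*: t<0\}$ meets $\{f>0\}$. Then $\partial_sR_af(s,\theta^*)$ has a jump across $s=s^*$: the derivative exists for all $s\ne s^*$ near $s^*$, and its one-sided limits at $s^*$ exist, are finite, and are different. -/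

import Mathlib

open Real Set Filter Topology

noncomputable section

/-- The Euclidean plane. -/
abbrev Plane : Type := EuclideanSpace ℝ (Fin 2)

/-- The unit vector `θ = (cos ω, sin ω)`. -/
def dir (ω : ℝ) : Plane := !₂[cos ω, sin ω]

/-- The unit vector `θ^⊥ = (-sin ω, cos ω)`, i.e. `θ` rotated anticlockwise by `π / 2`. -/
def dirPerp (ω : ℝ) : Plane := !₂[-sin ω, cos ω]

/-- The oriented line with parameters `(s, θ)`: the points `s θ^⊥ + t θ`, `t ∈ ℝ`. -/
def lineSet (s ω : ℝ) : Set Plane := {y | ∃ t : ℝ, y = s • dirPerp ω + t • dir ω}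

/-- The beam transform `Da (x, θ) = ∫_0^∞ a (x + t θ) dt`. -/
def beamTransform (a : Plane → ℝ) (x : Plane) (ω : ℝ) : ℝ :=
  ∫ t in Ioi (0 : ℝ), a (x + t • dir ω)

/-- The attenuated Radon transform
`R_a f (s, θ) = ∫ f (s θ^⊥ + t θ) exp (-Da (s θ^⊥ + t θ, θ)) dt`, where `θ = (cos ω, sin ω)`. -/
def attRadon (a f : Plane → ℝ) (s ω : ℝ) : ℝ :=
  ∫ t : ℝ, f (s • dirPerp ω + t • dir ω) *
    exp (-beamTransform a (s • dirPerp ω + t • dir ω) ω)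

/-- `Φ` is a local `C^∞` diffeomorphism of the plane, defined near `x` and sending `x` to `0`. -/
structure IsSmoothChartAt (Φ : OpenPartialHomeomorph Plane Plane) (x : Plane) : Prop where
  mem_source : x ∈ Φ.source
  map_base : Φ x = 0
  contDiffOn : ContDiffOn ℝ ((⊤ : ℕ∞) : WithTop ℕ∞) Φ Φ.source
  contDiffOn_symm : ContDiffOn ℝ ((⊤ : ℕ∞) : WithTop ℕ∞) Φ.symm Φ.target

/-- The chart `Φ` at `x` straightens `V` to the half plane `{p₁ > 0}`. -/
structure IsHalfPlaneChart (Φ : OpenPartialHomeomorph Plane Plane) (V : Set Plane) (x : Plane) :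
    Prop extends IsSmoothChartAt Φ x where
  mem_iff : ∀ y ∈ Φ.source, y ∈ V ↔ 0 < Φ y 1

/-- Near `x ∈ ∂V`, the set `V` lies on one side of a single smooth curve through `x`. -/
def IsSmoothGerm (V : Set Plane) (x : Plane) : Prop :=
  ∃ Φ : OpenPartialHomeomorph Plane Plane, IsHalfPlaneChart Φ V x

/-- Near `x ∈ ∂V`, the set `V` is a single curvilinear sector with vertex `x`, bounded by two
smooth arcs with linearly independent tangents at `x`: it is diffeomorphic to a quadrant
(interior angle less than `π`) or to the union of three quadrants (angle greater than `π`). -/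
def IsCornerGerm (V : Set Plane) (x : Plane) : Prop :=
  ∃ Φ : OpenPartialHomeomorph Plane Plane, IsSmoothChartAt Φ x ∧
    ((∀ y ∈ Φ.source, y ∈ V ↔ (0 < Φ y 0 ∧ 0 < Φ y 1)) ∨
     (∀ y ∈ Φ.source, y ∈ V ↔ (0 < Φ y 0 ∨ 0 < Φ y 1)))

/-- The boundary of `U` is smooth, possibly with corners: near each boundary point `U` consists of
finitely many disjoint pieces, each of which has a smooth boundary or a corner there.
(There may be several pieces, since different components of `U` may touch at a point.) -/
def HasSmoothBoundaryWithCorners (U : Set Plane) : Prop :=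
  ∀ x ∈ frontier U, ∃ (k : ℕ) (V : Fin k → Set Plane),
    (∀ i, IsOpen (V i)) ∧ Pairwise (fun i i' => Disjoint (V i) (V i')) ∧
    (∀ᶠ y in 𝓝 x, y ∈ U ↔ ∃ i, y ∈ V i) ∧
    ∀ i, IsSmoothGerm (V i) x ∨ IsCornerGerm (V i) x

/-- `x` is a corner of the boundary of one of the local components of `U` at `x`. -/
def HasCornerAt (U : Set Plane) (x : Plane) : Prop :=
  ∃ V W : Set Plane, IsOpen V ∧ IsOpen W ∧ Disjoint V W ∧
    (∀ᶠ y in 𝓝 x, y ∈ U ↔ y ∈ V ∪ W) ∧ IsCornerGerm V x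

/-- The signed curvature `(γ₀' γ₁'' - γ₁' γ₀'') / |γ'|³` of a plane curve `γ`. -/
def planeCurvature (γ : ℝ → Plane) (t : ℝ) : ℝ :=
  (deriv γ t 0 * deriv (deriv γ) t 1 - deriv γ t 1 * deriv (deriv γ) t 0) / ‖deriv γ t‖ ^ 3

/-- `∂U` is a smooth curve near `x` and has nonzero curvature at `x`. The boundary is parametrised
near `x` by `t ↦ Φ⁻¹ (t, 0)`, where `Φ` straightens `U`. -/
def HasNonzeroCurvatureAt (U : Set Plane) (x : Plane) : Prop :=
  ∃ Φ : OpenPartialHomeomorph Plane Plane, IsHalfPlaneChart Φ U x ∧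
    planeCurvature (fun t : ℝ => Φ.symm !₂[t, 0]) 0 ≠ 0

/-- The line through `y` with direction `θ` is tangent to `∂U` at `y`. At a corner this means
tangent to one of the branches of the boundary (the tangent cone over `ℝ` is symmetric, so it is
the union of the tangent lines of all branches of `∂U` at `y`). -/
def IsTangentAt (U : Set Plane) (y : Plane) (ω : ℝ) : Prop :=
  y ∈ frontier U ∧ dir ω ∈ tangentConeAt ℝ (frontier U) y

/-- `a` is multi-bang with nonzero, pairwise distinct values `c j` on the sets `Ω j`
(and value `0` elsewhere). -/
structure IsMultiBang {n : ℕ} (a : Plane → ℝ) (c : Fin n → ℝ) (Ω : Fin n → Set Plane) :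
    Prop where
  value_injective : Function.Injective c
  value_ne_zero : ∀ j, c j ≠ 0
  isOpen : ∀ j, IsOpen (Ω j)
  isBounded : ∀ j, Bornology.IsBounded (Ω j)
  disjoint : Pairwise (fun j l => Disjoint (Ω j) (Ω l))
  interior_closure : ∀ j, interior (closure (Ω j)) = Ω j
  boundary : ∀ j, HasSmoothBoundaryWithCorners (Ω j)
  /-- Every line meets the boundaries in finitely many points and closed segments. -/
  line_inter : ∀ s ω : ℝ, ∃ I : Finset (ℝ × ℝ),
    {t : ℝ | ∃ j, s • dirPerp ω + t • dir ω ∈ frontier (Ω j)} = ⋃ p ∈ I, Icc p.1 p.2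
  eq_sum : ∀ x, a x = ∑ j, (Ω j).indicator (fun _ => c j) x

/-- The regions of constancy of `a`: the sets `Ω j`, and (index `none`) the background
`ℝ² \ ⋃ closure (Ω j)`, on which `a = 0`. -/
def region {n : ℕ} (Ω : Fin n → Set Plane) : Option (Fin n) → Set Plane
  | none => (⋃ j, closure (Ω j))ᶜ
  | some j => Ω j

/-- The point `x` is a corner of `Ω j` and of exactly one other region (the background counts as
a region): near `x` each of the two is a single sector, and no third region reaches `x`. -/
def IsCornerOfExactlyTwo {n : ℕ} (Ω : Fin n → Set Plane) (j : Fin n) (x : Plane) : Prop :=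
  IsCornerGerm (Ω j) x ∧ ∃ l : Option (Fin n), l ≠ some j ∧ IsCornerGerm (region Ω l) x ∧
    ∀ m : Option (Fin n), x ∈ frontier (region Ω m) → m = some j ∨ m = l

/-- `F'` has a singularity of order `α` at `s₀`: `F` is differentiable at all `s ≠ s₀` near `s₀`,
both one-sided limits of `|s - s₀|^α F'(s)` at `s₀` exist, and they are not both zero. -/
def DerivHasSingularityOfOrder (F : ℝ → ℝ) (s₀ α : ℝ) : Prop :=
  (∀ᶠ s in 𝓝[≠] s₀, DifferentiableAt ℝ F s) ∧
  ∃ L₁ L₂ : ℝ, Tendsto (fun s => |s - s₀| ^ α * deriv F s) (𝓝[<] s₀) (𝓝 L₁) ∧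
    Tendsto (fun s => |s - s₀| ^ α * deriv F s) (𝓝[>] s₀) (𝓝 L₂) ∧ (L₁ ≠ 0 ∨ L₂ ≠ 0)

/-- `F'` has a jump at `s₀`: `F` is differentiable at all `s ≠ s₀` near `s₀`, and both one-sided
limits of `F'` at `s₀` exist and are different. -/
def DerivHasJump (F : ℝ → ℝ) (s₀ : ℝ) : Prop :=
  (∀ᶠ s in 𝓝[≠] s₀, DifferentiableAt ℝ F s) ∧
  ∃ L₁ L₂ : ℝ, Tendsto (deriv F) (𝓝[<] s₀) (𝓝 L₁) ∧ Tendsto (deriv F) (𝓝[>] s₀) (𝓝 L₂) ∧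
    L₁ ≠ L₂

end

/-! ### One-variable calculus: removable points, implicit functions, normal forms at a critical
point. -/

/-- Serves for quotients such as h(u)/u, whose regularity is evident only off the point: the mean
value theorem turns a limit of the derivative into a derivative at the point. -/
theorem contDiffAt_one_of_punctured {φ : ℝ → ℝ} {x L : ℝ}
    (hd : ∀ᶠ u in 𝓝[≠] x, ContDiffAt ℝ 1 φ u) (hc : ContinuousAt φ x)
    (hl : Tendsto (deriv φ) (𝓝[≠] x) (𝓝 L)) : ContDiffAt ℝ 1 φ x ∧ deriv φ x = L := by
  obtain ⟨ε, hε, hb⟩ := Metric.eventually_nhds_iff.1 (eventually_nhdsWithin_iff.1 hd)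
  have hdiff : ∀ u ∈ Metric.ball x ε, u ≠ x → DifferentiableAt ℝ φ u := fun u hu hne =>
    (hb hu hne).differentiableAt one_ne_zero
  have hmem : Metric.ball x ε ∈ 𝓝 x := Metric.ball_mem_nhds x hε
  have h1 : HasDerivWithinAt φ L (Ici x) x := by
    refine hasDerivWithinAt_Ici_of_tendsto_deriv (s := Metric.ball x ε ∩ Ioi x)
      (fun u hu => (hdiff u hu.1 (ne_of_gt hu.2)).differentiableWithinAt) hc.continuousWithinAt
      (inter_mem (mem_nhdsWithin_of_mem_nhds hmem) self_mem_nhdsWithin)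
      (hl.mono_left (nhdsWithin_mono _ fun u (hu : x < u) => ne_of_gt hu))
  have h2 : HasDerivWithinAt φ L (Iic x) x := by
    refine hasDerivWithinAt_Iic_of_tendsto_deriv (s := Metric.ball x ε ∩ Iio x)
      (fun u hu => (hdiff u hu.1 (ne_of_lt hu.2)).differentiableWithinAt) hc.continuousWithinAt
      (inter_mem (mem_nhdsWithin_of_mem_nhds hmem) self_mem_nhdsWithin)
      (hl.mono_left (nhdsWithin_mono _ fun u (hu : u < x) => ne_of_lt hu))
  have h3 : HasDerivAt φ L x := by
    have := h1.union h2
    rwa [Ici_union_Iic, hasDerivWithinAt_univ] at this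
  refine ⟨?_, h3.deriv⟩
  have hdiff' : ∀ u ∈ Metric.ball x ε, DifferentiableAt ℝ φ u := fun u hu => by
    by_cases hne : u = x
    · rw [hne]; exact h3.differentiableAt
    · exact hdiff u hu hne
  have hcd : ContDiffOn ℝ 1 φ (Metric.ball x ε) := by
    rw [show (1 : WithTop ℕ∞) = 0 + 1 from rfl, contDiffOn_succ_iff_deriv_of_isOpen Metric.isOpen_ball]
    refine ⟨fun u hu => (hdiff' u hu).differentiableWithinAt, by simp, ?_⟩
    rw [contDiffOn_zero]
    intro u hu
    by_cases hne : u = x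
    · subst hne
      refine ContinuousAt.continuousWithinAt ?_
      rw [continuousAt_iff_punctured_nhds, h3.deriv]
      exact hl
    · exact ((((hb hu hne).derivWithin (m := 0) (by norm_num)).continuousAt)).continuousWithinAt
  exact hcd.contDiffAt hmem

/-- The implicit function theorem together with the side of the graph on which g is positive; the
side decides which region a point of a line belongs to. -/
theorem exists_implicit {g : ℝ × ℝ → ℝ} {n : WithTop ℕ∞} {a b : ℝ} (hn : n ≠ 0)
    (hg : ContDiffAt ℝ n g (a, b)) (h0 : g (a, b) = 0) (hd : fderiv ℝ g (a, b) (0, 1) ≠ 0) :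
    ∃ p : ℝ → ℝ, ContDiffAt ℝ n p a ∧ p a = b ∧
      deriv p a = -fderiv ℝ g (a, b) (1, 0) / fderiv ℝ g (a, b) (0, 1) ∧
      ∀ᶠ z : ℝ × ℝ in 𝓝 (a, b), (g z = 0 ↔ z.2 = p z.1) ∧
        (0 < g z ↔ 0 < fderiv ℝ g (a, b) (0, 1) * (z.2 - p z.1)) := by
  set d := fderiv ℝ g (a, b) (0, 1) with hdd
  have hinv : (fderiv ℝ g (a, b) ∘L .inr ℝ ℝ ℝ).IsInvertible := by
    refine ⟨ContinuousLinearEquiv.unitsEquivAut ℝ (Units.mk0 d hd), ?_⟩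
    ext
    simp [hdd]
  have h1 := hg.contDiffAt_implicitFunction hn hinv
  have h2 := hg.implicitFunction_apply_self hn hinv
  have h3 := hg.eventually_apply_eq_iff_implicitFunction hn hinv
  have h4 := hg.eventually_apply_implicitFunction hn hinv
  set p := hg.implicitFunction hn hinv
  simp only at h1 h2 h4
  rw [h0] at h4
  have hpc : ContinuousAt p a := h1.continuousAt
  have hgs := hg.hasStrictFDerivAt hn
  refine ⟨p, h1, h2, ?_, ?_⟩
  · have hpd : HasDerivAt p (deriv p a) a := (h1.differentiableAt hn).hasDerivAt
    have hcomp : HasDerivAt (fun l => g (l, p l)) (fderiv ℝ g (a, b) (1, deriv p a)) a := by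
      have hgd : HasFDerivAt g (fderiv ℝ g (a, b)) (a, p a) := by
        rw [h2]; exact hgs.hasFDerivAt
      exact hgd.comp_hasDerivAt (f := fun l => (l, p l)) a ((hasDerivAt_id a).prodMk hpd)
    have hz : HasDerivAt (fun l => g (l, p l)) 0 a :=
      (hasDerivAt_const a (0 : ℝ)).congr_of_eventuallyEq h4
    have h5 := hcomp.unique hz
    have h6 : ((1 : ℝ), deriv p a) = (1, 0) + deriv p a • ((0 : ℝ), (1 : ℝ)) := by simp
    rw [h6, map_add, map_smul, smul_eq_mul, ← hdd] at h5
    field_simp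
    linarith
  · have htend : Tendsto (fun z : ℝ × ℝ => (z, (z.1, p z.1))) (𝓝 (a, b)) (𝓝 ((a, b), (a, b))) := by
      have : ContinuousAt (fun z : ℝ × ℝ => (z, (z.1, p z.1))) (a, b) := by
        refine continuousAt_id.prodMk (continuousAt_fst.prodMk ?_)
        exact ContinuousAt.comp (f := Prod.fst) (x := (a, b)) hpc continuousAt_fst
      have h := this.tendsto
      simp only [h2] at h
      exact h
    -- Strict differentiability, applied to z and to the point of the graph with the same first
    -- coordinate, gives g z = d (z.2 - p z.1) with an error of at most half that size, so both have
    -- the same sign.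
    have hlo := (hgs.isLittleO.comp_tendsto htend).def (c := |d| / 2) (by positivity)
    have h4' : ∀ᶠ z : ℝ × ℝ in 𝓝 (a, b), g (z.1, p z.1) = 0 :=
      (continuousAt_fst (p := (a, b))).tendsto.eventually h4
    filter_upwards [h3, hlo, h4'] with z hz3 hzlo hz4
    rw [h0] at hz3
    refine ⟨hz3.trans eq_comm, ?_⟩
    have h6 : z - (z.1, p z.1) = (z.2 - p z.1) • ((0 : ℝ), (1 : ℝ)) := by
      ext <;> simp
    simp only [Function.comp_def, hz4, h6, map_smul, smul_eq_mul, ← hdd, norm_smul, sub_zero] at hzlo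
    have h7 : |g z - (z.2 - p z.1) * d| ≤ |d| / 2 * |z.2 - p z.1| := by
      simpa [Prod.norm_def] using hzlo
    set y := z.2 - p z.1
    have h8 : |d| * |y| = |d * y| := (abs_mul _ _).symm
    have h9 := abs_le.1 h7
    constructor
    · intro hpos
      by_contra hneg
      have : |d * y| = -(d * y) := abs_of_nonpos (not_lt.1 hneg)
      nlinarith
    · intro hpos
      have : |d * y| = d * y := abs_of_pos hpos
      nlinarith

theorem tendsto_quadratic_quotients {h : ℝ → ℝ} (hh : ContDiffAt ℝ 2 h 0) (h0 : h 0 = 0)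
    (h1 : deriv h 0 = 0) :
    Tendsto (fun u => deriv h u / u) (𝓝[≠] 0) (𝓝 (deriv (deriv h) 0)) ∧
    Tendsto (fun u => h u / u ^ 2) (𝓝[≠] 0) (𝓝 (deriv (deriv h) 0 / 2)) := by
  have hd : ContDiffAt ℝ 1 (deriv h) 0 := hh.derivWithin (by norm_num)
  have hA : Tendsto (fun u => deriv h u / u) (𝓝[≠] 0) (𝓝 (deriv (deriv h) 0)) := by
    have := (hd.differentiableAt one_ne_zero).hasDerivAt.tendsto_slope
    refine this.congr fun u => ?_
    simp [slope_def_field, h1]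
  refine ⟨hA, ?_⟩
  have hev : ∀ᶠ u in 𝓝[≠] (0 : ℝ), DifferentiableAt ℝ h u :=
    eventually_nhdsWithin_of_eventually_nhds
      ((hh.eventually (by simp)).mono fun u hu => hu.differentiableAt (by norm_num))
  refine deriv.lhopital_zero_nhdsNE hev ?_ ?_ ?_ ?_
  · filter_upwards [self_mem_nhdsWithin] with u hu
    simpa using hu
  · have := hh.continuousAt.tendsto
    rw [h0] at this
    exact this.mono_left nhdsWithin_le_nhds
  · have : Continuous fun u : ℝ => u ^ 2 := by fun_prop
    have := this.tendsto 0
    simp only [ne_eq, OfNat.ofNat_ne_zero, not_false_eq_true, zero_pow] at this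
    exact this.mono_left nhdsWithin_le_nhds
  · refine (hA.div_const 2).congr fun u => ?_
    simp
    ring

/-- Division by u costs one derivative, and the C¹ quotient is still enough for the implicit
function theorem. -/
theorem exists_mul_eq {h : ℝ → ℝ} (hh : ContDiffAt ℝ 2 h 0) (h0 : h 0 = 0) (h1 : deriv h 0 = 0) :
    ∃ m : ℝ → ℝ, ContDiffAt ℝ 1 m 0 ∧ m 0 = 0 ∧ deriv m 0 = deriv (deriv h) 0 / 2 ∧
      ∀ u, h u = u * m u := by
  obtain ⟨hA, hB⟩ := tendsto_quadratic_quotients hh h0 h1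
  set A := deriv (deriv h) 0
  -- At u = 0 the convention 0 / 0 = 0 happens to give the limit h'(0) = 0.
  refine ⟨fun u => h u / u, ?_⟩
  have hev : ∀ᶠ u in 𝓝[≠] (0 : ℝ), ContDiffAt ℝ 2 h u :=
    eventually_nhdsWithin_of_eventually_nhds (hh.eventually (by simp))
  have key := contDiffAt_one_of_punctured (φ := fun u => h u / u) (x := 0) (L := A / 2) ?_ ?_ ?_
  · refine ⟨key.1, by simp, key.2, fun u => ?_⟩
    by_cases hu : u = 0
    · simp [hu, h0]
    · field_simp
  · filter_upwards [hev, self_mem_nhdsWithin] with u hu hne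
    exact (hu.of_le (by norm_num)).div contDiffAt_id hne
  · rw [continuousAt_iff_punctured_nhds]
    have := hB.mul (tendsto_id.mono_left nhdsWithin_le_nhds : Tendsto id (𝓝[≠] (0 : ℝ)) (𝓝 0))
    simp only [mul_zero, div_zero] at this ⊢
    refine this.congr' ?_
    filter_upwards [self_mem_nhdsWithin] with u hu
    simp only [id]
    have : u ≠ 0 := hu
    field_simp
  · have := hA.sub hB
    rw [show A - A / 2 = A / 2 by ring] at this
    refine this.congr' ?_
    filter_upwards [hev, self_mem_nhdsWithin] with u hu hne
    have hne : u ≠ 0 := hne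
    have := ((hu.differentiableAt (by norm_num)).hasDerivAt.div (hasDerivAt_id u) hne).deriv
    rw [show (fun u => h u / u) = (h / id) from rfl, this]
    simp only [id]
    field_simp

/-- A nonnegative quadratic-like germ is the square of a `C¹` coordinate. -/
theorem exists_sq_eq {h : ℝ → ℝ} (hh : ContDiffAt ℝ 2 h 0) (h0 : h 0 = 0) (h1 : deriv h 0 = 0)
    (h2 : 0 < deriv (deriv h) 0) :
    ∃ k : ℝ → ℝ, ContDiffAt ℝ 1 k 0 ∧ k 0 = 0 ∧ 0 < deriv k 0 ∧ ∀ᶠ u in 𝓝 0, h u = k u ^ 2 := by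
  obtain ⟨hA, hB⟩ := tendsto_quadratic_quotients hh h0 h1
  set A := deriv (deriv h) 0
  have hev : ∀ᶠ u in 𝓝[≠] (0 : ℝ), ContDiffAt ℝ 2 h u :=
    eventually_nhdsWithin_of_eventually_nhds (hh.eventually (by simp))
  have hpos : ∀ᶠ u in 𝓝[≠] (0 : ℝ), 0 < h u / u ^ 2 := hB.eventually (lt_mem_nhds (by positivity))
  have hsq : Tendsto (fun u => √(h u / u ^ 2)) (𝓝[≠] 0) (𝓝 √(A / 2)) := hB.sqrt
  have hAs : 0 < √(A / 2) := Real.sqrt_pos.2 (by positivity)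
  -- The quotient tends to h''(0) / 2 > 0, so its root is regular off 0 and bounded near 0; the
  -- factor u gives k the sign of u, and the right value at 0.
  refine ⟨fun u => u * √(h u / u ^ 2), ?_⟩
  have key := contDiffAt_one_of_punctured (φ := fun u => u * √(h u / u ^ 2)) (x := 0)
    (L := √(A / 2)) ?_ ?_ ?_
  · refine ⟨key.1, by simp, by rw [key.2]; exact hAs, ?_⟩
    filter_upwards [eventually_nhdsWithin_iff.1 hpos] with u hu
    by_cases hne : u = 0
    · simp [hne, h0]
    · rw [mul_pow, Real.sq_sqrt (hu hne).le]
      field_simp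
  · filter_upwards [hev, hpos, self_mem_nhdsWithin] with u hu hp hne
    have hne : u ≠ 0 := hne
    refine contDiffAt_id.mul (ContDiffAt.sqrt ?_ hp.ne')
    exact (hu.of_le (by norm_num)).div (contDiffAt_id.pow 2) (pow_ne_zero 2 hne)
  · rw [continuousAt_iff_punctured_nhds]
    have := (tendsto_id.mono_left nhdsWithin_le_nhds : Tendsto id (𝓝[≠] (0 : ℝ)) (𝓝 0)).mul hsq
    simpa using this
  · have hlim : Tendsto (fun u => (deriv h u / u) / (2 * √(h u / u ^ 2))) (𝓝[≠] 0)
        (𝓝 (A / (2 * √(A / 2)))) := hA.div (hsq.const_mul 2) (by positivity)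
    have hAA : A / (2 * √(A / 2)) = √(A / 2) := by
      have := Real.sq_sqrt (show 0 ≤ A / 2 by positivity)
      field_simp
      nlinarith
    rw [hAA] at hlim
    refine hlim.congr' ?_
    filter_upwards [hev, hpos, self_mem_nhdsWithin] with u hu hp hne
    have hne : u ≠ 0 := hne
    have hd1 := (hu.differentiableAt (by norm_num)).hasDerivAt.div (hasDerivAt_pow 2 u)
      (pow_ne_zero 2 hne)
    have hd2 := (hasDerivAt_id u).mul (hd1.sqrt hp.ne')
    have hd3 : deriv (fun u => u * √(h u / u ^ 2)) u = _ := hd2.deriv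
    rw [hd3]
    have hs := Real.sq_sqrt hp.le
    have hs0 : 0 < √(h u / u ^ 2) := Real.sqrt_pos.2 hp
    simp only [id, Pi.div_apply]
    have hhu : h u = √(h u / u ^ 2) ^ 2 * u ^ 2 := by rw [hs]; field_simp
    generalize √(h u / u ^ 2) = s at *
    rw [hhu]
    field_simp
    norm_num
    ring

/-! ### Crossing parameters and jump representations; transversal curves and corners. -/

/-- `p` is a crossing parameter based at `τ`: it is continuous at `0` with `p 0 = τ`, it is `C¹` at
all nonzero parameters near `0`, and its derivative, weighted by `w`, has the one-sided limits
`q₁` and `q₂` at `0`. -/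
structure IsCrossing (w p : ℝ → ℝ) (τ q₁ q₂ : ℝ) : Prop where
  map_zero : p 0 = τ
  continuousAt : ContinuousAt p 0
  contDiffAt : ∀ᶠ l in 𝓝[≠] 0, ContDiffAt ℝ 1 p l
  tendsto_left : Tendsto (fun l => w l * deriv p l) (𝓝[<] 0) (𝓝 q₁)
  tendsto_right : Tendsto (fun l => w l * deriv p l) (𝓝[>] 0) (𝓝 q₂)

/-- The indicator function of `r > p`. -/
noncomputable def step (p r : ℝ) : ℝ := if p < r then 1 else 0

/-- Near `(0, τ)` the function `A` is a constant plus a combination of steps located at crossing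
parameters based at `τ`, whose weighted one-sided slopes add up to `J₁` and `J₂`. -/
def JumpRep (w : ℝ → ℝ) (A : ℝ → ℝ → ℝ) (τ J₁ J₂ : ℝ) : Prop :=
  ∃ (ι : Type) (_ : Fintype ι) (C : ℝ) (β q₁ q₂ : ι → ℝ) (p : ι → ℝ → ℝ),
    (∀ i, IsCrossing w (p i) τ (q₁ i) (q₂ i)) ∧
    (∀ᶠ z : ℝ × ℝ in 𝓝 (0, τ),
      (∀ i, z.2 ≠ p i z.1) → A z.1 z.2 = C + ∑ i, β i * step (p i z.1) z.2) ∧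
    ∑ i, β i * q₁ i = J₁ ∧ ∑ i, β i * q₂ i = J₂

namespace JumpRep

variable {w : ℝ → ℝ} {A B : ℝ → ℝ → ℝ} {τ J₁ J₂ K₁ K₂ : ℝ}

theorem congr (h : JumpRep w A τ J₁ J₂) (hAB : ∀ᶠ z : ℝ × ℝ in 𝓝 (0, τ), B z.1 z.2 = A z.1 z.2) :
    JumpRep w B τ J₁ J₂ := by
  obtain ⟨ι, _, C, β, q₁, q₂, p, hp, hA, h₁, h₂⟩ := h
  refine ⟨ι, inferInstance, C, β, q₁, q₂, p, hp, ?_, h₁, h₂⟩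
  filter_upwards [hA, hAB] with z h1 h2 h3
  rw [h2, h1 h3]

theorem of_eventually_const {C : ℝ} (h : ∀ᶠ z : ℝ × ℝ in 𝓝 (0, τ), A z.1 z.2 = C) :
    JumpRep w A τ 0 0 := by
  refine ⟨Empty, inferInstance, C, Empty.elim, Empty.elim, Empty.elim, Empty.elim, by simp,
    ?_, by simp, by simp⟩
  filter_upwards [h] with z hz _
  simp [hz]

theorem add (hA : JumpRep w A τ J₁ J₂) (hB : JumpRep w B τ K₁ K₂) :
    JumpRep w (fun l r => A l r + B l r) τ (J₁ + K₁) (J₂ + K₂) := by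
  obtain ⟨ι, _, C, β, q₁, q₂, p, hp, hA, h₁, h₂⟩ := hA
  obtain ⟨ι', _, C', β', q₁', q₂', p', hp', hA', h₁', h₂'⟩ := hB
  refine ⟨ι ⊕ ι', inferInstance, C + C', Sum.elim β β', Sum.elim q₁ q₁', Sum.elim q₂ q₂',
    Sum.elim p p', ?_, ?_, by simp [← h₁, ← h₁'], by simp [← h₂, ← h₂']⟩
  · rintro (i | i)
    exacts [hp i, hp' i]
  · filter_upwards [hA, hA'] with z h1 h2 h3
    rw [h1 fun i => h3 (.inl i), h2 fun i => h3 (.inr i)]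
    simp
    ring

theorem const_mul (hA : JumpRep w A τ J₁ J₂) (k : ℝ) :
    JumpRep w (fun l r => k * A l r) τ (k * J₁) (k * J₂) := by
  obtain ⟨ι, _, C, β, q₁, q₂, p, hp, hA, h₁, h₂⟩ := hA
  refine ⟨ι, inferInstance, k * C, fun i => k * β i, q₁, q₂, p, hp, ?_, ?_, ?_⟩
  · filter_upwards [hA] with z h1 h3
    rw [h1 h3, mul_add, Finset.mul_sum]
    simp [mul_assoc]
  · simp [← h₁, Finset.mul_sum, mul_assoc]
  · simp [← h₂, Finset.mul_sum, mul_assoc]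

theorem sum {κ : Type*} (s : Finset κ) {A : κ → ℝ → ℝ → ℝ} {J₁ J₂ : κ → ℝ}
    (h : ∀ i ∈ s, JumpRep w (A i) τ (J₁ i) (J₂ i)) :
    JumpRep w (fun l r => ∑ i ∈ s, A i l r) τ (∑ i ∈ s, J₁ i) (∑ i ∈ s, J₂ i) := by
  classical
  induction s using Finset.induction_on with
  | empty =>
    simp only [Finset.sum_empty]
    exact of_eventually_const (C := 0) (by simp)
  | insert i s hi ih =>
    simp only [Finset.sum_insert hi]
    exact (h i (Finset.mem_insert_self i s)).add
      (ih fun k hk => h k (Finset.mem_insert_of_mem hk))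

end JumpRep

section Crossings

variable {w : ℝ → ℝ} {w₀ τ : ℝ} {p p₀ p₁ : ℝ → ℝ}

theorem isCrossing_of_contDiffAt (hw : Tendsto w (𝓝[≠] 0) (𝓝 w₀)) (hp : ContDiffAt ℝ 1 p 0)
    (h0 : p 0 = τ) : IsCrossing w p τ (w₀ * deriv p 0) (w₀ * deriv p 0) := by
  have hd : Tendsto (deriv p) (𝓝[≠] 0) (𝓝 (deriv p 0)) :=
    (hp.derivWithin (m := 0) (by norm_num)).continuousAt.tendsto.mono_left nhdsWithin_le_nhds
  exact ⟨h0, hp.continuousAt, eventually_nhdsWithin_of_eventually_nhds (hp.eventually (by simp)),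
    (hw.mul hd).mono_left (nhdsLT_le_nhdsNE 0), (hw.mul hd).mono_left (nhdsGT_le_nhdsNE 0)⟩

theorem IsCrossing.congr {q₁ q₂ : ℝ} {p' : ℝ → ℝ} (h : IsCrossing w p τ q₁ q₂) (h' : p' =ᶠ[𝓝 0] p) :
    IsCrossing w p' τ q₁ q₂ := by
  have hne : ∀ᶠ l in 𝓝[≠] 0, p' =ᶠ[𝓝 l] p :=
    eventually_nhdsWithin_of_eventually_nhds h'.eventually_nhds
  refine ⟨by rw [h'.self_of_nhds, h.map_zero], h.continuousAt.congr h'.symm, ?_, ?_, ?_⟩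
  · filter_upwards [hne, h.contDiffAt] with l h1 h2
    exact h2.congr_of_eventuallyEq h1
  · refine h.tendsto_left.congr' ?_
    filter_upwards [nhdsLT_le_nhdsNE 0 hne] with l hl
    rw [hl.deriv_eq]
  · refine h.tendsto_right.congr' ?_
    filter_upwards [nhdsGT_le_nhdsNE 0 hne] with l hl
    rw [hl.deriv_eq]

/-- The branch of smaller slope is the larger one for l < 0 and the smaller one for l > 0, so the
maximum changes branch at 0. This kink is the source of the jump at a corner. -/
theorem isCrossing_max (hw : Tendsto w (𝓝[≠] 0) (𝓝 w₀)) (hp₀ : ContDiffAt ℝ 1 p₀ 0)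
    (hp₁ : ContDiffAt ℝ 1 p₁ 0) (h0 : p₀ 0 = τ) (h1 : p₁ 0 = τ)
    (hlt : deriv p₀ 0 < deriv p₁ 0) :
    IsCrossing w (fun l => max (p₀ l) (p₁ l)) τ (w₀ * deriv p₀ 0) (w₀ * deriv p₁ 0) := by
  have hs : Tendsto (slope (p₁ - p₀) 0) (𝓝[≠] 0) (𝓝 (deriv p₁ 0 - deriv p₀ 0)) :=
    ((hp₁.differentiableAt one_ne_zero).hasDerivAt.sub
      (hp₀.differentiableAt one_ne_zero).hasDerivAt).tendsto_slope
  have hpos := hs.eventually (lt_mem_nhds (sub_pos.2 hlt))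
  have hpos' : ∀ᶠ l in 𝓝[≠] (0 : ℝ), 0 < (p₁ l - p₀ l) / l := by
    filter_upwards [hpos] with l hl
    simpa [slope_def_field, h0, h1] using hl
  have hL : ∀ᶠ l in 𝓝[<] (0 : ℝ), p₁ l < p₀ l := by
    filter_upwards [nhdsLT_le_nhdsNE 0 hpos', self_mem_nhdsWithin] with l hl (hl0 : l < 0)
    rcases div_pos_iff.1 hl with h | h <;> linarith
  have hR : ∀ᶠ l in 𝓝[>] (0 : ℝ), p₀ l < p₁ l := by
    filter_upwards [nhdsGT_le_nhdsNE 0 hpos', self_mem_nhdsWithin] with l hl (hl0 : 0 < l)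
    rcases div_pos_iff.1 hl with h | h <;> linarith
  have c0 := isCrossing_of_contDiffAt hw hp₀ h0
  have c1 := isCrossing_of_contDiffAt hw hp₁ h1
  have eL : ∀ᶠ l in 𝓝[<] (0 : ℝ), (fun l => max (p₀ l) (p₁ l)) =ᶠ[𝓝 l] p₀ := by
    filter_upwards [hL, nhdsLT_le_nhdsNE 0 c0.contDiffAt, nhdsLT_le_nhdsNE 0 c1.contDiffAt]
      with l h h' h''
    filter_upwards [h''.continuousAt.eventually_lt h'.continuousAt h] with y hy
    exact max_eq_left hy.le
  have eR : ∀ᶠ l in 𝓝[>] (0 : ℝ), (fun l => max (p₀ l) (p₁ l)) =ᶠ[𝓝 l] p₁ := by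
    filter_upwards [hR, nhdsGT_le_nhdsNE 0 c0.contDiffAt, nhdsGT_le_nhdsNE 0 c1.contDiffAt]
      with l h h' h''
    filter_upwards [h'.continuousAt.eventually_lt h''.continuousAt h] with y hy
    exact max_eq_right hy.le
  refine ⟨by simp [h0, h1], c0.continuousAt.max c1.continuousAt, ?_, ?_, ?_⟩
  · rw [← Iio_union_Ioi, nhdsWithin_union, eventually_sup]
    constructor
    · filter_upwards [eL, nhdsLT_le_nhdsNE 0 c0.contDiffAt] with l h h'
      exact h'.congr_of_eventuallyEq h
    · filter_upwards [eR, nhdsGT_le_nhdsNE 0 c1.contDiffAt] with l h h'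
      exact h'.congr_of_eventuallyEq h
  · refine c0.tendsto_left.congr' ?_
    filter_upwards [eL] with l hl
    rw [hl.deriv_eq]
  · refine c1.tendsto_right.congr' ?_
    filter_upwards [eR] with l hl
    rw [hl.deriv_eq]

end Crossings

/-- The indicator of `d * (r - p) > 0` off `r = p`, as an affine function of a step. -/
theorem exists_affine_step {d : ℝ} (hd : d ≠ 0) : ∃ σ e : ℝ, σ ≠ 0 ∧ ∀ p r : ℝ,
    (0 < d * (r - p) → e + σ * step p r = 1) ∧ (d * (r - p) < 0 → e + σ * step p r = 0) := by
  rcases lt_or_gt_of_ne hd with hd | hd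
  · refine ⟨-1, 1, by norm_num, fun p r => ⟨fun h => ?_, fun h => ?_⟩⟩
    · have : ¬ p < r := by intro h'; nlinarith
      simp [step, this]
    · have : p < r := by by_contra h'; nlinarith
      simp [step, this]
  · refine ⟨1, 0, by norm_num, fun p r => ⟨fun h => ?_, fun h => ?_⟩⟩
    · have : p < r := by by_contra h'; nlinarith
      simp [step, this]
    · have : ¬ p < r := by intro h'; nlinarith
      simp [step, this]

theorem jumpRep_smooth {w : ℝ → ℝ} {w₀ τ : ℝ} (hw : Tendsto w (𝓝[≠] 0) (𝓝 w₀)) {g : ℝ × ℝ → ℝ}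
    (hg : ContDiffAt ℝ 1 g (0, τ)) (h0 : g (0, τ) = 0) (hd : fderiv ℝ g (0, τ) (0, 1) ≠ 0)
    {A : ℝ → ℝ → ℝ} {c c' : ℝ}
    (hA : ∀ᶠ z : ℝ × ℝ in 𝓝 (0, τ), (0 < g z → A z.1 z.2 = c) ∧ (g z < 0 → A z.1 z.2 = c')) :
    ∃ j, JumpRep w A τ (w₀ * j) (w₀ * j) := by
  obtain ⟨p, hp, hp0, -, hev⟩ := exists_implicit one_ne_zero hg h0 hd
  obtain ⟨σ, e, -, hσ⟩ := exists_affine_step hd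
  refine ⟨(c - c') * σ * deriv p 0, Unit, inferInstance, c' + (c - c') * e, fun _ => (c - c') * σ,
    fun _ => w₀ * deriv p 0, fun _ => w₀ * deriv p 0, fun _ => p,
    fun _ => isCrossing_of_contDiffAt hw hp hp0, ?_, by simp; ring, by simp; ring⟩
  filter_upwards [hA, hev] with z hz ⟨hz0, hz1⟩ hne
  simp only [Finset.univ_unique, Finset.sum_singleton]
  have hne0 : g z ≠ 0 := fun h => hne () (hz0.1 h)
  have hne1 : z.2 - p z.1 ≠ 0 := sub_ne_zero.2 (hne ())
  rcases lt_or_gt_of_ne hne0 with h | h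
  · have h1 : fderiv ℝ g (0, τ) (0, 1) * (z.2 - p z.1) < 0 :=
      lt_of_le_of_ne (not_lt.1 fun h' => (lt_asymm h (hz1.2 h'))) (mul_ne_zero hd hne1)
    have := (hσ (p z.1) z.2).2 h1
    rw [hz.2 h]
    linear_combination (-(c - c')) * this
  · have := (hσ (p z.1) z.2).1 (hz1.1 h)
    rw [hz.1 h]
    linear_combination (-(c - c')) * this

theorem step_max (p q r : ℝ) : step (max p q) r = step p r * step q r := by
  by_cases h1 : p < r <;> by_cases h2 : q < r <;> simp [step, h1, h2]

/-- Two transversal curves cut a neighbourhood into four regions. The only term with unequal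
one-sided slopes is the product of the two steps, whose coefficient is a nonzero multiple of a - b -
b' + c. In `hJ` the first alternative says that the two crossings have different slopes; the second
one is needed for the pivot of a rotating family, where the vertex stays fixed. -/
theorem jumpRep_corner {w : ℝ → ℝ} {w₀ τ : ℝ} (hw : Tendsto w (𝓝[≠] 0) (𝓝 w₀))
    {g₀ g₁ : ℝ × ℝ → ℝ}
    (hg₀ : ContDiffAt ℝ 1 g₀ (0, τ)) (h0 : g₀ (0, τ) = 0) (hd₀ : fderiv ℝ g₀ (0, τ) (0, 1) ≠ 0)
    (hg₁ : ContDiffAt ℝ 1 g₁ (0, τ)) (h1 : g₁ (0, τ) = 0) (hd₁ : fderiv ℝ g₁ (0, τ) (0, 1) ≠ 0)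
    (hJ : fderiv ℝ g₀ (0, τ) (1, 0) * fderiv ℝ g₁ (0, τ) (0, 1) ≠
        fderiv ℝ g₁ (0, τ) (1, 0) * fderiv ℝ g₀ (0, τ) (0, 1) ∨
      ∀ᶠ l in 𝓝 (0 : ℝ), g₀ (l, τ) = 0 ∧ g₁ (l, τ) = 0)
    {A : ℝ → ℝ → ℝ} {a b b' c : ℝ}
    (hA : ∀ᶠ z : ℝ × ℝ in 𝓝 (0, τ), (0 < g₀ z → 0 < g₁ z → A z.1 z.2 = a) ∧
      (0 < g₀ z → g₁ z < 0 → A z.1 z.2 = b) ∧ (g₀ z < 0 → 0 < g₁ z → A z.1 z.2 = b') ∧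
      (g₀ z < 0 → g₁ z < 0 → A z.1 z.2 = c)) :
    ∃ j₁ j₂, JumpRep w A τ (w₀ * j₁) (w₀ * j₂) ∧
      (fderiv ℝ g₀ (0, τ) (1, 0) * fderiv ℝ g₁ (0, τ) (0, 1) ≠
        fderiv ℝ g₁ (0, τ) (1, 0) * fderiv ℝ g₀ (0, τ) (0, 1) → a - b - b' + c ≠ 0 → j₁ ≠ j₂) := by
  obtain ⟨p₀, hp₀, hp₀0, hp₀d, hev₀⟩ := exists_implicit one_ne_zero hg₀ h0 hd₀
  obtain ⟨p₁, hp₁, hp₁0, hp₁d, hev₁⟩ := exists_implicit one_ne_zero hg₁ h1 hd₁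
  obtain ⟨σ₀, e₀, hσ₀0, hσ₀⟩ := exists_affine_step hd₀
  obtain ⟨σ₁, e₁, hσ₁0, hσ₁⟩ := exists_affine_step hd₁
  have hmax : ∃ m₁ m₂, IsCrossing w (fun l => max (p₀ l) (p₁ l)) τ (w₀ * m₁) (w₀ * m₂) ∧
      (fderiv ℝ g₀ (0, τ) (1, 0) * fderiv ℝ g₁ (0, τ) (0, 1) ≠
        fderiv ℝ g₁ (0, τ) (1, 0) * fderiv ℝ g₀ (0, τ) (0, 1) → m₁ ≠ m₂) := by
    rcases lt_trichotomy (deriv p₀ 0) (deriv p₁ 0) with h | h | h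
    · exact ⟨_, _, isCrossing_max hw hp₀ hp₁ hp₀0 hp₁0 h, fun _ => h.ne⟩
    -- Equal slopes leave only the fixed vertex: both crossings are then constantly τ near 0, and so
    -- is their maximum.
    · have hJ' : ¬ (fderiv ℝ g₀ (0, τ) (1, 0) * fderiv ℝ g₁ (0, τ) (0, 1) ≠
          fderiv ℝ g₁ (0, τ) (1, 0) * fderiv ℝ g₀ (0, τ) (0, 1)) := by
        rw [hp₀d, hp₁d, div_eq_div_iff hd₀ hd₁] at h
        rw [not_ne_iff]
        linarith
      refine ⟨deriv p₀ 0, deriv p₀ 0, ?_, fun h' => absurd h' hJ'⟩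
      have hJ'' := hJ.resolve_left hJ'
      have htend : Tendsto (fun l : ℝ => (l, τ)) (𝓝 0) (𝓝 (0, τ)) :=
        (Continuous.prodMk continuous_id continuous_const).tendsto 0
      refine (isCrossing_of_contDiffAt hw hp₀ hp₀0).congr ?_
      filter_upwards [htend.eventually hev₀, htend.eventually hev₁, hJ''] with l a0 a1 ⟨b0, b1⟩
      rw [← a0.1.1 b0, ← a1.1.1 b1, max_self]
    · obtain hm := isCrossing_max hw hp₁ hp₀ hp₁0 hp₀0 h
      refine ⟨_, _, ?_, fun _ => h.ne⟩
      simpa only [max_comm] using hm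
  obtain ⟨m₁, m₂, hm, hmne⟩ := hmax
  -- With I₀, I₁ the indicators of g₀ > 0 and g₁ > 0, A = c + (b - c) I₀ + (b' - c) I₁ + (a - b - b'
  -- + c) I₀ I₁. Inserting I = e + σ * step, the constants B₀, B₁, B₂ are the coefficients of the
  -- two steps and of their product.
  set B₀ := (b - c) * σ₀ + (a - b - b' + c) * (e₁ * σ₀) with hB₀
  set B₁ := (b' - c) * σ₁ + (a - b - b' + c) * (e₀ * σ₁) with hB₁
  set B₂ := (a - b - b' + c) * (σ₀ * σ₁) with hB₂
  refine ⟨B₀ * deriv p₀ 0 + B₁ * deriv p₁ 0 + B₂ * m₁, B₀ * deriv p₀ 0 + B₁ * deriv p₁ 0 + B₂ * m₂,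
    ⟨Fin 3, inferInstance, c + (b - c) * e₀ + (b' - c) * e₁ + (a - b - b' + c) * (e₀ * e₁),
    ![B₀, B₁, B₂], ![w₀ * deriv p₀ 0, w₀ * deriv p₁ 0, w₀ * m₁],
    ![w₀ * deriv p₀ 0, w₀ * deriv p₁ 0, w₀ * m₂],
    ![p₀, p₁, fun l => max (p₀ l) (p₁ l)], ?_, ?_, ?_, ?_⟩, ?_⟩
  · intro i
    fin_cases i
    · exact isCrossing_of_contDiffAt hw hp₀ hp₀0
    · exact isCrossing_of_contDiffAt hw hp₁ hp₁0
    · exact hm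
  · filter_upwards [hA, hev₀, hev₁] with z hz ⟨hz0, hz1⟩ ⟨hy0, hy1⟩ hne
    have n0 : z.2 ≠ p₀ z.1 := hne 0
    have n1 : z.2 ≠ p₁ z.1 := hne 1
    have g0 : g₀ z ≠ 0 := fun h => n0 (hz0.1 h)
    have g1 : g₁ z ≠ 0 := fun h => n1 (hy0.1 h)
    have s0 : g₀ z < 0 → e₀ + σ₀ * step (p₀ z.1) z.2 = 0 := fun h =>
      (hσ₀ (p₀ z.1) z.2).2 (lt_of_le_of_ne (not_lt.1 fun h' => (lt_asymm h (hz1.2 h')))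
        (mul_ne_zero hd₀ (sub_ne_zero.2 n0)))
    have s1 : g₁ z < 0 → e₁ + σ₁ * step (p₁ z.1) z.2 = 0 := fun h =>
      (hσ₁ (p₁ z.1) z.2).2 (lt_of_le_of_ne (not_lt.1 fun h' => (lt_asymm h (hy1.2 h')))
        (mul_ne_zero hd₁ (sub_ne_zero.2 n1)))
    have t0 : 0 < g₀ z → e₀ + σ₀ * step (p₀ z.1) z.2 = 1 := fun h =>
      (hσ₀ (p₀ z.1) z.2).1 (hz1.1 h)
    have t1 : 0 < g₁ z → e₁ + σ₁ * step (p₁ z.1) z.2 = 1 := fun h =>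
      (hσ₁ (p₁ z.1) z.2).1 (hy1.1 h)
    have key : A z.1 z.2 = c + (b - c) * (e₀ + σ₀ * step (p₀ z.1) z.2) +
        (b' - c) * (e₁ + σ₁ * step (p₁ z.1) z.2) + (a - b - b' + c) *
        ((e₀ + σ₀ * step (p₀ z.1) z.2) * (e₁ + σ₁ * step (p₁ z.1) z.2)) := by
      rcases lt_or_gt_of_ne g0 with h | h <;> rcases lt_or_gt_of_ne g1 with h' | h'
      · rw [hz.2.2.2 h h', s0 h, s1 h']; ring
      · rw [hz.2.2.1 h h', s0 h, t1 h']; ring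
      · rw [hz.2.1 h h', t0 h, s1 h']; ring
      · rw [hz.1 h h', t0 h, t1 h']; ring
    rw [key]
    simp only [Fin.sum_univ_three, Matrix.cons_val_zero, Matrix.cons_val_one, Matrix.cons_val]
    rw [step_max]
    ring
  · simp only [Fin.sum_univ_three, Matrix.cons_val_zero, Matrix.cons_val_one, Matrix.cons_val]
    ring
  · simp only [Fin.sum_univ_three, Matrix.cons_val_zero, Matrix.cons_val_one, Matrix.cons_val]
    ring
  · intro hne hcc heq
    exact hmne hne (mul_left_cancel₀ (mul_ne_zero hcc (mul_ne_zero hσ₀0 hσ₁0)) (by linarith))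

/-! ### Crossings at a tangency. -/

/-- Since `√l = 0` for negative l, the crossing is constant on the left; on the right the weight
exactly cancels the factor 1 / √l of its derivative. -/
theorem isCrossing_comp_sqrt {κ : ℝ → ℝ} (hκ : ContDiffAt ℝ 1 κ 0) (h0 : κ 0 = 0) (ε : ℝ) :
    IsCrossing (fun l => √|l|) (fun l => κ (ε * √l)) 0 0 (ε * deriv κ 0 / 2) := by
  have hc : ContinuousAt (fun l : ℝ => ε * √l) 0 := by fun_prop
  have ht : Tendsto (fun l : ℝ => ε * √l) (𝓝 0) (𝓝 0) := by simpa using hc.tendsto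
  have hκe : ∀ᶠ l in 𝓝 (0 : ℝ), ContDiffAt ℝ 1 κ (ε * √l) :=
    ht.eventually (hκ.eventually (by simp))
  have hneg : ∀ l < (0 : ℝ), (fun l => κ (ε * √l)) =ᶠ[𝓝 l] fun _ => 0 := by
    intro l hl
    filter_upwards [Iio_mem_nhds hl] with y hy
    rw [Real.sqrt_eq_zero_of_nonpos (le_of_lt hy), mul_zero, h0]
  refine ⟨by simp [h0], ?_, ?_, ?_, ?_⟩
  · exact ContinuousAt.comp (g := κ) (by simpa using hκ.continuousAt) hc
  · filter_upwards [eventually_nhdsWithin_of_eventually_nhds hκe, self_mem_nhdsWithin] with l hl hne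
    rcases lt_or_gt_of_ne (show l ≠ 0 from hne) with h | h
    · exact contDiffAt_const.congr_of_eventuallyEq (hneg l h)
    · exact ContDiffAt.comp l hl (contDiffAt_const.mul (contDiffAt_id.sqrt h.ne'))
  · refine tendsto_const_nhds.congr' ?_
    filter_upwards [self_mem_nhdsWithin] with l hl
    rw [(hneg l hl).deriv_eq]
    simp
  · have hd : Tendsto (deriv κ) (𝓝 0) (𝓝 (deriv κ 0)) :=
      (hκ.derivWithin (m := 0) (by norm_num)).continuousAt.tendsto
    have hlim : Tendsto (fun l => ε * deriv κ (ε * √l) / 2) (𝓝[>] 0) (𝓝 (ε * deriv κ 0 / 2)) :=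
      (((hd.comp ht).const_mul ε).div_const 2).mono_left nhdsWithin_le_nhds
    refine hlim.congr' ?_
    filter_upwards [nhdsWithin_le_nhds hκe, self_mem_nhdsWithin] with l hl (hl0 : 0 < l)
    have h1 : HasDerivAt (fun l : ℝ => ε * √l) (ε * (1 / (2 * √l))) l :=
      (Real.hasDerivAt_sqrt hl0.ne').const_mul ε
    have h2 := (hl.differentiableAt one_ne_zero).hasDerivAt.comp l h1
    have h3 : deriv (fun l => κ (ε * √l)) l = _ := h2.deriv
    rw [h3, abs_of_pos hl0]
    have := Real.sqrt_pos.2 hl0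
    field_simp

theorem IsCrossing.comp_neg {w p : ℝ → ℝ} {τ q₁ q₂ : ℝ} (hw : ∀ l, w (-l) = w l)
    (h : IsCrossing w p τ q₁ q₂) : IsCrossing w (fun l => p (-l)) τ (-q₂) (-q₁) := by
  have hder : ∀ l, deriv (fun l => p (-l)) l = -deriv p (-l) := fun l => by
    rw [deriv_comp_neg]
  have ht : Tendsto (fun l : ℝ => -l) (𝓝[≠] 0) (𝓝[≠] 0) := by
    refine tendsto_nhdsWithin_iff.2 ⟨?_, ?_⟩
    · have := (continuous_neg (G := ℝ)).tendsto 0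
      rw [neg_zero] at this
      exact this.mono_left nhdsWithin_le_nhds
    · filter_upwards [self_mem_nhdsWithin] with l hl
      simpa using hl
  refine ⟨by simp [h.map_zero], ?_, ?_, ?_, ?_⟩
  · have : ContinuousAt p (-0) := by simpa using h.continuousAt
    exact ContinuousAt.comp (f := fun l : ℝ => -l) this continuousAt_neg
  · filter_upwards [ht.eventually h.contDiffAt] with l hl
    exact ContDiffAt.comp (f := fun l : ℝ => -l) l hl contDiffAt_id.neg
  · have : Tendsto (fun l : ℝ => -l) (𝓝[<] 0) (𝓝[>] 0) := by simpa using tendsto_neg_nhdsLT (a := (0:ℝ))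
    refine ((h.tendsto_right.comp this).neg).congr fun l => ?_
    simp [hder, hw]
  · have : Tendsto (fun l : ℝ => -l) (𝓝[>] 0) (𝓝[<] 0) := by simpa using tendsto_neg_nhdsGT (a := (0:ℝ))
    refine ((h.tendsto_left.comp this).neg).congr fun l => ?_
    simp [hder, hw]

theorem JumpRep.comp_neg {w : ℝ → ℝ} {A : ℝ → ℝ → ℝ} {τ J₁ J₂ : ℝ} (hw : ∀ l, w (-l) = w l)
    (h : JumpRep w A τ J₁ J₂) : JumpRep w (fun l r => A (-l) r) τ (-J₂) (-J₁) := by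
  obtain ⟨ι, _, C, β, q₁, q₂, p, hp, hA, h₁, h₂⟩ := h
  refine ⟨ι, inferInstance, C, β, fun i => -q₂ i, fun i => -q₁ i, fun i l => p i (-l),
    fun i => (hp i).comp_neg hw, ?_, by simp [← h₂], by simp [← h₁]⟩
  have ht : Tendsto (fun z : ℝ × ℝ => (-z.1, z.2)) (𝓝 (0, τ)) (𝓝 (0, τ)) := by
    have : Continuous (fun z : ℝ × ℝ => (-z.1, z.2)) := by fun_prop
    simpa using this.tendsto (0, τ)
  exact ht.eventually hA

/-- Writing h = k² with a C¹ coordinate k, the region h(u) < μ is the interval between κ(-√μ) and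
κ(√μ), where κ inverts k. Its indicator is a difference of two steps, which cancel for μ < 0 because
both roots are then 0. -/
theorem jumpRep_fold_of_pos {h : ℝ → ℝ} (hh : ContDiffAt ℝ 2 h 0) (h0 : h 0 = 0)
    (h1 : deriv h 0 = 0) (h2 : 0 < deriv (deriv h) 0) :
    ∃ J, J ≠ 0 ∧ ∀ (A : ℝ → ℝ → ℝ) (c c' : ℝ), (∀ᶠ z : ℝ × ℝ in 𝓝 (0, 0),
      (h z.2 < z.1 → A z.1 z.2 = c) ∧ (z.1 < h z.2 → A z.1 z.2 = c')) →
      JumpRep (fun l => √|l|) A 0 0 ((c - c') * J) := by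
  obtain ⟨k, hk, hk0, hk1, hkh⟩ := exists_sq_eq hh h0 h1 h2
  have hkd := (hk.differentiableAt one_ne_zero).hasDerivAt
  have hg : ContDiffAt ℝ 1 (fun z : ℝ × ℝ => k z.2 - z.1) (0, 0) :=
    (ContDiffAt.comp (g := k) (f := Prod.snd) (0, 0) hk contDiffAt_snd).sub contDiffAt_fst
  have hgd : HasFDerivAt (fun z : ℝ × ℝ => k z.2 - z.1)
      (deriv k 0 • ContinuousLinearMap.snd ℝ ℝ ℝ - ContinuousLinearMap.fst ℝ ℝ ℝ) (0, 0) :=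
    (HasDerivAt.comp_hasFDerivAt (h₂ := k) (f := Prod.snd) (0, 0) hkd hasFDerivAt_snd).sub
      hasFDerivAt_fst
  obtain ⟨κ, hκ, hκ0, hκd, hev⟩ := exists_implicit one_ne_zero hg (by simp [hk0])
    (by rw [hgd.fderiv]; simpa using hk1.ne')
  rw [hgd.fderiv] at hκd hev
  simp only [sub_apply, smul_apply,
    ContinuousLinearMap.coe_snd', ContinuousLinearMap.coe_fst', smul_eq_mul, mul_zero, mul_one,
    zero_sub, sub_zero, neg_neg] at hκd hev
  -- The crossings have weighted slopes ∓κ'(0)/2 and opposite coefficients, so their contributions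
  -- add up instead of cancelling.
  refine ⟨-deriv κ 0, by rw [hκd, neg_ne_zero]; positivity, fun A c c' hA => ?_⟩
  refine ⟨Fin 2, inferInstance, c', ![c - c', -(c - c')], ![0, 0],
    ![-1 * deriv κ 0 / 2, 1 * deriv κ 0 / 2],
    ![fun l => κ (-1 * √l), fun l => κ (1 * √l)], ?_, ?_, by simp, ?_⟩
  · intro i
    fin_cases i
    · exact isCrossing_comp_sqrt hκ hκ0 (-1)
    · exact isCrossing_comp_sqrt hκ hκ0 1
  · have ht : ∀ ε : ℝ, Tendsto (fun z : ℝ × ℝ => (ε * √z.1, z.2)) (𝓝 (0, 0)) (𝓝 (0, 0)) := by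
      intro ε
      have : Continuous (fun z : ℝ × ℝ => (ε * √z.1, z.2)) := by fun_prop
      simpa using this.tendsto (0, 0)
    have hkh' : ∀ᶠ z : ℝ × ℝ in 𝓝 (0, 0), h z.2 = k z.2 ^ 2 :=
      (continuousAt_snd (p := ((0 : ℝ), (0 : ℝ)))).tendsto.eventually hkh
    filter_upwards [hA, hkh', (ht (-1)).eventually hev, (ht 1).eventually hev]
      with z hz hzk ⟨e1, e2⟩ ⟨e3, e4⟩ hne
    have n1 : z.2 ≠ κ (-1 * √z.1) := hne 0
    have n2 : z.2 ≠ κ (1 * √z.1) := hne 1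
    simp only [Fin.sum_univ_two, Matrix.cons_val_zero, Matrix.cons_val_one]
    have e1' : k z.2 - -1 * √z.1 ≠ 0 := fun hh => n1 (e1.1 hh)
    have e3' : k z.2 - 1 * √z.1 ≠ 0 := fun hh => n2 (e3.1 hh)
    simp only [one_mul, neg_one_mul] at *
    rw [mul_pos_iff_of_pos_left hk1] at e2 e4
    have s1 : step (κ (-√z.1)) z.2 = if 0 < k z.2 - -√z.1 then 1 else 0 := by
      simp only [step, e2, sub_pos]
    have s2 : step (κ (√z.1)) z.2 = if 0 < k z.2 - √z.1 then 1 else 0 := by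
      simp only [step, e4, sub_pos]
    rw [s1, s2]
    have hs := Real.sqrt_nonneg z.1
    rcases lt_trichotomy (h z.2) z.1 with hlt | heq | hgt
    · rw [hz.1 hlt]
      have : |k z.2| < √z.1 := Real.lt_sqrt_of_sq_lt (by rwa [sq_abs, ← hzk])
      rw [abs_lt] at this
      rw [if_pos (by linarith), if_neg (by linarith)]
      ring
    · exfalso
      have : |k z.2| = √z.1 := by rw [← heq, hzk, Real.sqrt_sq_eq_abs]
      rcases abs_eq hs |>.1 this with h' | h'
      · exact e3' (by linarith)
      · exact e1' (by linarith)
    · rw [hz.2 hgt]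
      have : √z.1 ≤ |k z.2| := by
        rw [← Real.sqrt_sq_eq_abs, ← hzk]
        exact Real.sqrt_le_sqrt hgt.le
      rcases le_abs.1 this with h' | h'
      · have : 0 < k z.2 - √z.1 := lt_of_le_of_ne (by linarith) (Ne.symm e3')
        rw [if_pos (by linarith), if_pos this]
        ring
      · have : k z.2 - -√z.1 < 0 := lt_of_le_of_ne (by linarith) e1'
        rw [if_neg (by linarith), if_neg (by linarith)]
        ring
  · simp only [Fin.sum_univ_two, Matrix.cons_val_zero, Matrix.cons_val_one]
    ring

/-- Jumps of a function determined by the side of a curve `μ = h u` with a fold at `0`. -/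
theorem jumpRep_fold {h : ℝ → ℝ} (hh : ContDiffAt ℝ 2 h 0) (h0 : h 0 = 0)
    (h1 : deriv h 0 = 0) (h2 : deriv (deriv h) 0 ≠ 0) :
    ∃ J₁ J₂ : ℝ, (J₁ = 0 ∧ J₂ ≠ 0 ∨ J₁ ≠ 0 ∧ J₂ = 0) ∧ ∀ (A : ℝ → ℝ → ℝ) (c c' : ℝ),
      (∀ᶠ z : ℝ × ℝ in 𝓝 (0, 0),
        (h z.2 < z.1 → A z.1 z.2 = c) ∧ (z.1 < h z.2 → A z.1 z.2 = c')) →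
      JumpRep (fun l => √|l|) A 0 ((c - c') * J₁) ((c - c') * J₂) := by
  rcases lt_or_gt_of_ne h2 with h2 | h2
  -- Reflecting μ turns h into -h and exchanges the two sides of the curve as well as the two
  -- one-sided limits.
  · have hn : deriv (fun u => -h u) = fun u => -deriv h u := by
      ext u; exact deriv.fun_neg
    obtain ⟨J, hJ, hA⟩ := jumpRep_fold_of_pos (h := fun u => -h u) hh.neg (by simp [h0])
      (by simp [hn, h1]) (by rw [hn, deriv.fun_neg]; linarith)
    refine ⟨J, 0, .inr ⟨hJ, rfl⟩, fun A c c' h' => ?_⟩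
    have ht : Tendsto (fun z : ℝ × ℝ => (-z.1, z.2)) (𝓝 (0, 0)) (𝓝 (0, 0)) := by
      have : Continuous (fun z : ℝ × ℝ => (-z.1, z.2)) := by fun_prop
      simpa using this.tendsto (0, 0)
    have := (hA (fun l r => A (-l) r) c' c (by
      filter_upwards [ht.eventually h'] with z hz
      exact ⟨fun hlt => hz.2 (by linarith), fun hlt => hz.1 (by linarith)⟩)).comp_neg
      (by simp)
    simp only [neg_neg, neg_zero] at this
    rw [mul_zero]
    convert this using 1
    ring
  · obtain ⟨J, hJ, hA⟩ := jumpRep_fold_of_pos hh h0 h1 h2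
    refine ⟨0, J, .inl ⟨rfl, hJ⟩, fun A c c' h' => ?_⟩
    rw [mul_zero]
    exact hA A c c' h'

/-- Jumps of a function determined by the side of the curve `u μ = h u`, for vanishing weight. -/
theorem jumpRep_cross {w h : ℝ → ℝ} (hw : Tendsto w (𝓝[≠] 0) (𝓝 0)) (hh : ContDiffAt ℝ 2 h 0)
    (h0 : h 0 = 0) (h1 : deriv h 0 = 0) (h2 : deriv (deriv h) 0 ≠ 0)
    {A : ℝ → ℝ → ℝ} {c c' : ℝ} (hA : ∀ᶠ z : ℝ × ℝ in 𝓝 (0, 0),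
        (h z.2 < z.2 * z.1 → A z.1 z.2 = c) ∧ (z.2 * z.1 < h z.2 → A z.1 z.2 = c')) :
    JumpRep w A 0 0 0 := by
  obtain ⟨m, hm, hm0, hm1, hhm⟩ := exists_mul_eq hh h0 h1
  have hmd := (hm.differentiableAt one_ne_zero).hasDerivAt
  have hg : ContDiffAt ℝ 1 (fun z : ℝ × ℝ => z.1 - m z.2) (0, 0) :=
    contDiffAt_fst.sub (ContDiffAt.comp (g := m) (f := Prod.snd) (0, 0) hm contDiffAt_snd)
  have hgd : HasFDerivAt (fun z : ℝ × ℝ => z.1 - m z.2)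
      (ContinuousLinearMap.fst ℝ ℝ ℝ - deriv m 0 • ContinuousLinearMap.snd ℝ ℝ ℝ) (0, 0) :=
    hasFDerivAt_fst.sub
      (HasDerivAt.comp_hasFDerivAt (h₂ := m) (f := Prod.snd) (0, 0) hmd hasFDerivAt_snd)
  have hsd : HasFDerivAt (fun z : ℝ × ℝ => z.2) (ContinuousLinearMap.snd ℝ ℝ ℝ) (0, 0) :=
    hasFDerivAt_snd
  -- With h(u) = u m(u) the side of the curve is the sign of u (μ - m(u)): a four-region
  -- configuration with equal values in opposite regions. As m'(0) = h''(0)/2 ≠ 0, both factors can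
  -- be solved for u, and the weight kills the bounded slopes.
  obtain ⟨j₁, j₂, hj, -⟩ := jumpRep_corner hw (g₀ := fun z => z.2) (g₁ := fun z => z.1 - m z.2)
    (A := A) (a := c) (b := c') (b' := c') (c := c) contDiffAt_snd rfl
    (by rw [hsd.fderiv]; simp) hg (by simp [hm0])
    (by rw [hgd.fderiv]; simpa [hm1] using h2) (.inl (by rw [hgd.fderiv, hsd.fderiv]; simp))
    (by
      filter_upwards [hA] with z hz
      rw [hhm] at hz
      refine ⟨fun a b => hz.1 ?_, fun a b => hz.2 ?_, fun a b => hz.2 ?_, fun a b => hz.1 ?_⟩ <;>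
      nlinarith)
  simpa using hj

/-- A line turned by the angle l about a pivot has slope tan l, and its point r lies at u = r cos l
- τ along the original line, counted from the point τ. A crossing u = p(tan l) thus becomes r = (τ +
p(tan l)) / cos l. As √|sin l| = √(cos l) √|tan l| and cos l → 1, the weighted slopes have the same
limits; the term from differentiating 1 / cos l is negligible. -/
theorem IsCrossing.polar {p : ℝ → ℝ} {q₁ q₂ : ℝ} (h : IsCrossing (fun l => √|l|) p 0 q₁ q₂) (τ : ℝ) :
    IsCrossing (fun l => √|sin l|) (fun l => (τ + p (tan l)) / cos l) τ q₁ q₂ := by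
  have hcos : ∀ᶠ l in 𝓝 (0 : ℝ), 0 < cos l :=
    continuous_cos.continuousAt.eventually (lt_mem_nhds (by simp))
  have hsin : Tendsto (fun l => sin l) (𝓝 0) (𝓝 0) := by simpa using continuous_sin.tendsto 0
  have hcost : Tendsto (fun l => cos l) (𝓝 0) (𝓝 1) := by simpa using continuous_cos.tendsto 0
  have htan : HasDerivAt tan 1 0 := by simpa using Real.hasDerivAt_tan (x := 0) (by simp)
  have ht : Tendsto tan (𝓝 0) (𝓝 0) := by simpa using htan.continuousAt.tendsto
  have hslope : ∀ᶠ l in 𝓝[≠] (0 : ℝ), 0 < tan l / l := by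
    have := htan.tendsto_slope.eventually (lt_mem_nhds one_pos)
    filter_upwards [this] with l hl
    simpa [slope_def_field] using hl
  have htL : Tendsto tan (𝓝[<] 0) (𝓝[<] 0) := by
    refine tendsto_nhdsWithin_iff.2 ⟨ht.mono_left nhdsWithin_le_nhds, ?_⟩
    filter_upwards [nhdsLT_le_nhdsNE 0 hslope, self_mem_nhdsWithin] with l hl (hl0 : l < 0)
    rcases div_pos_iff.1 hl with h | h
    · linarith
    · exact h.1
  have htR : Tendsto tan (𝓝[>] 0) (𝓝[>] 0) := by
    refine tendsto_nhdsWithin_iff.2 ⟨ht.mono_left nhdsWithin_le_nhds, ?_⟩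
    filter_upwards [nhdsGT_le_nhdsNE 0 hslope, self_mem_nhdsWithin] with l hl (hl0 : 0 < l)
    rcases div_pos_iff.1 hl with h | h
    · exact h.1
    · linarith
  have htN : Tendsto tan (𝓝[≠] 0) (𝓝[≠] 0) := by
    refine tendsto_nhdsWithin_iff.2 ⟨ht.mono_left nhdsWithin_le_nhds, ?_⟩
    filter_upwards [hslope] with l hl h0
    rw [mem_singleton_iff.1 h0, zero_div] at hl
    exact lt_irrefl _ hl
  have hCD := htN.eventually h.contDiffAt
  have hder : ∀ᶠ l in 𝓝[≠] (0 : ℝ), √|sin l| * deriv (fun l => (τ + p (tan l)) / cos l) l =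
      √(cos l) * (√|tan l| * deriv p (tan l)) / cos l ^ 3 +
        √|sin l| * (τ + p (tan l)) * sin l / cos l ^ 2 := by
    filter_upwards [hCD, nhdsWithin_le_nhds hcos] with l hl hc
    have h1 := (hl.differentiableAt one_ne_zero).hasDerivAt.comp l (Real.hasDerivAt_tan hc.ne')
    have h2 : deriv (fun l => (τ + p (tan l)) / cos l) l = _ :=
      ((h1.const_add τ).div (Real.hasDerivAt_cos l) hc.ne').deriv
    have h3 : √|sin l| = √(cos l) * √|tan l| := by
      rw [← Real.sqrt_mul hc.le]
      rw [← Real.tan_mul_cos hc.ne', abs_mul, abs_of_pos hc, mul_comm]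
    rw [h2, h3]
    simp only [Function.comp_apply]
    field_simp
    ring
  have hpt : Tendsto (fun l => p (tan l)) (𝓝 0) (𝓝 0) := by
    have := h.continuousAt.tendsto
    rw [h.map_zero] at this
    exact this.comp ht
  have hrest : Tendsto (fun l => √|sin l| * (τ + p (tan l)) * sin l / cos l ^ 2) (𝓝 0) (𝓝 0) := by
    have := ((hsin.abs.sqrt.mul (hpt.const_add τ)).mul hsin).div (hcost.pow 2) (by norm_num)
    simp only [abs_zero, Real.sqrt_zero, add_zero, zero_mul, zero_div] at this
    exact this
  have hfac : Tendsto (fun l => √(cos l)) (𝓝 0) (𝓝 1) := by simpa using hcost.sqrt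
  have hlim : ∀ {s : Set ℝ} {q : ℝ}, s ⊆ {0}ᶜ →
      Tendsto (fun l => √|tan l| * deriv p (tan l)) (𝓝[s] 0) (𝓝 q) →
      Tendsto (fun l => √|sin l| * deriv (fun l => (τ + p (tan l)) / cos l) l) (𝓝[s] 0) (𝓝 q) := by
    intro s q hs hq
    have h1 := (((hfac.mono_left nhdsWithin_le_nhds).mul hq).div
      ((hcost.pow 3).mono_left nhdsWithin_le_nhds) (by norm_num)).add
      (hrest.mono_left (nhdsWithin_le_nhds (s := s)))
    simp only [one_mul, one_pow, div_one, add_zero] at h1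
    refine h1.congr' ?_
    filter_upwards [nhdsWithin_mono _ hs hder] with l hl
    exact hl.symm
  refine ⟨by simp [h.map_zero], ?_, ?_, ?_, ?_⟩
  · have h1 : Tendsto (fun l => (τ + p (tan l)) / cos l) (𝓝 0) (𝓝 ((τ + 0) / 1)) :=
      (hpt.const_add τ).div hcost one_ne_zero
    simpa [ContinuousAt, h.map_zero] using h1
  · filter_upwards [hCD, nhdsWithin_le_nhds hcos] with l hl hc
    exact (contDiffAt_const.add (ContDiffAt.comp l hl (Real.contDiffAt_tan.2 hc.ne'))).div
      Real.contDiff_cos.contDiffAt hc.ne'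
  · exact hlim (fun u (hu : u < 0) => ne_of_lt hu) (h.tendsto_left.comp htL)
  · exact hlim (fun u (hu : 0 < u) => ne_of_gt hu) (h.tendsto_right.comp htR)

theorem JumpRep.polar {A : ℝ → ℝ → ℝ} {J₁ J₂ : ℝ} (h : JumpRep (fun l => √|l|) A 0 J₁ J₂) (τ : ℝ) :
    JumpRep (fun l => √|sin l|) (fun l r => A (tan l) (r * cos l - τ)) τ J₁ J₂ := by
  obtain ⟨ι, _, C, β, q₁, q₂, p, hp, hA, h₁, h₂⟩ := h
  refine ⟨ι, inferInstance, C, β, q₁, q₂, fun i l => (τ + p i (tan l)) / cos l,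
    fun i => (hp i).polar τ, ?_, h₁, h₂⟩
  have ht : Tendsto (fun z : ℝ × ℝ => (tan z.1, z.2 * cos z.1 - τ)) (𝓝 (0, τ)) (𝓝 (0, 0)) := by
    have h1 : ContinuousAt tan 0 := Real.continuousAt_tan.2 (by simp)
    have h2 : ContinuousAt (fun z : ℝ × ℝ => tan z.1) (0, τ) :=
      ContinuousAt.comp (g := tan) (f := Prod.fst) (x := ((0 : ℝ), τ)) h1 continuousAt_fst
    have : ContinuousAt (fun z : ℝ × ℝ => (tan z.1, z.2 * cos z.1 - τ)) (0, τ) := by fun_prop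
    simpa [ContinuousAt] using this
  have hcos : ∀ᶠ z : ℝ × ℝ in 𝓝 (0, τ), 0 < cos z.1 := by
    have : ContinuousAt (fun z : ℝ × ℝ => cos z.1) (0, τ) := by fun_prop
    exact this.eventually (lt_mem_nhds (by simp))
  filter_upwards [ht.eventually hA, hcos] with z hz hc hne
  rw [hz fun i h' => hne i (by rw [eq_div_iff hc.ne']; linarith)]
  congr 1
  refine Finset.sum_congr rfl fun i _ => ?_
  simp only [step, div_lt_iff₀ hc, lt_sub_iff_add_lt']

/-! ### From local to global representations. -/

theorem eventually_step_eq {p : ℝ → ℝ} {r : ℝ} (hp : ContinuousAt p 0) (hr : p 0 ≠ r) :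
    ∀ᶠ z : ℝ × ℝ in 𝓝 (0, r), z.2 ≠ p z.1 ∧ step (p z.1) z.2 = step (p 0) z.2 := by
  have h1 : ContinuousAt (fun z : ℝ × ℝ => p z.1) (0, r) :=
    ContinuousAt.comp (g := p) (f := Prod.fst) (x := ((0 : ℝ), r)) hp continuousAt_fst
  have h2 : ContinuousAt (fun z : ℝ × ℝ => z.2) (0, r) := continuousAt_snd
  have h3 : ContinuousAt (fun _ : ℝ × ℝ => p 0) (0, r) := continuousAt_const
  rcases lt_or_gt_of_ne hr with h | h
  · filter_upwards [h1.eventually_lt h2 h, h3.eventually_lt h2 h] with z a b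
    exact ⟨a.ne', by simp [step, a, b]⟩
  · filter_upwards [h2.eventually_lt h1 h, h2.eventually_lt h3 h] with z a b
    exact ⟨a.ne, by simp [step, not_lt.2 a.le, not_lt.2 b.le]⟩

/-- All crossings of the representation tend to τ, so their steps are locally constant near (0, r)
for r ≠ τ. Consequently the points near which A depends on l are isolated. -/
theorem JumpRep.eventually_eq {w : ℝ → ℝ} {A : ℝ → ℝ → ℝ} {τ J₁ J₂ : ℝ}
    (h : JumpRep w A τ J₁ J₂) :
    ∀ᶠ r in 𝓝[≠] τ, ∀ᶠ z : ℝ × ℝ in 𝓝 (0, r), A z.1 z.2 = A 0 z.2 := by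
  obtain ⟨ι, _, C, β, q₁, q₂, p, hp, hA, h₁, h₂⟩ := h
  have ht : Tendsto (fun r : ℝ => ((0 : ℝ), r)) (𝓝 τ) (𝓝 (0, τ)) :=
    (Continuous.prodMk continuous_const continuous_id).tendsto τ
  filter_upwards [eventually_nhdsWithin_of_eventually_nhds (ht.eventually hA.eventually_nhds),
    self_mem_nhdsWithin] with r hr hne
  have hs : ∀ᶠ z : ℝ × ℝ in 𝓝 (0, r), ∀ i, z.2 ≠ p i z.1 ∧ step (p i z.1) z.2 = step (p i 0) z.2 :=
    eventually_all.2 fun i => eventually_step_eq (hp i).continuousAt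
      (by rw [(hp i).map_zero]; exact Ne.symm hne)
  have ht' : Tendsto (fun z : ℝ × ℝ => ((0 : ℝ), z.2)) (𝓝 (0, r)) (𝓝 (0, r)) := by
    have : Continuous (fun z : ℝ × ℝ => ((0 : ℝ), z.2)) := by fun_prop
    exact this.tendsto (0, r)
  filter_upwards [hr, hs, ht'.eventually hr, ht'.eventually hs] with z a b c d
  rw [a fun i => (b i).1, c fun i => (d i).1]
  simp only [fun i => (b i).2]

/-- Local representations glue to a representation of the difference `A l r - A 0 r` by finitely
many crossings. -/
theorem exists_global_steps {w : ℝ → ℝ} {A : ℝ → ℝ → ℝ} {J₁ J₂ : ℝ → ℝ} {M : ℝ}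
    (hJ : ∀ τ, JumpRep w A τ (J₁ τ) (J₂ τ)) (hAM : ∀ l r, |l| ≤ 1 → M ≤ |r| → A l r = 0) (τ₀ : ℝ) :
    ∃ (S : Finset ℝ) (ι : Type) (_ : Fintype ι) (τ β q₁ q₂ : ι → ℝ) (p : ι → ℝ → ℝ),
      τ₀ ∈ S ∧ (∀ i, IsCrossing w (p i) (τ i) (q₁ i) (q₂ i)) ∧
      (∀ W : ℝ → ℝ, ∑ i, β i * q₁ i * W (τ i) = ∑ s ∈ S, J₁ s * W s) ∧
      (∀ W : ℝ → ℝ, ∑ i, β i * q₂ i * W (τ i) = ∑ s ∈ S, J₂ s * W s) ∧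
      ∀ᶠ l in 𝓝 (0 : ℝ), ∀ r, (∀ i, r ≠ p i l ∧ r ≠ p i 0) →
        A l r - A 0 r = ∑ i, β i * (step (p i l) r - step (p i 0) r) := by
  classical
  -- The points that need crossings. They lie in a compact interval and do not accumulate, hence are
  -- finitely many.
  set Z := {r : ℝ | ¬ ∀ᶠ z : ℝ × ℝ in 𝓝 (0, r), A z.1 z.2 = A 0 z.2} with hZ
  have habs : ∀ r, ∀ᶠ z : ℝ × ℝ in 𝓝 (0, r), |z.1| ≤ 1 := fun r => by
    have : ContinuousAt (fun z : ℝ × ℝ => |z.1|) (0, r) := by fun_prop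
    exact (this.eventually (gt_mem_nhds (show |((0 : ℝ), r).1| < 1 by simp))).mono fun z hz => hz.le
  have hZsub : Z ⊆ Icc (-M) M := by
    intro r hr
    by_contra hcon
    refine hr ?_
    have hMr : M < |r| := by
      by_contra h
      exact hcon (abs_le.1 (not_lt.1 h))
    have : ContinuousAt (fun z : ℝ × ℝ => |z.2|) (0, r) := by fun_prop
    filter_upwards [habs r, this.eventually (lt_mem_nhds hMr)] with z a b
    rw [hAM z.1 z.2 a b.le, hAM 0 z.2 (by simp) b.le]
  have hZfin : Z.Finite := by
    by_contra hinf
    obtain ⟨τ, -, hτ⟩ := Set.Infinite.exists_accPt_of_subset_isCompact hinf isCompact_Icc hZsub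
    rw [accPt_iff_frequently_nhdsNE] at hτ
    exact hτ ((hJ τ).eventually_eq.mono fun r hr => not_not.2 hr)
  -- The point τ₀ is added by force so that its term can always be isolated in sums over S.
  set S : Finset ℝ := insert τ₀ hZfin.toFinset with hS
  choose I hI C β q₁ q₂ p hp hA h₁ h₂ using hJ
  have hsum : ∀ (f : (s : S) → I s → ℝ), ∑ i : (s : S) × I s, f i.1 i.2 = ∑ s : S, ∑ k, f s k :=
    fun f => Fintype.sum_sigma _
  refine ⟨S, (s : S) × I s, inferInstance, fun i => i.1, fun i => β i.1 i.2, fun i => q₁ i.1 i.2,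
    fun i => q₂ i.1 i.2, fun i => p i.1 i.2, Finset.mem_insert_self _ _, fun i => hp i.1 i.2,
    fun W => ?_, fun W => ?_, ?_⟩
  · rw [hsum fun s k => β s k * q₁ s k * W s, ← Finset.sum_coe_sort S]
    refine Finset.sum_congr rfl fun s _ => ?_
    rw [← Finset.sum_mul, h₁]
  · rw [hsum fun s k => β s k * q₂ s k * W s, ← Finset.sum_coe_sort S]
    refine Finset.sum_congr rfl fun s _ => ?_
    rw [← Finset.sum_mul, h₂]
  -- Near r, only the crossings based at r itself contribute a difference; compactness of [-M', M']
  -- then makes the neighbourhood of l = 0 uniform in r.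
  · have hloc : ∀ r, ∀ᶠ z : ℝ × ℝ in 𝓝 (0, r),
        (∀ i : (s : S) × I s, z.2 ≠ p i.1 i.2 z.1 ∧ z.2 ≠ p i.1 i.2 0) → A z.1 z.2 - A 0 z.2 =
          ∑ i : (s : S) × I s, β i.1 i.2 * (step (p i.1 i.2 z.1) z.2 - step (p i.1 i.2 0) z.2) := by
      intro r
      have hother : ∀ᶠ z : ℝ × ℝ in 𝓝 (0, r), ∀ i : (s : S) × I s, (i.1 : ℝ) ≠ r →
          step (p i.1 i.2 z.1) z.2 = step (p i.1 i.2 0) z.2 := by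
        refine eventually_all.2 fun i => ?_
        by_cases hi : (i.1 : ℝ) = r
        · exact Eventually.of_forall fun z h => absurd hi h
        · refine (eventually_step_eq (hp i.1 i.2).continuousAt ?_).mono fun z hz _ => hz.2
          rw [(hp i.1 i.2).map_zero]
          exact hi
      have ht' : Tendsto (fun z : ℝ × ℝ => ((0 : ℝ), z.2)) (𝓝 (0, r)) (𝓝 (0, r)) := by
        have : Continuous (fun z : ℝ × ℝ => ((0 : ℝ), z.2)) := by fun_prop
        exact this.tendsto (0, r)
      by_cases hr : r ∈ S
      · filter_upwards [hother, hA r, ht'.eventually (hA r)] with z a b c hne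
        rw [b fun k => (hne ⟨⟨r, hr⟩, k⟩).1, c fun k => (hne ⟨⟨r, hr⟩, k⟩).2,
          hsum fun s k => β s k * (step (p s k z.1) z.2 - step (p s k 0) z.2),
          Finset.sum_eq_single_of_mem (⟨r, hr⟩ : S) (Finset.mem_univ _)]
        · simp only [mul_sub, Finset.sum_sub_distrib]
          ring
        · intro s _ hs
          refine Finset.sum_eq_zero fun k _ => ?_
          rw [a ⟨s, k⟩ fun h => hs (Subtype.ext h), sub_self, mul_zero]
      · have hrZ : r ∉ Z := fun h => hr (Finset.mem_insert_of_mem (hZfin.mem_toFinset.2 h))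
        filter_upwards [hother, not_not.1 hrZ] with z a b _
        rw [b, sub_self]
        refine (Finset.sum_eq_zero fun i _ => ?_).symm
        rw [a i fun h => hr (h ▸ i.1.2), sub_self, mul_zero]
    -- Larger than M and than every base point: for |r| > M' and small l both sides of the identity
    -- vanish.
    set M' := |M| + 1 + ∑ s ∈ S, |s| with hM'
    have hSM : ∀ s ∈ S, |s| < M' := fun s hs => by
      have := Finset.single_le_sum (f := fun s : ℝ => |s|) (fun s _ => abs_nonneg s) hs
      have := abs_nonneg M
      linarith
    have hMM' : M ≤ M' := by
      have := Finset.sum_nonneg (s := S) (f := fun s : ℝ => |s|) (fun s _ => abs_nonneg s)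
      have := le_abs_self M
      linarith
    have hcomp := (isCompact_Icc (a := -M') (b := M')).eventually_forall_of_forall_eventually
      (P := fun l r => (∀ i : (s : S) × I s, r ≠ p i.1 i.2 l ∧ r ≠ p i.1 i.2 0) → A l r - A 0 r =
          ∑ i : (s : S) × I s, β i.1 i.2 * (step (p i.1 i.2 l) r - step (p i.1 i.2 0) r))
      (x₀ := (0 : ℝ)) (fun r _ => hloc r)
    have hpM : ∀ᶠ l in 𝓝 (0 : ℝ), ∀ i : (s : S) × I s, |p i.1 i.2 l| < M' := by
      refine eventually_all.2 fun i => ?_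
      refine (hp i.1 i.2).continuousAt.abs.eventually (gt_mem_nhds ?_)
      simp only [(hp i.1 i.2).map_zero]
      exact hSM _ i.1.2
    have hl1 : ∀ᶠ l in 𝓝 (0 : ℝ), |l| ≤ 1 :=
      (continuous_abs.continuousAt.eventually (gt_mem_nhds (show |(0 : ℝ)| < 1 by simp))).mono
        fun z hz => hz.le
    filter_upwards [hcomp, hpM, hl1] with l a b c r hne
    by_cases hr : r ∈ Icc (-M') M'
    · exact a r hr hne
    · have hr' : M' < |r| := by
        by_contra h
        exact hr (abs_le.1 (not_lt.1 h))
      rw [hAM l r c (by linarith), hAM 0 r (by simp) (by linarith), sub_self]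
      refine (Finset.sum_eq_zero fun i _ => ?_).symm
      have h1 := abs_lt.1 (b i)
      have h2 := abs_lt.1 (hpM.self_of_nhds i)
      have : step (p i.1 i.2 l) r = step (p i.1 i.2 0) r := by
        rcases lt_abs.1 hr' with h | h
        · rw [step, step, if_pos (by linarith), if_pos (by linarith)]
        · rw [step, step, if_neg (by linarith), if_neg (by linarith)]
      rw [this, sub_self, mul_zero]

/-! ### Integrals of steps. -/

open MeasureTheory in
-- The integral is the signed length of the part beyond t of the interval between p and q; the
-- maxima in the exponent come from here.
theorem setIntegral_step_sub (t p q : ℝ) :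
    IntegrableOn (fun r => step p r - step q r) (Ioi t) ∧
    ∫ r in Ioi t, (step p r - step q r) = max t q - max t p := by
  have key : ∀ p q : ℝ, p ≤ q → IntegrableOn (fun r => step p r - step q r) (Ioi t) ∧
      ∫ r in Ioi t, (step p r - step q r) = max t q - max t p := by
    intro p q hpq
    have h1 : (fun r => step p r - step q r) = indicator (Ioc p q) fun _ => (1 : ℝ) := by
      ext r
      by_cases h1 : p < r <;> by_cases h2 : q < r
      · simp [step, h1, h2]
      · simp [step, indicator, h1, h2, not_lt.1 h2]
      · exact absurd (hpq.trans_lt h2) h1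
      · simp [step, h1, h2]
    rw [h1]
    constructor
    · exact (integrable_indicator_iff measurableSet_Ioc).2 (by simp) |>.integrableOn
    · rw [setIntegral_indicator measurableSet_Ioc, setIntegral_const, inter_comm, Ioc_inter_Ioi,
        Real.volume_real_Ioc]
      simp only [smul_eq_mul, mul_one]
      rcases le_total t p with h | h <;> rcases le_total t q with h' | h' <;>
        simp [h, h', hpq]
      linarith
  rcases le_total p q with h | h
  · exact key p q h
  · have := key q p h
    have e : (fun r => step p r - step q r) = fun r => -(step q r - step p r) := by ext; ring
    rw [e]
    refine ⟨this.1.neg, ?_⟩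
    rw [integral_neg, this.2]
    ring

open MeasureTheory in
theorem setIntegral_sub_of_steps {ι : Type} [Fintype ι] {β p q : ι → ℝ} {a b : ℝ → ℝ}
    (ha : Integrable a) (hb : Integrable b)
    (h : ∀ r, (∀ i, r ≠ p i ∧ r ≠ q i) → a r - b r = ∑ i, β i * (step (p i) r - step (q i) r))
    (t : ℝ) : ∫ r in Ioi t, a r = (∫ r in Ioi t, b r) - ∑ i, β i * (max t (p i) - max t (q i)) := by
  have hae : ∀ᵐ r : ℝ, ∀ i, r ≠ p i ∧ r ≠ q i :=
    eventually_countable_forall.2 fun i =>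
      (Measure.ae_ne volume (p i)).and (Measure.ae_ne volume (q i))
  have h1 : ∫ r in Ioi t, (a r - b r) =
      ∫ r in Ioi t, ∑ i, β i * (step (p i) r - step (q i) r) :=
    integral_congr_ae ((ae_restrict_of_ae hae).mono fun r hr => h r hr)
  rw [integral_sub ha.integrableOn hb.integrableOn, integral_finsetSum _ fun i _ =>
    (setIntegral_step_sub t (p i) (q i)).1.const_mul (β i)] at h1
  simp only [integral_const_mul, (setIntegral_step_sub t _ _).2] at h1
  rw [sub_eq_iff_eq_add] at h1
  rw [h1, add_comm, sub_eq_add_neg, ← Finset.sum_neg_distrib]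
  congr 1
  exact Finset.sum_congr rfl fun i _ => by ring

open MeasureTheory in
theorem continuous_setIntegral_Ioi {a : ℝ → ℝ} (ha : Integrable a) :
    Continuous fun t => ∫ r in Ioi t, a r := by
  have h : (fun t => ∫ r in Ioi t, a r) = fun t => (∫ r in Ioi 0, a r) - ∫ r in (0 : ℝ)..t, a r := by
    ext t
    rw [← intervalIntegral.integral_interval_add_Ioi (a := 0) (b := t) ha.integrableOn
      ha.integrableOn]
    ring
  rw [h]
  exact continuous_const.sub
    (intervalIntegral.continuous_primitive (fun _ _ => ha.intervalIntegrable) 0)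

/-! ### Differentiation under the integral sign. -/

/-- A `C¹` function on `[-1, 1] × ℝ` supported in `[-1, 1] × [-M, M]`. -/
structure StripSupported (F : ℝ × ℝ → ℝ) (M : ℝ) : Prop where
  contDiff : ContDiff ℝ 1 F
  eq_zero : ∀ l t, |l| ≤ 1 → M ≤ |t| → F (l, t) = 0

namespace StripSupported

variable {F : ℝ × ℝ → ℝ} {M : ℝ}

theorem hasDerivAt (hF : StripSupported F M) (l t : ℝ) :
    HasDerivAt (fun l => F (l, t)) (fderiv ℝ F (l, t) (1, 0)) l :=
  ((hF.contDiff.differentiable one_ne_zero (l, t)).hasFDerivAt.comp_hasDerivAt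
    (f := fun l => (l, t)) l ((hasDerivAt_id l).prodMk (hasDerivAt_const l t)))

theorem fderiv_eq_zero (hF : StripSupported F M) {l t : ℝ} (hl : |l| < 1) (ht : M ≤ |t|) :
    fderiv ℝ F (l, t) (1, 0) = 0 := by
  refine (hF.hasDerivAt l t).unique ((hasDerivAt_const l (0 : ℝ)).congr_of_eventuallyEq ?_)
  filter_upwards [continuous_abs.continuousAt.eventually (gt_mem_nhds hl)] with y hy
  exact hF.eq_zero y t hy.le ht

theorem exists_bound (hF : StripSupported F M) : ∃ K, 0 ≤ K ∧
    (∀ l t, |l| ≤ 1 → |F (l, t)| ≤ K) ∧ (∀ l t, |l| < 1 → |fderiv ℝ F (l, t) (1, 0)| ≤ K) := by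
  have hc : IsCompact (Icc (-1 : ℝ) 1 ×ˢ Icc (-M) M) := isCompact_Icc.prod isCompact_Icc
  have hfd : Continuous fun z => fderiv ℝ F z (1, 0) :=
    (hF.contDiff.continuous_fderiv one_ne_zero).clm_apply continuous_const
  obtain ⟨K₁, h₁⟩ := hc.exists_bound_of_continuousOn hF.contDiff.continuous.continuousOn
  obtain ⟨K₂, h₂⟩ := hc.exists_bound_of_continuousOn hfd.continuousOn
  refine ⟨max (max K₁ K₂) 0, le_max_right _ _, fun l t hl => ?_, fun l t hl => ?_⟩
  · by_cases ht : |t| ≤ M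
    · exact (h₁ (l, t) ⟨abs_le.1 hl, abs_le.1 ht⟩).trans ((le_max_left _ _).trans (le_max_left _ _))
    · rw [hF.eq_zero l t hl (not_le.1 ht).le, abs_zero]
      exact le_max_right _ _
  · by_cases ht : |t| ≤ M
    · exact (h₂ (l, t) ⟨abs_le.1 hl.le, abs_le.1 ht⟩).trans
        ((le_max_right _ _).trans (le_max_left _ _))
    · rw [hF.fderiv_eq_zero hl (not_le.1 ht).le, abs_zero]
      exact le_max_right _ _

end StripSupported

/-- The exponent `∑ β (max t p - max t τ)`. -/
noncomputable def maxSum {ι : Type} [Fintype ι] (β τ p : ι → ℝ) (t : ℝ) : ℝ :=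
  ∑ i, β i * (max t (p i) - max t (τ i))

section MaxSum

variable {ι : Type} [Fintype ι] {β τ : ι → ℝ}

theorem continuous_maxSum (p : ι → ℝ) : Continuous (maxSum β τ p) := by
  unfold maxSum
  fun_prop

theorem abs_maxSum_sub_le (p q : ι → ℝ) (t : ℝ) :
    |maxSum β τ p t - maxSum β τ q t| ≤ ∑ i, |β i| * |p i - q i| := by
  unfold maxSum
  rw [← Finset.sum_sub_distrib]
  refine (Finset.abs_sum_le_sum_abs _ _).trans (Finset.sum_le_sum fun i _ => ?_)
  rw [← mul_sub, abs_mul, sub_sub_sub_cancel_right]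
  rw [max_comm t, max_comm t]
  exact mul_le_mul_of_nonneg_left (abs_max_sub_max_le_abs (p i) (q i) t) (abs_nonneg _)

theorem maxSum_self (t : ℝ) : maxSum β τ τ t = 0 := by simp [maxSum]

theorem abs_maxSum_le (p : ι → ℝ) (t : ℝ) : |maxSum β τ p t| ≤ ∑ i, |β i| * |p i - τ i| := by
  simpa [maxSum_self] using abs_maxSum_sub_le (β := β) (τ := τ) p τ t

theorem hasDerivAt_maxSum {p : ι → ℝ → ℝ} {l t : ℝ} (hp : ∀ i, DifferentiableAt ℝ (p i) l)
    (ht : ∀ i, t ≠ p i l) : HasDerivAt (fun l => maxSum β τ (fun i => p i l) t)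
      (∑ i, β i * (deriv (p i) l * step t (p i l))) l := by
  unfold maxSum
  refine HasDerivAt.fun_sum fun i _ => HasDerivAt.const_mul (β i) ?_
  refine HasDerivAt.sub_const _ ?_
  rcases lt_or_gt_of_ne (ht i) with h | h
  · rw [step, if_pos h, mul_one]
    refine (hp i).hasDerivAt.congr_of_eventuallyEq ?_
    filter_upwards [(hp i).continuousAt.eventually (lt_mem_nhds h)] with y hy
    exact max_eq_right hy.le
  · rw [step, if_neg (not_lt.2 h.le), mul_zero]
    refine (hasDerivAt_const l t).congr_of_eventuallyEq ?_
    filter_upwards [(hp i).continuousAt.eventually (gt_mem_nhds h)] with y hy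
    exact max_eq_left hy.le

end MaxSum

theorem abs_exp_sub_exp_le {x y B : ℝ} (hx : x ≤ B) (hy : y ≤ B) :
    |exp x - exp y| ≤ exp B * |x - y| := by
  have := (convex_Iic B).norm_image_sub_le_of_norm_hasDerivWithin_le (f := exp) (f' := exp)
    (C := exp B) (x := y) (y := x) (fun z _ => (Real.hasDerivAt_exp z).hasDerivWithinAt)
    (fun z hz => by rw [Real.norm_eq_abs, abs_of_pos (exp_pos z)]; exact exp_le_exp.2 hz) hy hx
  simpa using this

theorem measurable_step_left (s : ℝ) : Measurable fun t => step t s := by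
  unfold step
  exact Measurable.ite measurableSet_Iio measurable_const measurable_const

theorem abs_step_le (p r : ℝ) : |step p r| ≤ 1 := by
  unfold step; split_ifs <;> simp

section Differentiation

open MeasureTheory

variable {ι : Type} [Fintype ι] {β τ : ι → ℝ} {p : ι → ℝ → ℝ} {F : ℝ × ℝ → ℝ} {M : ℝ} {ρ : ℝ → ℝ}

/-- The pointwise derivative in `l` of `F (l, t) ρ(t) exp (∑ β (max t p(l) - max t τ))`. -/
noncomputable def integrandDeriv (β τ : ι → ℝ) (p : ι → ℝ → ℝ) (F : ℝ × ℝ → ℝ) (ρ : ℝ → ℝ)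
    (l t : ℝ) : ℝ :=
  (fderiv ℝ F (l, t) (1, 0) + F (l, t) * ∑ i, β i * (deriv (p i) l * step t (p i l))) * ρ t *
    exp (maxSum β τ (fun i => p i l) t)

theorem measurable_integrandDeriv (hF : StripSupported F M) (hρ : Continuous ρ) (l : ℝ) :
    Measurable (integrandDeriv β τ p F ρ l) := by
  unfold integrandDeriv
  have h1 : Continuous fun t => fderiv ℝ F (l, t) (1, 0) :=
    ((hF.contDiff.continuous_fderiv one_ne_zero).comp (Continuous.prodMk_right l)).clm_apply
      continuous_const
  have h2 : Continuous fun t => F (l, t) := hF.contDiff.continuous.comp (Continuous.prodMk_right l)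
  have h3 : Measurable fun t => ∑ i, β i * (deriv (p i) l * step t (p i l)) :=
    Finset.measurable_fun_sum _ fun i _ =>
      ((measurable_step_left (p i l)).const_mul _).const_mul _
  exact ((h1.measurable.add (h2.measurable.mul h3)).mul hρ.measurable).mul
    (continuous_maxSum _).rexp.measurable

theorem integrable_indicator_weight (hρ : Continuous ρ) (c : ℝ) :
    Integrable (indicator (Icc (-M) M) fun t => c * |ρ t|) := by
  rw [integrable_indicator_iff measurableSet_Icc]
  exact (hρ.abs.const_mul c).integrableOn_Icc

/-- Although max t (p l) is not differentiable when t = p l, the integrand is Lipschitz in l with an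
integrable constant and differentiable at l₀ for all t outside the finite set of values p i l₀,
which suffices for dominated differentiation. -/
theorem hasDerivAt_weighted_integral (hF : StripSupported F M) (hρ : Continuous ρ) {l₀ : ℝ}
    (hl₀ : |l₀| < 1) (hp : ∀ i, ContDiffAt ℝ 1 (p i) l₀) :
    HasDerivAt (fun l => ∫ t, F (l, t) * ρ t * exp (maxSum β τ (fun i => p i l) t))
      (∫ t, integrandDeriv β τ p F ρ l₀ t) l₀ := by
  obtain ⟨K, hK0, hK1, hK2⟩ := hF.exists_bound
  choose L s hs hL using fun i => (hp i).exists_lipschitzOnWith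
  set Λ := ∑ i, |β i| * (L i : ℝ) with hΛ
  have hΛ0 : 0 ≤ Λ := Finset.sum_nonneg fun i _ => mul_nonneg (abs_nonneg _) (L i).2
  have hev : ∀ᶠ l in 𝓝 l₀, (∀ i, l ∈ s i) ∧ |l - l₀| ≤ 1 ∧ |l| < 1 := by
    refine (eventually_all.2 fun i => hs i).and (Eventually.and ?_ ?_)
    · have : ContinuousAt (fun l => |l - l₀|) l₀ := by fun_prop
      exact (this.eventually (gt_mem_nhds (show |l₀ - l₀| < 1 by simp))).mono fun l h => h.le
    · exact continuous_abs.continuousAt.eventually (gt_mem_nhds hl₀)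
  obtain ⟨δ, hδ, hball⟩ := Metric.eventually_nhds_iff_ball.1 hev
  have hl₀mem : l₀ ∈ Metric.ball l₀ δ := Metric.mem_ball_self hδ
  have hlip : ∀ t, ∀ l ∈ Metric.ball l₀ δ, ∀ l' ∈ Metric.ball l₀ δ,
      |maxSum β τ (fun i => p i l) t - maxSum β τ (fun i => p i l') t| ≤ Λ * |l - l'| := by
    intro t l hl l' hl'
    refine (abs_maxSum_sub_le _ _ t).trans ?_
    rw [hΛ, Finset.sum_mul]
    refine Finset.sum_le_sum fun i _ => ?_
    rw [mul_assoc]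
    gcongr
    simpa [Real.dist_eq] using (hL i).dist_le_mul l ((hball l hl).1 i) l' ((hball l' hl').1 i)
  set B := (∑ i, |β i| * |p i l₀ - τ i|) + Λ with hB
  have hbd : ∀ t, ∀ l ∈ Metric.ball l₀ δ, maxSum β τ (fun i => p i l) t ≤ B := by
    intro t l hl
    have h1 := le_of_abs_le (hlip t l hl l₀ hl₀mem)
    have h2 := le_of_abs_le (abs_maxSum_le (β := β) (τ := τ) (fun i => p i l₀) t)
    have h3 : Λ * |l - l₀| ≤ Λ := mul_le_of_le_one_right hΛ0 (hball l hl).2.1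
    linarith
  have hFlip : ∀ t, ∀ l ∈ Metric.ball l₀ δ, ∀ l' ∈ Metric.ball l₀ δ,
      |F (l, t) - F (l', t)| ≤ K * |l - l'| := by
    intro t l hl l' hl'
    exact (convex_ball l₀ δ).norm_image_sub_le_of_norm_hasDerivWithin_le
      (f := fun l => F (l, t)) (f' := fun l => fderiv ℝ F (l, t) (1, 0))
      (fun z _ => (hF.hasDerivAt z t).hasDerivWithinAt) (fun z hz => hK2 z t (hball z hz).2.2) hl' hl
  have hcont : ∀ l, Continuous fun t => F (l, t) * ρ t * exp (maxSum β τ (fun i => p i l) t) :=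
    fun l => ((hF.contDiff.continuous.comp (Continuous.prodMk_right l)).mul hρ).mul
      (continuous_maxSum _).rexp
  refine (hasDerivAt_integral_of_dominated_loc_of_lip
    (bound := indicator (Icc (-M) M) fun t => (K * exp B + K * (exp B * Λ)) * |ρ t|)
    (F' := integrandDeriv β τ p F ρ l₀) (Metric.ball_mem_nhds l₀ hδ)
    (Eventually.of_forall fun l => (hcont l).aestronglyMeasurable) ?_
    (measurable_integrandDeriv hF hρ l₀).aestronglyMeasurable ?_
    (integrable_indicator_weight hρ _) ?_).2
  · refine (hcont l₀).integrable_of_hasCompactSupport ?_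
    refine HasCompactSupport.intro (isCompact_Icc (a := -M) (b := M)) fun t ht => ?_
    have : M ≤ |t| := by
      by_contra h
      exact ht (abs_le.1 (not_le.1 h).le)
    rw [hF.eq_zero l₀ t hl₀.le this]
    ring
  · refine Eventually.of_forall fun t => LipschitzOnWith.of_dist_le_mul fun l hl l' hl' => ?_
    rw [Real.dist_eq, Real.dist_eq]
    by_cases ht : t ∈ Icc (-M) M
    · rw [indicator_of_mem ht, Real.coe_nnabs,
        abs_of_nonneg (a := (K * exp B + K * (exp B * Λ)) * |ρ t|) (by positivity)]
      set x := maxSum β τ (fun i => p i l) t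
      set y := maxSum β τ (fun i => p i l') t
      have h1 : F (l, t) * ρ t * exp x - F (l', t) * ρ t * exp y =
          ((F (l, t) - F (l', t)) * exp x + F (l', t) * (exp x - exp y)) * ρ t := by ring
      rw [h1, abs_mul]
      have h2 : |(F (l, t) - F (l', t)) * exp x| ≤ K * |l - l'| * exp B := by
        rw [abs_mul, abs_of_pos (exp_pos x)]
        exact mul_le_mul (hFlip t l hl l' hl') (exp_le_exp.2 (hbd t l hl)) (exp_pos _).le
          (by positivity)
      have h3 : |F (l', t) * (exp x - exp y)| ≤ K * (exp B * (Λ * |l - l'|)) := by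
        rw [abs_mul]
        refine mul_le_mul (hK1 l' t (hball l' hl').2.2.le) ?_ (abs_nonneg _) hK0
        refine (abs_exp_sub_exp_le (hbd t l hl) (hbd t l' hl')).trans ?_
        gcongr
        exact hlip t l hl l' hl'
      calc _ ≤ (K * |l - l'| * exp B + K * (exp B * (Λ * |l - l'|))) * |ρ t| := by
            exact mul_le_mul_of_nonneg_right ((abs_add_le _ _).trans (add_le_add h2 h3))
              (abs_nonneg _)
        _ = _ := by ring
    · have : M ≤ |t| := by
        by_contra h
        exact ht (abs_le.1 (not_le.1 h).le)
      rw [hF.eq_zero l t (hball l hl).2.2.le this, hF.eq_zero l' t (hball l' hl').2.2.le this]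
      simp only [zero_mul, sub_self, abs_zero]
      positivity
  · have hae : ∀ᵐ t : ℝ, ∀ i, t ≠ p i l₀ :=
      eventually_countable_forall.2 fun i => Measure.ae_ne volume (p i l₀)
    refine hae.mono fun t ht => ?_
    have h1 := (hasDerivAt_maxSum (β := β) (τ := τ)
      (fun i => (hp i).differentiableAt one_ne_zero) ht).exp
    have h2 := ((hF.hasDerivAt l₀ t).mul_const (ρ t)).mul h1
    refine h2.congr_deriv ?_
    unfold integrandDeriv
    ring

/-- Dominated convergence; the filter is left general so that both one-sided limits are covered. In
the limit the exponential factor becomes 1 because every p i tends to τ i. -/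
theorem tendsto_weighted_integrandDeriv (hF : StripSupported F M) (hρ : Continuous ρ)
    {𝓕 : Filter ℝ} [𝓕.IsCountablyGenerated] (h𝓕 : 𝓕 ≤ 𝓝 0) {w : ℝ → ℝ} {w₀ : ℝ} {q : ι → ℝ}
    (hw : Tendsto w 𝓕 (𝓝 w₀)) (hp : ∀ i, Tendsto (p i) 𝓕 (𝓝 (τ i)))
    (hq : ∀ i, Tendsto (fun l => w l * deriv (p i) l) 𝓕 (𝓝 (q i))) :
    Tendsto (fun l => w l * ∫ t, integrandDeriv β τ p F ρ l t) 𝓕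
      (𝓝 (w₀ * (∫ t, fderiv ℝ F (0, t) (1, 0) * ρ t) +
        ∑ i, β i * q i * ∫ t, F (0, t) * ρ t * step t (τ i))) := by
  obtain ⟨K, hK0, hK1, hK2⟩ := hF.exists_bound
  have hF0 : Continuous fun t => F (0, t) := hF.contDiff.continuous.comp (Continuous.prodMk_right 0)
  have hD0 : Continuous fun t => fderiv ℝ F (0, t) (1, 0) :=
    ((hF.contDiff.continuous_fderiv one_ne_zero).comp (Continuous.prodMk_right 0)).clm_apply
      continuous_const
  have hsupp : ∀ t, t ∉ Icc (-M) M → M ≤ |t| := fun t ht => by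
    by_contra h
    exact ht (abs_le.1 (not_le.1 h).le)
  have hiD : Integrable fun t => fderiv ℝ F (0, t) (1, 0) * ρ t := by
    refine (hD0.mul hρ).integrable_of_hasCompactSupport
      (HasCompactSupport.intro (isCompact_Icc (a := -M) (b := M)) fun t ht => ?_)
    simp only [Pi.mul_apply, hF.fderiv_eq_zero (l := 0) (by simp) (hsupp t ht), zero_mul]
  have hiF : Integrable fun t => F (0, t) * ρ t := by
    refine (hF0.mul hρ).integrable_of_hasCompactSupport
      (HasCompactSupport.intro (isCompact_Icc (a := -M) (b := M)) fun t ht => ?_)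
    simp only [Pi.mul_apply, hF.eq_zero 0 t (by simp) (hsupp t ht), zero_mul]
  have hiS : ∀ i, Integrable fun t => F (0, t) * ρ t * step t (τ i) := fun i =>
    hiF.mul_bdd (c := 1) (measurable_step_left (τ i)).aestronglyMeasurable
      (Eventually.of_forall fun t => abs_step_le _ _)
  have hlimit : w₀ * (∫ t, fderiv ℝ F (0, t) (1, 0) * ρ t) +
        ∑ i, β i * q i * ∫ t, F (0, t) * ρ t * step t (τ i) =
      ∫ t, (w₀ * (fderiv ℝ F (0, t) (1, 0) * ρ t) +
        ∑ i, β i * q i * (F (0, t) * ρ t * step t (τ i))) := by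
    rw [integral_add (hiD.const_mul _) (integrable_finsetSum _ fun i _ => (hiS i).const_mul _),
      integral_const_mul, integral_finsetSum _ fun i _ => (hiS i).const_mul _]
    simp only [integral_const_mul]
  rw [hlimit]
  simp_rw [← integral_const_mul]
  have hwb : ∀ᶠ l in 𝓕, |w l| ≤ |w₀| + 1 :=
    (hw.abs.eventually (gt_mem_nhds (lt_add_one _))).mono fun l h => h.le
  have hqb : ∀ᶠ l in 𝓕, ∀ i, |w l * deriv (p i) l| ≤ |q i| + 1 :=
    eventually_all.2 fun i =>
      ((hq i).abs.eventually (gt_mem_nhds (lt_add_one _))).mono fun l h => h.le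
  have hpb : ∀ᶠ l in 𝓕, ∀ i, |p i l - τ i| ≤ 1 := eventually_all.2 fun i => by
    have : Tendsto (fun l => |p i l - τ i|) 𝓕 (𝓝 0) := by
      simpa using ((hp i).sub_const (τ i)).abs
    exact (this.eventually (gt_mem_nhds one_pos)).mono fun l h => h.le
  have hl1 : ∀ᶠ l in 𝓕, |l| < 1 :=
    h𝓕 (continuous_abs.continuousAt.eventually (gt_mem_nhds (show |(0 : ℝ)| < 1 by simp)))
  set B := ∑ i, |β i| with hB
  set Q := ∑ i, |β i| * (|q i| + 1) with hQ
  have hQ0 : 0 ≤ Q := Finset.sum_nonneg fun i _ => by positivity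
  refine tendsto_integral_filter_of_dominated_convergence
    (indicator (Icc (-M) M) fun t => ((|w₀| + 1) * K + K * Q) * exp B * |ρ t|)
    (Eventually.of_forall fun l =>
      ((measurable_integrandDeriv hF hρ l).const_mul _).aestronglyMeasurable) ?_
    (integrable_indicator_weight hρ _) ?_
  · filter_upwards [hwb, hqb, hpb, hl1] with l h1 h2 h3 h4
    refine Eventually.of_forall fun t => ?_
    by_cases ht : t ∈ Icc (-M) M
    · rw [indicator_of_mem ht]
      unfold integrandDeriv
      -- The weight is moved inside the sum, since the slopes may be unbounded and only their
      -- products with w are controlled.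
      have e1 : w l * ((fderiv ℝ F (l, t) (1, 0) +
          F (l, t) * ∑ i, β i * (deriv (p i) l * step t (p i l))) * ρ t *
          exp (maxSum β τ (fun i => p i l) t)) = (w l * fderiv ℝ F (l, t) (1, 0) +
          F (l, t) * ∑ i, β i * (w l * deriv (p i) l * step t (p i l))) *
          exp (maxSum β τ (fun i => p i l) t) * ρ t := by
        have : ∑ i, β i * (w l * deriv (p i) l * step t (p i l)) =
            w l * ∑ i, β i * (deriv (p i) l * step t (p i l)) := by
          rw [Finset.mul_sum]
          exact Finset.sum_congr rfl fun i _ => by ring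
        rw [this]
        ring
      rw [e1, Real.norm_eq_abs, abs_mul, abs_mul, abs_of_pos (exp_pos _)]
      have e2 : |∑ i, β i * (w l * deriv (p i) l * step t (p i l))| ≤ Q := by
        refine (Finset.abs_sum_le_sum_abs _ _).trans (Finset.sum_le_sum fun i _ => ?_)
        rw [abs_mul, abs_mul]
        gcongr
        exact (mul_le_of_le_one_right (abs_nonneg _) (abs_step_le _ _)).trans (h2 i)
      have e3 : maxSum β τ (fun i => p i l) t ≤ B := by
        refine (le_of_abs_le (abs_maxSum_le _ t)).trans (Finset.sum_le_sum fun i _ => ?_)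
        exact mul_le_of_le_one_right (abs_nonneg _) (h3 i)
      gcongr
      refine (abs_add_le _ _).trans ?_
      rw [abs_mul, abs_mul]
      gcongr
      · exact hK2 l t h4
      · exact hK1 l t h4.le
    · unfold integrandDeriv
      rw [indicator_of_notMem ht, hF.fderiv_eq_zero h4 (hsupp t ht),
        hF.eq_zero l t h4.le (hsupp t ht)]
      simp
  · have hae : ∀ᵐ t : ℝ, ∀ i, t ≠ τ i :=
      eventually_countable_forall.2 fun i => Measure.ae_ne volume (τ i)
    refine hae.mono fun t ht => ?_
    have hstep : ∀ i, Tendsto (fun l => step t (p i l)) 𝓕 (𝓝 (step t (τ i))) := by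
      intro i
      refine tendsto_const_nhds.congr' ?_
      rcases lt_or_gt_of_ne (ht i) with h | h
      · filter_upwards [(hp i).eventually (lt_mem_nhds h)] with l hl
        simp [step, h, hl]
      · filter_upwards [(hp i).eventually (gt_mem_nhds h)] with l hl
        simp [step, not_lt.2 h.le, not_lt.2 hl.le]
    have hmax : Tendsto (fun l => maxSum β τ (fun i => p i l) t) 𝓕 (𝓝 0) := by
      unfold maxSum
      have : Tendsto (fun l => ∑ i, β i * (max t (p i l) - max t (τ i))) 𝓕
          (𝓝 (∑ i, β i * (max t (τ i) - max t (τ i)))) :=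
        tendsto_finsetSum _ fun i _ =>
          (((tendsto_const_nhds (x := t)).max (hp i)).sub_const _).const_mul _
      simpa using this
    have hl0 : Tendsto (fun l : ℝ => (l, t)) 𝓕 (𝓝 (0, t)) :=
      ((Continuous.prodMk continuous_id continuous_const).tendsto 0).mono_left h𝓕
    have hFt : Tendsto (fun l => F (l, t)) 𝓕 (𝓝 (F (0, t))) :=
      (hF.contDiff.continuous.tendsto (0, t)).comp hl0
    have hDt : Tendsto (fun l => fderiv ℝ F (l, t) (1, 0)) 𝓕 (𝓝 (fderiv ℝ F (0, t) (1, 0))) :=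
      (((hF.contDiff.continuous_fderiv one_ne_zero).clm_apply
        (continuous_const (y := ((1 : ℝ), (0 : ℝ))))).tendsto (0, t)).comp hl0
    have hsum : Tendsto (fun l => ∑ i, β i * (w l * deriv (p i) l * step t (p i l))) 𝓕
        (𝓝 (∑ i, β i * (q i * step t (τ i)))) :=
      tendsto_finsetSum _ fun i _ => ((hq i).mul (hstep i)).const_mul _
    have hall := (((hw.mul hDt).add (hFt.mul hsum)).mul_const (ρ t)).mul
      ((Real.continuous_exp.tendsto 0).comp hmax)
    have elim : w₀ * (fderiv ℝ F (0, t) (1, 0) * ρ t) +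
        ∑ i, β i * q i * (F (0, t) * ρ t * step t (τ i)) =
        (w₀ * fderiv ℝ F (0, t) (1, 0) + F (0, t) * ∑ i, β i * (q i * step t (τ i))) * ρ t *
          exp 0 := by
      rw [exp_zero, mul_one, add_mul, mul_assoc, Finset.mul_sum, Finset.sum_mul]
      congr 1
      exact Finset.sum_congr rfl fun i _ => by ring
    rw [elim]
    refine hall.congr fun l => ?_
    unfold integrandDeriv
    have : ∑ i, β i * (w l * deriv (p i) l * step t (p i l)) =
        w l * ∑ i, β i * (deriv (p i) l * step t (p i l)) := by
      rw [Finset.mul_sum]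
      exact Finset.sum_congr rfl fun i _ => by ring
    rw [this, Function.comp]
    ring

end Differentiation

/-! ### One-sided limits of the derivative of an attenuated integral. -/

section Asymptotics

open MeasureTheory

/-- The integral `∫ F (l, t) exp (-∫_t^∞ A l) dt`. -/
noncomputable def attIntegral (F : ℝ × ℝ → ℝ) (A : ℝ → ℝ → ℝ) (l : ℝ) : ℝ :=
  ∫ t, F (l, t) * exp (-∫ r in Ioi t, A l r)

/-- The part of the attenuated integral at `l = 0` coming from `t < s`. -/
noncomputable def partialAttIntegral (F : ℝ × ℝ → ℝ) (A : ℝ → ℝ → ℝ) (s : ℝ) : ℝ :=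
  ∫ t, F (0, t) * exp (-∫ r in Ioi t, A 0 r) * step t s

/-- Attenuations along a family of lines: measurable, bounded, with uniformly bounded support. -/
structure IsAttenuation (A : ℝ → ℝ → ℝ) (M : ℝ) : Prop where
  measurable : ∀ l, Measurable (A l)
  bounded : ∃ K, ∀ l r, |A l r| ≤ K
  eq_zero : ∀ l r, |l| ≤ 1 → M ≤ |r| → A l r = 0

theorem IsAttenuation.integrable {A : ℝ → ℝ → ℝ} {M : ℝ} (hA : IsAttenuation A M) {l : ℝ}
    (hl : |l| ≤ 1) : Integrable (A l) := by
  obtain ⟨K, hK⟩ := hA.bounded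
  have h1 : IntegrableOn (A l) (Icc (-M) M) :=
    Measure.integrableOn_of_bounded (M := K) (by simp) (hA.measurable l).aestronglyMeasurable
      (Eventually.of_forall (hK l))
  refine (integrableOn_iff_integrable_of_support_subset fun r hr => ?_).1 h1
  by_contra h
  exact hr (hA.eq_zero l r hl (by
    by_contra h'
    exact h (abs_le.1 (not_le.1 h').le)))

/-- The regular constant B and the factors `partialAttIntegral F A s` are the same on both sides, so
any asymmetry or singularity must come from the jumps. -/
theorem exists_jump_asymptotics {w : ℝ → ℝ} {w₀ : ℝ} {A : ℝ → ℝ → ℝ} {J₁ J₂ : ℝ → ℝ}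
    {F : ℝ × ℝ → ℝ} {M : ℝ} (hw : Tendsto w (𝓝[≠] 0) (𝓝 w₀)) (hF : StripSupported F M)
    (hA : IsAttenuation A M) (hJ : ∀ τ, JumpRep w A τ (J₁ τ) (J₂ τ)) (τ₀ : ℝ) :
    (∀ᶠ l in 𝓝[≠] 0, DifferentiableAt ℝ (attIntegral F A) l) ∧ ∃ (B : ℝ) (S : Finset ℝ), τ₀ ∈ S ∧
      Tendsto (fun l => w l * deriv (attIntegral F A) l) (𝓝[<] 0)
        (𝓝 (w₀ * B + ∑ s ∈ S, J₁ s * partialAttIntegral F A s)) ∧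
      Tendsto (fun l => w l * deriv (attIntegral F A) l) (𝓝[>] 0)
        (𝓝 (w₀ * B + ∑ s ∈ S, J₂ s * partialAttIntegral F A s)) := by
  obtain ⟨S, ι, _, τ, β, q₁, q₂, p, hS, hp, h₁, h₂, hev⟩ :=
    exists_global_steps hJ hA.eq_zero τ₀
  set ρ : ℝ → ℝ := fun t => exp (-∫ r in Ioi t, A 0 r) with hρdef
  have hρ : Continuous ρ :=
    (continuous_setIntegral_Ioi (hA.integrable (l := 0) (by simp))).neg.rexp
  have hl1 : ∀ᶠ l in 𝓝 (0 : ℝ), |l| < 1 :=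
    continuous_abs.continuousAt.eventually (gt_mem_nhds (show |(0 : ℝ)| < 1 by simp))
  have hG : attIntegral F A =ᶠ[𝓝 0]
      fun l => ∫ t, F (l, t) * ρ t * exp (maxSum β τ (fun i => p i l) t) := by
    filter_upwards [hev, hl1] with l hl hl'
    refine integral_congr_ae (Eventually.of_forall fun t => ?_)
    simp only [hρdef]
    rw [mul_assoc, ← exp_add,
      setIntegral_sub_of_steps (hA.integrable hl'.le) (hA.integrable (l := 0) (by simp)) hl t,
      maxSum]
    simp only [fun i => (hp i).map_zero]
    congr 2
    ring
  have hder : ∀ᶠ l in 𝓝[≠] (0 : ℝ),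
      HasDerivAt (attIntegral F A) (∫ t, integrandDeriv β τ p F ρ l t) l := by
    filter_upwards [eventually_all.2 fun i => (hp i).contDiffAt, nhdsWithin_le_nhds hl1,
      nhdsWithin_le_nhds hG.eventually_nhds] with l a b c
    exact (hasDerivAt_weighted_integral hF hρ b a).congr_of_eventuallyEq c
  refine ⟨hder.mono fun l hl => hl.differentiableAt,
    ∫ t, fderiv ℝ F (0, t) (1, 0) * ρ t, S, hS, ?_, ?_⟩
  · rw [← h₁]
    refine (tendsto_weighted_integrandDeriv hF hρ (𝓕 := 𝓝[<] 0) nhdsWithin_le_nhds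
      (hw.mono_left (nhdsLT_le_nhdsNE 0)) (fun i => ?_) fun i => (hp i).tendsto_left).congr' ?_
    · have := (hp i).continuousAt.tendsto
      rw [(hp i).map_zero] at this
      exact this.mono_left nhdsWithin_le_nhds
    · filter_upwards [nhdsLT_le_nhdsNE 0 hder] with l hl
      rw [hl.deriv]
  · rw [← h₂]
    refine (tendsto_weighted_integrandDeriv hF hρ (𝓕 := 𝓝[>] 0) nhdsWithin_le_nhds
      (hw.mono_left (nhdsGT_le_nhdsNE 0)) (fun i => ?_) fun i => (hp i).tendsto_right).congr' ?_
    · have := (hp i).continuousAt.tendsto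
      rw [(hp i).map_zero] at this
      exact this.mono_left nhdsWithin_le_nhds
    · filter_upwards [nhdsGT_le_nhdsNE 0 hder] with l hl
      rw [hl.deriv]

theorem partialAttIntegral_pos {A : ℝ → ℝ → ℝ} {F : ℝ × ℝ → ℝ} {M : ℝ}
    (hF : StripSupported F M) (hA : IsAttenuation A M) (hF0 : ∀ z, 0 ≤ F z) {s t₀ : ℝ}
    (ht₀ : t₀ < s) (hpos : 0 < F (0, t₀)) : 0 < partialAttIntegral F A s := by
  set ρ : ℝ → ℝ := fun t => exp (-∫ r in Ioi t, A 0 r) with hρdef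
  have hρ : Continuous ρ :=
    (continuous_setIntegral_Ioi (hA.integrable (l := 0) (by simp))).neg.rexp
  have hFc : Continuous fun t => F (0, t) := hF.contDiff.continuous.comp (Continuous.prodMk_right 0)
  have hiF : Integrable fun t => F (0, t) * ρ t := by
    refine (hFc.mul hρ).integrable_of_hasCompactSupport
      (HasCompactSupport.intro (isCompact_Icc (a := -M) (b := M)) fun t ht => ?_)
    simp only [Pi.mul_apply, hF.eq_zero 0 t (by simp) (by
      by_contra h
      exact ht (abs_le.1 (not_le.1 h).le)), zero_mul]
  have hint : Integrable fun t => F (0, t) * ρ t * step t s :=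
    hiF.mul_bdd (c := 1) (measurable_step_left s).aestronglyMeasurable
      (Eventually.of_forall fun t => abs_step_le _ _)
  have hstep0 : ∀ t, 0 ≤ step t s := fun t => by unfold step; split_ifs <;> simp
  refine (integral_pos_iff_support_of_nonneg
    (fun t => mul_nonneg (mul_nonneg (hF0 _) (exp_pos _).le) (hstep0 t)) hint).2 ?_
  have hopen : IsOpen ({t | 0 < F (0, t)} ∩ Iio s) := (isOpen_lt continuous_const hFc).inter isOpen_Iio
  refine lt_of_lt_of_le (hopen.measure_pos volume ⟨t₀, hpos, ht₀⟩) (measure_mono fun t ht => ?_)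
  have h1 : step t s = 1 := if_pos ht.2
  have h2 : 0 < F (0, t) := ht.1
  simp only [Function.mem_support, h1, mul_one]
  exact (mul_pos h2 (exp_pos _)).ne'

/-- All terms of the two limits agree except those at τ₀, whose difference is (J₁ τ₀ - J₂ τ₀) times
a positive integral. -/
theorem attIntegral_derivHasJump {A : ℝ → ℝ → ℝ} {J₁ J₂ : ℝ → ℝ}
    {F : ℝ × ℝ → ℝ} {M : ℝ} (hF : StripSupported F M) (hA : IsAttenuation A M)
    (hF0 : ∀ z, 0 ≤ F z) (hJ : ∀ τ, JumpRep (fun _ => 1) A τ (J₁ τ) (J₂ τ)) {τ₀ t₀ : ℝ}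
    (hne : ∀ τ, τ ≠ τ₀ → J₁ τ = J₂ τ) (hτ₀ : J₁ τ₀ ≠ J₂ τ₀) (ht₀ : t₀ < τ₀)
    (hpos : 0 < F (0, t₀)) : DerivHasJump (attIntegral F A) 0 := by
  obtain ⟨hd, B, S, hS, hL, hR⟩ := exists_jump_asymptotics (w₀ := 1) tendsto_const_nhds hF hA hJ τ₀
  simp only [one_mul] at hL hR
  refine ⟨hd, _, _, hL, hR, fun h => ?_⟩
  rw [← Finset.add_sum_erase S _ hS, ← Finset.add_sum_erase S _ hS] at h
  have : ∑ x ∈ S.erase τ₀, J₁ x * partialAttIntegral F A x =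
      ∑ x ∈ S.erase τ₀, J₂ x * partialAttIntegral F A x :=
    Finset.sum_congr rfl fun x hx => by rw [hne x (Finset.ne_of_mem_erase hx)]
  rw [this] at h
  have h' := partialAttIntegral_pos hF hA hF0 ht₀ hpos
  exact hτ₀ (mul_right_cancel₀ h'.ne' (by linarith))

/-- A weight tending to 0 suppresses the regular term, and only the jump at τ₀ survives. -/
theorem attIntegral_tendsto_of_isolated {w : ℝ → ℝ} {A : ℝ → ℝ → ℝ} {J₁ J₂ : ℝ → ℝ}
    {F : ℝ × ℝ → ℝ} {M : ℝ} (hw : Tendsto w (𝓝[≠] 0) (𝓝 0)) (hF : StripSupported F M)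
    (hA : IsAttenuation A M) (hF0 : ∀ z, 0 ≤ F z) (hJ : ∀ τ, JumpRep w A τ (J₁ τ) (J₂ τ))
    {τ₀ t₀ : ℝ} (hne : ∀ τ, τ ≠ τ₀ → J₁ τ = 0 ∧ J₂ τ = 0) (ht₀ : t₀ < τ₀)
    (hpos : 0 < F (0, t₀)) :
    (∀ᶠ l in 𝓝[≠] 0, DifferentiableAt ℝ (attIntegral F A) l) ∧ ∃ W, 0 < W ∧
      Tendsto (fun l => w l * deriv (attIntegral F A) l) (𝓝[<] 0) (𝓝 (J₁ τ₀ * W)) ∧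
      Tendsto (fun l => w l * deriv (attIntegral F A) l) (𝓝[>] 0) (𝓝 (J₂ τ₀ * W)) := by
  obtain ⟨hd, B, S, hS, hL, hR⟩ := exists_jump_asymptotics hw hF hA hJ τ₀
  refine ⟨hd, partialAttIntegral F A τ₀, partialAttIntegral_pos hF hA hF0 ht₀ hpos, ?_, ?_⟩
  · rwa [zero_mul, zero_add, Finset.sum_eq_single_of_mem τ₀ hS fun x _ hx => by
      rw [(hne x hx).1, zero_mul]] at hL
  · rwa [zero_mul, zero_add, Finset.sum_eq_single_of_mem τ₀ hS fun x _ hx => by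
      rw [(hne x hx).2, zero_mul]] at hR

end Asymptotics

/-! ### Directions in the plane and families of lines. -/

theorem contDiff_dir {n : WithTop ℕ∞} : ContDiff ℝ n dir := by
  unfold dir
  rw [contDiff_euclidean]
  intro i
  fin_cases i <;> simp <;> fun_prop

theorem norm_dir (ω : ℝ) : ‖dir ω‖ = 1 := by
  simp [dir, EuclideanSpace.norm_eq]

theorem norm_dirPerp (ω : ℝ) : ‖dirPerp ω‖ = 1 := by
  simp [dirPerp, EuclideanSpace.norm_eq]

theorem eq_inner_dir_add (v : Plane) (ω : ℝ) :
    v = inner ℝ v (dir ω) • dir ω + inner ℝ v (dirPerp ω) • dirPerp ω := by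
  ext i
  have := sin_sq_add_cos_sq ω
  fin_cases i <;> simp [dir, dirPerp, PiLp.inner_apply, Fin.sum_univ_two] <;>
    linear_combination (-(v _)) * this

theorem inner_dir_dirPerp (ω : ℝ) : inner ℝ (dir ω) (dirPerp ω) = 0 := by
  simp [dir, dirPerp, PiLp.inner_apply, Fin.sum_univ_two]
  ring

theorem dirPerp_ne_smul_dir (ω : ℝ) {ν : ℝ} (hν : ν ≠ 0) (k : ℝ) : ν • dirPerp ω ≠ k • dir ω := by
  intro h
  have h1 := congrArg (fun v => inner ℝ v (dirPerp ω)) h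
  simp only [inner_smul_left, inner_dir_dirPerp, real_inner_self_eq_norm_sq, norm_dirPerp] at h1
  simp at h1
  exact hν h1

theorem hasDerivAt_dir (ω : ℝ) : HasDerivAt dir (dirPerp ω) ω := by
  have h : dir = fun ω => cos ω • dir 0 + sin ω • dirPerp 0 := by
    ext ω i
    fin_cases i <;> simp [dir, dirPerp]
  rw [h]
  have := ((hasDerivAt_cos ω).smul_const (dir 0)).add ((hasDerivAt_sin ω).smul_const (dirPerp 0))
  refine this.congr_deriv ?_
  ext i
  fin_cases i <;> simp [dir, dirPerp]

/-- The point with parameter `z.2` on the line with parameter `z.1` of a family of lines. -/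
noncomputable def lineMap (P : ℝ → Plane) (φ : ℝ → ℝ) (z : ℝ × ℝ) : Plane := P z.1 + z.2 • dir (φ z.1)

/-- A `C¹` family of lines with direction `ω₀` at parameter `0`, such that every point of the line
at parameter `0` moves transversally to that line or stays fixed. -/
structure IsLineFamily (P : ℝ → Plane) (φ : ℝ → ℝ) (ω₀ : ℝ) : Prop where
  contDiff_base : ContDiff ℝ 1 P
  contDiff_angle : ContDiff ℝ 1 φ
  angle_zero : φ 0 = ω₀
  transversal : ∀ τ, (∀ k : ℝ, deriv P 0 + τ • (deriv φ 0 • dirPerp ω₀) ≠ k • dir ω₀) ∨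
    ∀ l, lineMap P φ (l, τ) = lineMap P φ (0, τ)

namespace IsLineFamily

variable {P : ℝ → Plane} {φ : ℝ → ℝ} {ω₀ : ℝ}

theorem contDiff_lineMap (h : IsLineFamily P φ ω₀) : ContDiff ℝ 1 (lineMap P φ) := by
  unfold lineMap
  exact (h.contDiff_base.comp contDiff_fst).add
    (contDiff_snd.smul (contDiff_dir.comp (h.contDiff_angle.comp contDiff_fst)))

theorem fderiv_lineMap_snd (h : IsLineFamily P φ ω₀) (τ : ℝ) :
    fderiv ℝ (lineMap P φ) (0, τ) (0, 1) = dir ω₀ := by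
  have h1 : HasDerivAt (fun r => lineMap P φ (0, r)) (fderiv ℝ (lineMap P φ) (0, τ) (0, 1)) τ :=
    (h.contDiff_lineMap.differentiable one_ne_zero (0, τ)).hasFDerivAt.comp_hasDerivAt
      (f := fun r => ((0 : ℝ), r)) τ ((hasDerivAt_const τ 0).prodMk (hasDerivAt_id τ))
  have h2 : HasDerivAt (fun r => lineMap P φ (0, r)) ((1 : ℝ) • dir (φ 0)) τ :=
    ((hasDerivAt_id τ).smul_const (dir (φ 0))).const_add (P 0)
  rw [h1.unique h2, one_smul, h.angle_zero]

theorem fderiv_lineMap_fst (h : IsLineFamily P φ ω₀) (τ : ℝ) :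
    fderiv ℝ (lineMap P φ) (0, τ) (1, 0) = deriv P 0 + τ • (deriv φ 0 • dirPerp ω₀) := by
  have h1 : HasDerivAt (fun l => lineMap P φ (l, τ)) (fderiv ℝ (lineMap P φ) (0, τ) (1, 0)) 0 :=
    (h.contDiff_lineMap.differentiable one_ne_zero (0, τ)).hasFDerivAt.comp_hasDerivAt
      (f := fun l => (l, τ)) 0 ((hasDerivAt_id 0).prodMk (hasDerivAt_const 0 τ))
  have h3 := (h.contDiff_angle.differentiable one_ne_zero 0).hasDerivAt
  have h4 : HasDerivAt (fun l => dir (φ l)) (deriv φ 0 • dirPerp (φ 0)) 0 :=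
    (hasDerivAt_dir (φ 0)).scomp 0 h3
  have h2 : HasDerivAt (fun l => lineMap P φ (l, τ))
      (deriv P 0 + τ • (deriv φ 0 • dirPerp (φ 0))) 0 :=
    (h.contDiff_base.differentiable one_ne_zero 0).hasDerivAt.add (h4.const_smul τ)
  rw [h1.unique h2, h.angle_zero]

end IsLineFamily

/-! ### Boundary charts and tangent directions. -/

namespace IsSmoothChartAt

variable {Φ : OpenPartialHomeomorph Plane Plane} {x : Plane}

theorem contDiffAt (h : IsSmoothChartAt Φ x) {n : ℕ} : ContDiffAt ℝ n Φ x :=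
  (h.contDiffOn.contDiffAt (Φ.open_source.mem_nhds h.mem_source)).of_le (by exact_mod_cast le_top)

theorem zero_mem_target (h : IsSmoothChartAt Φ x) : (0 : Plane) ∈ Φ.target := by
  rw [← h.map_base]
  exact Φ.map_source h.mem_source

theorem symm_zero (h : IsSmoothChartAt Φ x) : Φ.symm 0 = x := by
  rw [← h.map_base, Φ.left_inv h.mem_source]

theorem contDiffAt_symm (h : IsSmoothChartAt Φ x) {n : ℕ} : ContDiffAt ℝ n Φ.symm 0 :=
  (h.contDiffOn_symm.contDiffAt (Φ.open_target.mem_nhds h.zero_mem_target)).of_le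
    (by exact_mod_cast le_top)

theorem hasFDerivAt (h : IsSmoothChartAt Φ x) : HasFDerivAt Φ (fderiv ℝ Φ x) x :=
  ((h.contDiffAt (n := 1)).differentiableAt (by norm_num)).hasFDerivAt

theorem hasFDerivAt_symm (h : IsSmoothChartAt Φ x) :
    HasFDerivAt Φ.symm (fderiv ℝ Φ.symm 0) 0 :=
  ((h.contDiffAt_symm (n := 1)).differentiableAt (by norm_num)).hasFDerivAt

theorem fderiv_symm_apply (h : IsSmoothChartAt Φ x) (v : Plane) :
    fderiv ℝ Φ.symm 0 (fderiv ℝ Φ x v) = v := by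
  have h1 : HasFDerivAt (Φ.symm ∘ Φ) ((fderiv ℝ Φ.symm 0).comp (fderiv ℝ Φ x)) x := by
    refine HasFDerivAt.comp x ?_ h.hasFDerivAt
    rw [h.map_base]
    exact h.hasFDerivAt_symm
  have h2 : HasFDerivAt (Φ.symm ∘ Φ) (ContinuousLinearMap.id ℝ Plane) x :=
    (hasFDerivAt_id x).congr_of_eventuallyEq (Φ.eventually_left_inverse h.mem_source)
  exact congrArg (fun L : Plane →L[ℝ] Plane => L v) (h1.unique h2)

theorem fderiv_apply_symm (h : IsSmoothChartAt Φ x) (v : Plane) :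
    fderiv ℝ Φ x (fderiv ℝ Φ.symm 0 v) = v := by
  have h1 : HasFDerivAt (Φ ∘ Φ.symm) ((fderiv ℝ Φ x).comp (fderiv ℝ Φ.symm 0)) 0 := by
    refine HasFDerivAt.comp 0 ?_ h.hasFDerivAt_symm
    rw [h.symm_zero]
    exact h.hasFDerivAt
  have h2 : HasFDerivAt (Φ ∘ Φ.symm) (ContinuousLinearMap.id ℝ Plane) 0 :=
    (hasFDerivAt_id 0).congr_of_eventuallyEq (Φ.eventually_right_inverse h.zero_mem_target)
  exact congrArg (fun L : Plane →L[ℝ] Plane => L v) (h1.unique h2)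

theorem hasFDerivAt_coord (h : IsSmoothChartAt Φ x) (i : Fin 2) :
    HasFDerivAt (fun z => Φ z i) ((EuclideanSpace.proj i).comp (fderiv ℝ Φ x)) x :=
  (EuclideanSpace.proj (𝕜 := ℝ) i).hasFDerivAt.comp x h.hasFDerivAt

theorem contDiffAt_coord (h : IsSmoothChartAt Φ x) (i : Fin 2) {n : ℕ} :
    ContDiffAt ℝ n (fun z => Φ z i) x :=
  (EuclideanSpace.proj (𝕜 := ℝ) i).contDiff.contDiffAt.comp x h.contDiffAt

theorem coord_base (h : IsSmoothChartAt Φ x) (i : Fin 2) : Φ x i = 0 := by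
  rw [h.map_base]; rfl

/-- A direction whose image under the chart points along the frontier of the model set, forwards or
backwards, is tangent to the frontier. -/
theorem mem_tangentConeAt_frontier (h : IsSmoothChartAt Φ x) {V U T : Set Plane}
    (hV : ∀ z ∈ Φ.source, z ∈ V ↔ Φ z ∈ T) (hVU : ∀ᶠ z in 𝓝 x, z ∈ frontier V → z ∈ frontier U)
    {v : Plane} {ε : ℝ} (hε : ε ≠ 0) (hT : ∀ σ > 0, (ε * σ) • fderiv ℝ Φ x v ∈ frontier T) :
    v ∈ tangentConeAt ℝ (frontier U) x := by
  set e := fderiv ℝ Φ x v with he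
  have hline : HasDerivAt (fun σ : ℝ => (ε * σ) • e) (ε • e) 0 := by
    have := ((hasDerivAt_id (0 : ℝ)).const_mul ε).smul_const e
    simpa using this
  have hcurve : HasDerivAt (fun σ : ℝ => Φ.symm ((ε * σ) • e)) (ε • v) 0 := by
    have h1 : HasFDerivAt Φ.symm (fderiv ℝ Φ.symm 0) ((ε * 0) • e) := by
      simpa using h.hasFDerivAt_symm
    have := h1.comp_hasDerivAt (0 : ℝ) hline
    rwa [map_smul, he, h.fderiv_symm_apply] at this
  have h0 : Φ.symm ((ε * 0) • e) = x := by simp [h.symm_zero]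
  have htend : Tendsto (fun σ : ℝ => Φ.symm ((ε * σ) • e)) (𝓝[>] 0) (𝓝 x) := by
    have := hcurve.continuousAt.tendsto
    simp only [h0] at this
    exact this.mono_left nhdsWithin_le_nhds
  have htgt : ∀ᶠ σ in 𝓝[>] (0 : ℝ), (ε * σ) • e ∈ Φ.target := by
    have := hline.continuousAt.tendsto
    simp only [mul_zero, zero_smul] at this
    exact (this.mono_left nhdsWithin_le_nhds).eventually (Φ.open_target.mem_nhds h.zero_mem_target)
  have himg : Φ.IsImage V T := fun z hz => (hV z hz).symm
  -- The preimage of the model ray runs in the frontier with initial velocity ε v; rescaling by 1 /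
  -- (ε σ) yields v even when ε is negative, because the tangent cone is taken over ℝ.
  refine mem_tangentConeAt_of_seq (𝓝[>] (0 : ℝ)) (fun σ => (ε * σ)⁻¹)
    (fun σ => Φ.symm ((ε * σ) • e) - x) ?_ ?_ ?_
  · simpa using htend.sub_const x
  · filter_upwards [htgt, htend.eventually hVU, self_mem_nhdsWithin] with σ h1 h2 h3
    rw [add_sub_cancel]
    refine h2 ((himg.frontier (Φ.map_target h1)).1 ?_)
    rw [Φ.right_inv h1]
    exact hT σ h3
  · have hs := hcurve.tendsto_slope.mono_left (nhdsGT_le_nhdsNE 0)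
    have := hs.const_smul ε⁻¹
    rw [inv_smul_smul₀ hε] at this
    refine this.congr fun σ => ?_
    rw [slope_def_module, h0, sub_zero, smul_smul, mul_inv]

end IsSmoothChartAt

theorem mem_frontier_of_ray {T : Set Plane} (hT : IsOpen T) {p w : Plane} (hp : p ∉ T)
    (hw : ∀ ε > (0 : ℝ), p + ε • w ∈ T) : p ∈ frontier T := by
  rw [hT.frontier_eq]
  refine ⟨?_, hp⟩
  have ht : Tendsto (fun ε : ℝ => p + ε • w) (𝓝[>] 0) (𝓝 p) := by
    have : Continuous fun ε : ℝ => p + ε • w := by fun_prop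
    have := this.tendsto 0
    simp only [zero_smul, add_zero] at this
    exact this.mono_left nhdsWithin_le_nhds
  refine mem_closure_of_tendsto ht ?_
  filter_upwards [self_mem_nhdsWithin] with ε hε using hw ε hε

theorem continuous_coord (i : Fin 2) : Continuous fun p : Plane => p i :=
  (EuclideanSpace.proj (𝕜 := ℝ) i).continuous

/-- If the derivative vanished, the image of the direction would run along the edge of the half
plane. Non-tangency thus provides the nonzero derivative required by the implicit function theorem.
-/
theorem fderiv_coord_ne_zero_of_halfPlane {Φ : OpenPartialHomeomorph Plane Plane} {x : Plane}
    {V U : Set Plane} {ω : ℝ} (h : IsHalfPlaneChart Φ V x)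
    (hVU : ∀ᶠ z in 𝓝 x, z ∈ frontier V → z ∈ frontier U)
    (ht : dir ω ∉ tangentConeAt ℝ (frontier U) x) : fderiv ℝ Φ x (dir ω) 1 ≠ 0 := by
  intro h0
  refine ht (h.toIsSmoothChartAt.mem_tangentConeAt_frontier (T := {p | 0 < p 1}) h.mem_iff hVU
    one_ne_zero fun σ _ => ?_)
  refine mem_frontier_of_ray (w := !₂[0, 1]) (isOpen_lt continuous_const (continuous_coord 1)) ?_ ?_
  · simp [h0]
  · intro ε hε
    simpa [h0] using hε

theorem fderiv_coord_ne_zero_of_corner {Φ : OpenPartialHomeomorph Plane Plane} {x : Plane}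
    {V U : Set Plane} {ω : ℝ} (h : IsSmoothChartAt Φ x)
    (hV : (∀ y ∈ Φ.source, y ∈ V ↔ (0 < Φ y 0 ∧ 0 < Φ y 1)) ∨
      (∀ y ∈ Φ.source, y ∈ V ↔ (0 < Φ y 0 ∨ 0 < Φ y 1)))
    (hVU : ∀ᶠ z in 𝓝 x, z ∈ frontier V → z ∈ frontier U)
    (ht : dir ω ∉ tangentConeAt ℝ (frontier U) x) (i : Fin 2) : fderiv ℝ Φ x (dir ω) i ≠ 0 := by
  set e := fderiv ℝ Φ x (dir ω) with he
  intro h0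
  have o0 : IsOpen {p : Plane | 0 < p 0} := isOpen_lt continuous_const (continuous_coord 0)
  have o1 : IsOpen {p : Plane | 0 < p 1} := isOpen_lt continuous_const (continuous_coord 1)
  -- The frontier of a quadrant contains only the nonnegative half axes, that of three quadrants
  -- only the nonpositive ones; the sign ε turns the ray onto the right half.
  have sgn : ∀ a : ℝ, ∃ ε : ℝ, ε ≠ 0 ∧ ∀ σ > 0, 0 ≤ ε * σ * a := fun a => by
    rcases le_total 0 a with ha | ha
    · exact ⟨1, one_ne_zero, fun σ hσ => by positivity⟩
    · exact ⟨-1, by norm_num, fun σ hσ => by nlinarith⟩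
  have sgn' : ∀ a : ℝ, ∃ ε : ℝ, ε ≠ 0 ∧ ∀ σ > 0, ε * σ * a ≤ 0 := fun a => by
    obtain ⟨ε, h1, h2⟩ := sgn a
    exact ⟨-ε, neg_ne_zero.2 h1, fun σ hσ => by linarith [h2 σ hσ]⟩
  rcases hV with hV | hV
  · have hopen : IsOpen {p : Plane | 0 < p 0 ∧ 0 < p 1} := o0.inter o1
    obtain ⟨ε, hε, hs⟩ := sgn (e (1 - i))
    refine ht (h.mem_tangentConeAt_frontier (T := {p | 0 < p 0 ∧ 0 < p 1}) hV hVU hε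
      fun σ hσ => ?_)
    have hs' := hs σ hσ
    refine mem_frontier_of_ray (w := !₂[1, 1]) hopen ?_ ?_
    · rw [← he]
      fin_cases i <;> simp at h0 ⊢ <;> simp [h0]
    · rw [← he]
      intro δ hδ
      fin_cases i <;> simp at h0 hs' ⊢ <;> simp only [h0, mul_zero, zero_add, hδ, true_and, and_true]
        <;> linarith
  · have hopen : IsOpen {p : Plane | 0 < p 0 ∨ 0 < p 1} := o0.union o1
    obtain ⟨ε, hε, hs⟩ := sgn' (e (1 - i))
    refine ht (h.mem_tangentConeAt_frontier (T := {p | 0 < p 0 ∨ 0 < p 1}) hV hVU hε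
      fun σ hσ => ?_)
    have hs' := hs σ hσ
    refine mem_frontier_of_ray (w := !₂[1, 1]) hopen ?_ ?_
    · rw [← he]
      fin_cases i <;> simp at h0 hs' ⊢ <;> simpa [h0] using hs'
    · rw [← he]
      intro δ hδ
      fin_cases i <;> simp at h0 ⊢ <;> simp [h0, hδ]

/-- A frontier point of one piece cannot lie in another piece: that piece is open and would meet the
first one. So tangency to a piece implies tangency to U. -/
theorem eventually_mem_frontier_of_piece {U : Set Plane} {x : Plane} {k : ℕ}
    {V : Fin k → Set Plane} (hVo : ∀ i, IsOpen (V i))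
    (hd : Pairwise fun i i' => Disjoint (V i) (V i'))
    (hU : ∀ᶠ y in 𝓝 x, y ∈ U ↔ ∃ i, y ∈ V i) (i : Fin k) :
    ∀ᶠ z in 𝓝 x, z ∈ frontier (V i) → z ∈ frontier U := by
  filter_upwards [hU.eventually_nhds] with z hz hzV
  rw [(hVo i).frontier_eq] at hzV
  rw [frontier_eq_closure_inter_closure]
  refine ⟨?_, subset_closure fun hzU => ?_⟩
  · rw [mem_closure_iff_frequently]
    exact (mem_closure_iff_frequently.1 hzV.1).mp (hz.mono fun y hy hyV => hy.2 ⟨i, hyV⟩)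
  · obtain ⟨j, hj⟩ := hz.self_of_nhds.1 hzU
    by_cases hij : j = i
    · exact hzV.2 (hij ▸ hj)
    · obtain ⟨y, hy1, hy2⟩ := mem_closure_iff.1 hzV.1 (V j) (hVo j) hj
      exact disjoint_left.1 (hd hij) hy1 hy2

/-! ### Boundaries transversal to a family of lines. -/

section Family

variable {P : ℝ → Plane} {φ : ℝ → ℝ} {ω₀ τ : ℝ} {w : ℝ → ℝ} {w₀ : ℝ}

theorem IsLineFamily.contDiffAt_coord (h : IsLineFamily P φ ω₀)
    {Φ : OpenPartialHomeomorph Plane Plane} (hΦ : IsSmoothChartAt Φ (lineMap P φ (0, τ)))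
    (i : Fin 2) : ContDiffAt ℝ 1 (fun z => Φ (lineMap P φ z) i) (0, τ) := by
  have := hΦ.contDiffAt_coord i (n := 1)
  exact ContDiffAt.comp (f := lineMap P φ) (g := fun z => Φ z i) (0, τ) this
    h.contDiff_lineMap.contDiffAt

theorem IsLineFamily.fderiv_coord (h : IsLineFamily P φ ω₀)
    {Φ : OpenPartialHomeomorph Plane Plane} (hΦ : IsSmoothChartAt Φ (lineMap P φ (0, τ)))
    (i : Fin 2) (v : ℝ × ℝ) : fderiv ℝ (fun z => Φ (lineMap P φ z) i) (0, τ) v =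
      fderiv ℝ Φ (lineMap P φ (0, τ)) (fderiv ℝ (lineMap P φ) (0, τ) v) i := by
  have h1 := (hΦ.hasFDerivAt_coord i).comp (0, τ)
    (h.contDiff_lineMap.differentiable one_ne_zero (0, τ)).hasFDerivAt
  have h2 : fderiv ℝ (fun z => Φ (lineMap P φ z) i) (0, τ) = _ := h1.fderiv
  rw [h2]
  rfl

theorem IsLineFamily.tendsto_lineMap (h : IsLineFamily P φ ω₀) :
    Tendsto (lineMap P φ) (𝓝 (0, τ)) (𝓝 (lineMap P φ (0, τ))) :=
  h.contDiff_lineMap.continuous.tendsto _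

/-- A function taking two values, according to the side of a smooth curve which is transversal to
the line. -/
theorem IsLineFamily.jumpRep_halfPlane (h : IsLineFamily P φ ω₀) (hw : Tendsto w (𝓝[≠] 0) (𝓝 w₀))
    {Φ : OpenPartialHomeomorph Plane Plane} (hΦ : IsSmoothChartAt Φ (lineMap P φ (0, τ)))
    (ht : fderiv ℝ Φ (lineMap P φ (0, τ)) (dir ω₀) 1 ≠ 0) {a : Plane → ℝ} {c c' : ℝ}
    (ha : ∀ᶠ z in 𝓝 (lineMap P φ (0, τ)), (0 < Φ z 1 → a z = c) ∧ (Φ z 1 < 0 → a z = c')) :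
    ∃ j, JumpRep w (fun l r => a (lineMap P φ (l, r))) τ (w₀ * j) (w₀ * j) :=
  jumpRep_smooth hw (h.contDiffAt_coord hΦ 1) (hΦ.coord_base 1)
    (by rw [h.fderiv_coord hΦ, h.fderiv_lineMap_snd]; exact ht) (h.tendsto_lineMap.eventually ha)

/-- A function taking two values, one inside a sector and the other one outside, at a vertex whose
branches are transversal to the line. -/
theorem IsLineFamily.jumpRep_quadrant (h : IsLineFamily P φ ω₀) (hw : Tendsto w (𝓝[≠] 0) (𝓝 w₀))
    {Φ : OpenPartialHomeomorph Plane Plane} (hΦ : IsSmoothChartAt Φ (lineMap P φ (0, τ)))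
    (ht : ∀ i, fderiv ℝ Φ (lineMap P φ (0, τ)) (dir ω₀) i ≠ 0) {a : Plane → ℝ} {b b' : ℝ}
    (hb : (∀ᶠ z in 𝓝 (lineMap P φ (0, τ)), (0 < Φ z 0 → 0 < Φ z 1 → a z = b) ∧
        (Φ z 0 < 0 ∨ Φ z 1 < 0 → a z = b')) ∨
      (∀ᶠ z in 𝓝 (lineMap P φ (0, τ)), (0 < Φ z 0 ∨ 0 < Φ z 1 → a z = b) ∧
        (Φ z 0 < 0 → Φ z 1 < 0 → a z = b'))) :
    ∃ j₁ j₂, JumpRep w (fun l r => a (lineMap P φ (l, r))) τ (w₀ * j₁) (w₀ * j₂) ∧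
      ((∀ k : ℝ, deriv P 0 + τ • (deriv φ 0 • dirPerp ω₀) ≠ k • dir ω₀) → b ≠ b' → j₁ ≠ j₂) := by
  set x := lineMap P φ (0, τ) with hx
  set v := deriv P 0 + τ • (deriv φ 0 • dirPerp ω₀) with hv
  have d1 : ∀ i, fderiv ℝ (fun z => Φ (lineMap P φ z) i) (0, τ) (0, 1) =
      fderiv ℝ Φ x (dir ω₀) i := fun i => by rw [h.fderiv_coord hΦ, h.fderiv_lineMap_snd]
  have d0 : ∀ i, fderiv ℝ (fun z => Φ (lineMap P φ z) i) (0, τ) (1, 0) =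
      fderiv ℝ Φ x v i := fun i => by rw [h.fderiv_coord hΦ, h.fderiv_lineMap_fst]
  -- A vanishing determinant makes the chart images of the velocity v and of the direction parallel;
  -- the derivative of the chart is injective, so v itself would be parallel to the line.
  have hdeg : (∀ k : ℝ, v ≠ k • dir ω₀) →
      fderiv ℝ Φ x v 0 * fderiv ℝ Φ x (dir ω₀) 1 ≠ fderiv ℝ Φ x v 1 * fderiv ℝ Φ x (dir ω₀) 0 := by
    intro hk heq
    set k := fderiv ℝ Φ x v 0 / fderiv ℝ Φ x (dir ω₀) 0 with hkdef
    refine hk k ?_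
    have h1 : fderiv ℝ Φ x v = k • fderiv ℝ Φ x (dir ω₀) := by
      have n0 := ht 0
      have n1 := ht 1
      ext i
      fin_cases i
      · simp only [Fin.zero_eta, PiLp.smul_apply, smul_eq_mul, hkdef]
        field_simp
      · simp only [Fin.mk_one, PiLp.smul_apply, smul_eq_mul, hkdef]
        field_simp
        linarith
    rw [← hΦ.fderiv_symm_apply v, h1, map_smul, hΦ.fderiv_symm_apply]
  have hJ : fderiv ℝ (fun z => Φ (lineMap P φ z) 0) (0, τ) (1, 0) *
        fderiv ℝ (fun z => Φ (lineMap P φ z) 1) (0, τ) (0, 1) ≠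
      fderiv ℝ (fun z => Φ (lineMap P φ z) 1) (0, τ) (1, 0) *
        fderiv ℝ (fun z => Φ (lineMap P φ z) 0) (0, τ) (0, 1) ∨
      ∀ᶠ l in 𝓝 (0 : ℝ), Φ (lineMap P φ (l, τ)) 0 = 0 ∧ Φ (lineMap P φ (l, τ)) 1 = 0 := by
    rw [d0, d0, d1, d1]
    rcases h.transversal τ with hk | hfix
    · exact .inl (hdeg hk)
    · refine .inr (Eventually.of_forall fun l => ?_)
      rw [hfix l]
      exact ⟨hΦ.coord_base 0, hΦ.coord_base 1⟩
  -- Both mixed quadrants carry the same value a₂, equal to b' for one quadrant and to b for three;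
  -- the alternating sum is b - b' or b' - b.
  obtain ⟨a₁, a₂, a₃, hA, hne⟩ : ∃ a₁ a₂ a₃ : ℝ, (∀ᶠ z in 𝓝 x, (0 < Φ z 0 → 0 < Φ z 1 → a z = a₁) ∧
      (0 < Φ z 0 → Φ z 1 < 0 → a z = a₂) ∧ (Φ z 0 < 0 → 0 < Φ z 1 → a z = a₂) ∧
      (Φ z 0 < 0 → Φ z 1 < 0 → a z = a₃)) ∧ (b ≠ b' → a₁ - a₂ - a₂ + a₃ ≠ 0) := by
    rcases hb with hb | hb
    · refine ⟨b, b', b', hb.mono fun z hz => ⟨hz.1, fun _ h => hz.2 (.inr h),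
        fun h _ => hz.2 (.inl h), fun h _ => hz.2 (.inl h)⟩, fun hbb h0 => hbb ?_⟩
      linarith
    · refine ⟨b, b, b', hb.mono fun z hz => ⟨fun h _ => hz.1 (.inl h), fun h _ => hz.1 (.inl h),
        fun _ h => hz.1 (.inr h), hz.2⟩, fun hbb h0 => hbb ?_⟩
      linarith
  obtain ⟨j₁, j₂, hj, hj'⟩ := jumpRep_corner hw (h.contDiffAt_coord hΦ 0) (hΦ.coord_base 0)
    (by rw [d1]; exact ht 0) (h.contDiffAt_coord hΦ 1) (hΦ.coord_base 1) (by rw [d1]; exact ht 1)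
    hJ (A := fun l r => a (lineMap P φ (l, r))) (h.tendsto_lineMap.eventually hA)
  rw [d0, d0, d1, d1] at hj'
  exact ⟨j₁, j₂, hj, fun hk hbb => hj' (hdeg hk) (hne hbb)⟩

/-- The indicator of a set with piecewise smooth boundary along a family of lines which are not
tangent to the boundary. -/
theorem IsLineFamily.jumpRep_indicator (h : IsLineFamily P φ ω₀)
    (hw : Tendsto w (𝓝[≠] 0) (𝓝 w₀)) {U : Set Plane} (hU : HasSmoothBoundaryWithCorners U)
    (ht : ¬ IsTangentAt U (lineMap P φ (0, τ)) ω₀) :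
    ∃ j₁ j₂, JumpRep w (fun l r => U.indicator 1 (lineMap P φ (l, r))) τ (w₀ * j₁) (w₀ * j₂) ∧
      (¬ HasCornerAt U (lineMap P φ (0, τ)) → j₁ = j₂) := by
  classical
  by_cases hx : lineMap P φ (0, τ) ∈ frontier U
  · have ht' : dir ω₀ ∉ tangentConeAt ℝ (frontier U) (lineMap P φ (0, τ)) := fun h' => ht ⟨hx, h'⟩
    obtain ⟨k, V, hVo, hVd, hUV, hV⟩ := hU _ hx
    have hpiece : ∀ i, ∃ j₁ j₂, JumpRep w (fun l r => (V i).indicator 1 (lineMap P φ (l, r))) τ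
        (w₀ * j₁) (w₀ * j₂) ∧ (¬ IsCornerGerm (V i) (lineMap P φ (0, τ)) → j₁ = j₂) := by
      intro i
      have hfr := eventually_mem_frontier_of_piece hVo hVd hUV i
      rcases hV i with ⟨Φ, hΦ⟩ | ⟨Φ, hΦ, hq⟩
      · obtain ⟨j, hj⟩ := h.jumpRep_halfPlane hw hΦ.toIsSmoothChartAt
          (fderiv_coord_ne_zero_of_halfPlane hΦ hfr ht') (a := (V i).indicator 1) (c := 1) (c' := 0)
          (by
            filter_upwards [Φ.open_source.mem_nhds hΦ.mem_source] with z hz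
            refine ⟨fun h1 => indicator_of_mem ((hΦ.mem_iff z hz).2 h1) _, fun h1 =>
              indicator_of_notMem (fun h2 => ?_) _⟩
            exact lt_asymm h1 ((hΦ.mem_iff z hz).1 h2))
        exact ⟨j, j, hj, fun _ => rfl⟩
      · obtain ⟨j₁, j₂, hj, -⟩ := h.jumpRep_quadrant hw hΦ
          (fderiv_coord_ne_zero_of_corner hΦ hq hfr ht') (a := (V i).indicator 1) (b := 1) (b' := 0)
          (by
            rcases hq with hq | hq
            · left
              filter_upwards [Φ.open_source.mem_nhds hΦ.mem_source] with z hz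
              refine ⟨fun h1 h2 => indicator_of_mem ((hq z hz).2 ⟨h1, h2⟩) _, fun h1 =>
                indicator_of_notMem (fun h2 => ?_) _⟩
              have := (hq z hz).1 h2
              rcases h1 with h1 | h1
              · exact lt_asymm h1 this.1
              · exact lt_asymm h1 this.2
            · right
              filter_upwards [Φ.open_source.mem_nhds hΦ.mem_source] with z hz
              refine ⟨fun h1 => indicator_of_mem ((hq z hz).2 h1) _, fun h1 h1' =>
                indicator_of_notMem (fun h2 => ?_) _⟩
              rcases (hq z hz).1 h2 with h3 | h3
              · exact lt_asymm h1 h3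
              · exact lt_asymm h1' h3)
        exact ⟨j₁, j₂, hj, fun hc => absurd ⟨Φ, hΦ, hq⟩ hc⟩
    choose j₁ j₂ hj hjj using hpiece
    refine ⟨∑ i, j₁ i, ∑ i, j₂ i, ?_, fun hc => Finset.sum_congr rfl fun i _ => hjj i fun hg => ?_⟩
    · rw [Finset.mul_sum, Finset.mul_sum]
      refine (JumpRep.sum Finset.univ fun i _ => hj i).congr ?_
      filter_upwards [h.tendsto_lineMap.eventually hUV] with z hz
      by_cases hzU : lineMap P φ z ∈ U
      · obtain ⟨i, hi⟩ := hz.1 hzU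
        rw [indicator_of_mem hzU, Finset.sum_eq_single_of_mem i (Finset.mem_univ i),
          indicator_of_mem hi]
        intro i' _ hne
        exact indicator_of_notMem (fun h' => disjoint_left.1 (hVd hne) h' hi) _
      · rw [indicator_of_notMem hzU]
        refine (Finset.sum_eq_zero fun i _ => indicator_of_notMem (fun h' => hzU (hz.2 ⟨i, h'⟩)) _).symm
    -- A piece with a corner, together with the union of the other pieces, would be a corner of U.
    · refine hc ⟨V i, ⋃ i' ∈ {i' | i' ≠ i}, V i', hVo i, isOpen_biUnion fun i' _ => hVo i', ?_, ?_, hg⟩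
      · exact disjoint_iUnion₂_right.2 fun i' hi' => (hVd hi').symm
      · filter_upwards [hUV] with z hz
        rw [hz]
        constructor
        · rintro ⟨i', hi'⟩
          by_cases hii : i' = i
          · exact .inl (hii ▸ hi')
          · exact .inr (mem_biUnion (show i' ∈ {i' | i' ≠ i} from hii) hi')
        · rintro (h' | h')
          · exact ⟨i, h'⟩
          · obtain ⟨i', -, hi'⟩ := mem_iUnion₂.1 h'
            exact ⟨i', hi'⟩
  · refine ⟨0, 0, ?_, fun _ => rfl⟩
    rw [mul_zero]
    by_cases hxU : lineMap P φ (0, τ) ∈ interior U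
    · refine JumpRep.of_eventually_const (C := 1) ?_
      filter_upwards [h.tendsto_lineMap.eventually (isOpen_interior.mem_nhds hxU)] with z hz
      exact indicator_of_mem (interior_subset hz) _
    · refine JumpRep.of_eventually_const (C := 0) ?_
      have hxc : lineMap P φ (0, τ) ∈ (closure U)ᶜ := fun h' => hx ⟨h', hxU⟩
      filter_upwards [h.tendsto_lineMap.eventually (isClosed_closure.isOpen_compl.mem_nhds hxc)]
        with z hz
      exact indicator_of_notMem (fun h' => hz (subset_closure h')) _

end Family

/-! ### Tangency at a point of nonzero curvature. -/

theorem fderiv_coord_eq_zero_of_tangent {Φ : OpenPartialHomeomorph Plane Plane} {x v : Plane}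
    {S : Set Plane} (h : IsSmoothChartAt Φ x) (hS : ∀ᶠ z in 𝓝 x, z ∈ S → Φ z 1 = 0)
    (hv : v ∈ tangentConeAt ℝ S x) : fderiv ℝ Φ x v 1 = 0 := by
  obtain ⟨α, l, hl, c, d, hd0, hds, hcd⟩ := exists_fun_of_mem_tangentConeAt hv
  have h1 := (h.hasFDerivAt_coord 1).hasFDerivWithinAt (s := S)
  have h2 := h1.lim hd0 hds hcd
  have hx : Tendsto (fun n => x + d n) l (𝓝 x) := by simpa using hd0.const_add x
  have h3 : Tendsto (fun _ : α => (0 : ℝ)) l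
      (𝓝 (((EuclideanSpace.proj 1).comp (fderiv ℝ Φ x)) v)) := by
    refine h2.congr' ?_
    filter_upwards [hx.eventually hS, hds] with n h4 h5
    rw [h4 h5, h.coord_base]
    simp
  exact (tendsto_nhds_unique h3 tendsto_const_nhds)

theorem inner_add_smul_dir (v : Plane) (ω : ℝ) : v 0 = inner ℝ v (dir ω) * cos ω -
    inner ℝ v (dirPerp ω) * sin ω ∧ v 1 = inner ℝ v (dir ω) * sin ω + inner ℝ v (dirPerp ω) * cos ω := by
  have := eq_inner_dir_add v ω
  constructor
  · have := congrArg (fun v : Plane => v 0) this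
    simp [dir, dirPerp] at this
    simp [dir, dirPerp]
    linarith
  · have := congrArg (fun v : Plane => v 1) this
    simp [dir, dirPerp] at this
    simp [dir, dirPerp]
    linarith

/-- A plane curve which runs in the graph of a function with vanishing first and second derivative
over the axis in direction `ω` has vanishing curvature. -/
theorem planeCurvature_eq_zero_of_graph {G : ℝ → Plane} {h : ℝ → ℝ} {ω : ℝ}
    (hG : ContDiffAt ℝ 2 G 0) (hh : ContDiffAt ℝ 2 h 0) (h1 : deriv h 0 = 0)
    (h2 : deriv (deriv h) 0 = 0)
    (hgraph : ∀ᶠ t in 𝓝 0, inner ℝ (G t - G 0) (dirPerp ω) = h (inner ℝ (G t - G 0) (dir ω))) :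
    planeCurvature G 0 = 0 := by
  have hG' : ∀ᶠ t in 𝓝 (0 : ℝ), HasDerivAt G (deriv G t) t :=
    (hG.eventually (by simp)).mono fun t ht => (ht.differentiableAt (by norm_num)).hasDerivAt
  have hG2 : HasDerivAt (deriv G) (deriv (deriv G) 0) 0 :=
    ((hG.derivWithin (m := 1) (by norm_num)).differentiableAt (by norm_num)).hasDerivAt
  have hh' : ∀ᶠ u in 𝓝 (0 : ℝ), HasDerivAt h (deriv h u) u :=
    (hh.eventually (by simp)).mono fun t ht => (ht.differentiableAt (by norm_num)).hasDerivAt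
  have hh2 : HasDerivAt (deriv h) (deriv (deriv h) 0) 0 :=
    ((hh.derivWithin (m := 1) (by norm_num)).differentiableAt (by norm_num)).hasDerivAt
  have hu : ∀ e : Plane, ∀ᶠ t in 𝓝 (0 : ℝ),
      HasDerivAt (fun t => inner ℝ (G t - G 0) e) (inner ℝ (deriv G t) e) t := fun e => by
    filter_upwards [hG'] with t ht
    simpa using (ht.sub_const (G 0)).inner ℝ (hasDerivAt_const t e)
  have hu2 : ∀ e : Plane, HasDerivAt (fun t => inner ℝ (deriv G t) e)
      (inner ℝ (deriv (deriv G) 0) e) 0 := fun e => by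
    simpa using hG2.inner ℝ (hasDerivAt_const 0 e)
  have hu0 : Tendsto (fun t => inner ℝ (G t - G 0) (dir ω)) (𝓝 0) (𝓝 0) := by
    simpa using (hu (dir ω)).self_of_nhds.continuousAt.tendsto
  -- Differentiating the graph relation v = h(u) twice gives v' = h' u' and v'' = h'' u'² + h' u''.
  -- Both vanish at 0, so G' and G'' are parallel there.
  have hv' : ∀ᶠ t in 𝓝 (0 : ℝ), inner ℝ (deriv G t) (dirPerp ω) =
      deriv h (inner ℝ (G t - G 0) (dir ω)) * inner ℝ (deriv G t) (dir ω) := by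
    filter_upwards [hu (dir ω), hu (dirPerp ω), hu0.eventually hh', hgraph.eventually_nhds]
      with t h3 h4 h5 h6
    exact (h4.congr_of_eventuallyEq (h6.mono fun s hs => hs.symm)).unique (h5.comp t h3)
  have hv0 : inner ℝ (deriv G 0) (dirPerp ω) = 0 := by
    simpa [h1] using hv'.self_of_nhds
  have hv2 : inner ℝ (deriv (deriv G) 0) (dirPerp ω) = 0 := by
    have h3 : HasDerivAt (fun t => deriv h (inner ℝ (G t - G 0) (dir ω))) 0 0 := by
      have h4 : HasDerivAt (deriv h) 0 (inner ℝ (G 0 - G 0) (dir ω)) := by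
        simpa [h2] using hh2
      have h5 : HasDerivAt (fun t => deriv h (inner ℝ (G t - G 0) (dir ω)))
          (0 * inner ℝ (deriv G 0) (dir ω)) 0 := 
        HasDerivAt.comp (h₂ := deriv h) (h := fun t => inner ℝ (G t - G 0) (dir ω)) 0 h4
          (hu (dir ω)).self_of_nhds
      rwa [zero_mul] at h5
    have h5 := h3.mul (hu2 (dir ω))
    have h6 := (h5.congr_of_eventuallyEq hv').unique (hu2 (dirPerp ω))
    simpa [h1] using h6.symm
  unfold planeCurvature
  obtain ⟨e1, e2⟩ := inner_add_smul_dir (deriv G 0) ω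
  obtain ⟨e3, e4⟩ := inner_add_smul_dir (deriv (deriv G) 0) ω
  rw [e1, e2, e3, e4, hv0, hv2]
  simp only [zero_mul, sub_zero, add_zero]
  rw [div_eq_zero_iff]
  left
  ring

/-- Near a point where it is tangent to the direction `ω` and has nonzero curvature, a smooth curve
is the graph of a function with nonzero second derivative. -/
theorem IsHalfPlaneChart.exists_graph {Φ : OpenPartialHomeomorph Plane Plane} {V : Set Plane}
    {x : Plane} {ω : ℝ} (h : IsHalfPlaneChart Φ V x)
    (hk : planeCurvature (fun t : ℝ => Φ.symm !₂[t, 0]) 0 ≠ 0)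
    (ht : fderiv ℝ Φ x (dir ω) 1 = 0) :
    ∃ (g : ℝ → ℝ) (ε : ℝ), ε ≠ 0 ∧ ContDiffAt ℝ 2 g 0 ∧ g 0 = 0 ∧ deriv g 0 = 0 ∧
      deriv (deriv g) 0 ≠ 0 ∧ ∀ᶠ z : ℝ × ℝ in 𝓝 (0, 0),
        (Φ (x + z.1 • dir ω + z.2 • dirPerp ω) 1 = 0 ↔ z.2 = g z.1) ∧
        (0 < Φ (x + z.1 • dir ω + z.2 • dirPerp ω) 1 ↔ 0 < ε * (z.2 - g z.1)) := by
  set E : ℝ × ℝ → Plane := fun z => x + z.1 • dir ω + z.2 • dirPerp ω with hE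
  have hEc : ContDiff ℝ 2 E := by fun_prop
  have hE0 : E (0, 0) = x := by simp [hE]
  have hEd : HasFDerivAt E ((ContinuousLinearMap.fst ℝ ℝ ℝ).smulRight (dir ω) +
      (ContinuousLinearMap.snd ℝ ℝ ℝ).smulRight (dirPerp ω)) (0, 0) :=
    ((hasFDerivAt_fst.smul_const (dir ω)).const_add x).add (hasFDerivAt_snd.smul_const (dirPerp ω))
  have hg : ContDiffAt ℝ 2 (fun z => Φ (E z) 1) (0, 0) := by
    refine ContDiffAt.comp (g := fun p => Φ p 1) (f := E) (0, 0) ?_ hEc.contDiffAt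
    rw [hE0]
    exact h.contDiffAt_coord 1 (n := 2)
  have hgd : ∀ v, fderiv ℝ (fun z => Φ (E z) 1) (0, 0) v =
      fderiv ℝ Φ x (v.1 • dir ω + v.2 • dirPerp ω) 1 := fun v => by
    have h1 := h.hasFDerivAt_coord 1
    rw [← hE0] at h1
    have h2 : fderiv ℝ (fun z => Φ (E z) 1) (0, 0) = _ := (h1.comp (0, 0) hEd).fderiv
    rw [h2, hE0]
    rfl
  -- Otherwise the derivative of the second chart coordinate would vanish along both axes,
  -- contradicting surjectivity of the derivative of the chart.
  have hd : fderiv ℝ (fun z => Φ (E z) 1) (0, 0) (0, 1) ≠ 0 := by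
    rw [hgd]
    intro h0
    simp only [zero_smul, one_smul, zero_add] at h0
    have h1 := h.fderiv_apply_symm !₂[0, 1]
    rw [eq_inner_dir_add (fderiv ℝ Φ.symm 0 !₂[0, 1]) ω] at h1
    have h2 := congrArg (fun v : Plane => v 1) h1
    simp [ht, h0] at h2
  obtain ⟨g, hg2, hg0, hg1, hev⟩ := exists_implicit two_ne_zero hg
    (by rw [hE0]; exact h.coord_base 1) hd
  have hg1' : deriv g 0 = 0 := by
    rw [hg1, hgd]
    simp [ht]
  refine ⟨g, _, hd, hg2, hg0, hg1', fun h2 => hk ?_, hev⟩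
  have hline : ContDiff ℝ 2 fun t : ℝ => (!₂[t, 0] : Plane) := by
    rw [contDiff_euclidean]
    intro i
    fin_cases i <;> simp <;> fun_prop
  have hl0 : (!₂[(0 : ℝ), 0] : Plane) = 0 := by ext i; fin_cases i <;> simp
  have hG : ContDiffAt ℝ 2 (fun t : ℝ => Φ.symm !₂[t, 0]) 0 := by
    refine ContDiffAt.comp (g := Φ.symm) (f := fun t : ℝ => (!₂[t, 0] : Plane)) 0 ?_
      hline.contDiffAt
    rw [hl0]
    exact h.contDiffAt_symm (n := 2)
  have hG0 : Φ.symm !₂[(0 : ℝ), 0] = x := by rw [hl0, h.symm_zero]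
  refine planeCurvature_eq_zero_of_graph (ω := ω) hG hg2 hg1' h2 ?_
  have htend : Tendsto (fun t : ℝ => (inner ℝ (Φ.symm !₂[t, 0] - x) (dir ω),
      inner ℝ (Φ.symm !₂[t, 0] - x) (dirPerp ω))) (𝓝 0) (𝓝 ((0 : ℝ), (0 : ℝ))) := by
    have h3 : ContinuousAt (fun t : ℝ => (inner ℝ (Φ.symm !₂[t, 0] - x) (dir ω),
      inner ℝ (Φ.symm !₂[t, 0] - x) (dirPerp ω))) 0 :=
      ((hG.continuousAt.sub continuousAt_const).inner continuousAt_const).prodMk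
        ((hG.continuousAt.sub continuousAt_const).inner continuousAt_const)
    have := h3.tendsto
    simp only [hG0, sub_self, inner_zero_left] at this
    exact this
  have htgt : ∀ᶠ t : ℝ in 𝓝 0, (!₂[t, 0] : Plane) ∈ Φ.target := by
    refine hline.continuous.continuousAt.eventually (Φ.open_target.mem_nhds ?_)
    simp only [hl0]
    exact h.zero_mem_target
  filter_upwards [htend.eventually hev, htgt] with t h3 h4
  rw [hG0]
  refine h3.1.1 ?_
  have h5 : E (inner ℝ (Φ.symm !₂[t, 0] - x) (dir ω), inner ℝ (Φ.symm !₂[t, 0] - x) (dirPerp ω)) =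
      Φ.symm !₂[t, 0] := by
    simp only [hE]
    rw [add_assoc, ← eq_inner_dir_add, add_sub_cancel]
  rw [h5, Φ.right_inv h4]
  simp

theorem dir_add (ω l : ℝ) : dir (ω + l) = cos l • dir ω + sin l • dirPerp ω := by
  ext i
  fin_cases i <;> simp [dir, dirPerp, cos_add, sin_add] <;> ring

section Tangency

variable {g : ℝ → ℝ} {a : Plane → ℝ} {x y : Plane} {ω c c' τ : ℝ}

/-- A function taking two values, according to the side of a curve, along the lines parallel to a
tangent of the curve. -/
theorem jumpRep_parallel_tangent (hg : ContDiffAt ℝ 2 g 0) (hg0 : g 0 = 0) (hg1 : deriv g 0 = 0)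
    (hg2 : deriv (deriv g) 0 ≠ 0) (hc : c ≠ c')
    (ha : ∀ᶠ z : ℝ × ℝ in 𝓝 (0, 0),
      (g z.1 < z.2 → a (x + z.1 • dir ω + z.2 • dirPerp ω) = c) ∧
      (z.2 < g z.1 → a (x + z.1 • dir ω + z.2 • dirPerp ω) = c')) :
    ∃ J₁ J₂, (J₁ ≠ 0 ∨ J₂ ≠ 0) ∧ JumpRep (fun l => √|l|)
      (fun l r => a (lineMap (fun l => x + l • dirPerp ω) (fun _ => ω) (l, r))) 0 J₁ J₂ := by
  obtain ⟨J₁, J₂, hJ, h⟩ := jumpRep_fold hg hg0 hg1 hg2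
  have hc' := sub_ne_zero.2 hc
  refine ⟨_, _, ?_, h _ c c' ?_⟩
  · rcases hJ with ⟨-, hJ⟩ | ⟨hJ, -⟩
    · exact .inr (mul_ne_zero hc' hJ)
    · exact .inl (mul_ne_zero hc' hJ)
  · have ht : Tendsto (fun z : ℝ × ℝ => (z.2, z.1)) (𝓝 (0, 0)) (𝓝 (0, 0)) :=
      (continuous_snd.prodMk continuous_fst).tendsto ((0 : ℝ), (0 : ℝ))
    filter_upwards [ht.eventually ha] with z hz
    have e : lineMap (fun l => x + l • dirPerp ω) (fun _ => ω) (z.1, z.2) =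
        x + z.2 • dir ω + z.1 • dirPerp ω := by simp only [lineMap]; abel
    simp only [e]
    exact hz

/-- A function taking two values, according to the side of a curve, along the lines through a fixed
point of a tangent of the curve. -/
theorem jumpRep_rotating_tangent (hg : ContDiffAt ℝ 2 g 0) (hg0 : g 0 = 0) (hg1 : deriv g 0 = 0)
    (hg2 : deriv (deriv g) 0 ≠ 0) (hc : c ≠ c') (hxy : x = y + τ • dir ω)
    (ha : ∀ᶠ z : ℝ × ℝ in 𝓝 (0, 0),
      (g z.1 < z.2 → a (x + z.1 • dir ω + z.2 • dirPerp ω) = c) ∧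
      (z.2 < g z.1 → a (x + z.1 • dir ω + z.2 • dirPerp ω) = c')) :
    ∃ J₁ J₂, (τ ≠ 0 → J₁ ≠ 0 ∨ J₂ ≠ 0) ∧ (τ = 0 → J₁ = 0 ∧ J₂ = 0) ∧ JumpRep (fun l => √|sin l|)
      (fun l r => a (lineMap (fun _ => y) (fun l => ω + l) (l, r))) τ J₁ J₂ := by
  have hc' := sub_ne_zero.2 hc
  -- The line of slope μ through y, in coordinates centred at x with u along the tangent: y sits at
  -- u = -τ, so the height at u is μ (u + τ).
  set A : ℝ → ℝ → ℝ := fun μ u => a (x + u • dir ω + (μ * (u + τ)) • dirPerp ω) with hA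
  have hpolar : ∀ J₁ J₂, JumpRep (fun l => √|l|) A 0 J₁ J₂ → JumpRep (fun l => √|sin l|)
      (fun l r => a (lineMap (fun _ => y) (fun l => ω + l) (l, r))) τ J₁ J₂ := by
    intro J₁ J₂ hJ
    refine (hJ.polar τ).congr ?_
    have hcos : ∀ᶠ z : ℝ × ℝ in 𝓝 (0, τ), 0 < cos z.1 := by
      have : ContinuousAt (fun z : ℝ × ℝ => cos z.1) (0, τ) := by fun_prop
      exact this.eventually (lt_mem_nhds (by simp))
    filter_upwards [hcos] with z hz
    have h1 : tan z.1 * (z.2 * cos z.1 - τ + τ) = z.2 * sin z.1 := by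
      rw [tan_eq_sin_div_cos]
      field_simp
      ring
    simp only [hA, lineMap, h1, dir_add, hxy]
    congr 1
    module
  have htend : Tendsto (fun z : ℝ × ℝ => (z.2, z.1 * (z.2 + τ))) (𝓝 (0, 0)) (𝓝 (0, 0)) := by
    have : Continuous fun z : ℝ × ℝ => (z.2, z.1 * (z.2 + τ)) := by fun_prop
    simpa using this.tendsto (0, 0)
  by_cases hτ : τ = 0
  · refine ⟨0, 0, fun h => absurd hτ h, fun _ => ⟨rfl, rfl⟩, hpolar _ _ ?_⟩
    have hw : Tendsto (fun l : ℝ => √|l|) (𝓝[≠] 0) (𝓝 0) := by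
      have : Continuous fun l : ℝ => √|l| := by fun_prop
      have := this.tendsto 0
      simp only [abs_zero, sqrt_zero] at this
      exact this.mono_left nhdsWithin_le_nhds
    refine jumpRep_cross hw hg hg0 hg1 hg2 (c := c) (c' := c') ?_
    filter_upwards [htend.eventually ha] with z hz
    simp only [hA, hτ, add_zero] at hz ⊢
    rwa [mul_comm z.2 z.1]
  -- Off the pivot, μ (u + τ) = g(u) reads μ = H(u), again a fold, since H''(0) = g''(0) / τ.
  · set H : ℝ → ℝ := fun u => g u / (u + τ) with hH
    have hne : ∀ᶠ u in 𝓝 (0 : ℝ), 0 < (u + τ) * τ := by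
      have : ContinuousAt (fun u : ℝ => (u + τ) * τ) 0 := by fun_prop
      exact this.eventually (lt_mem_nhds (by simpa using hτ))
    have hH2 : ContDiffAt ℝ 2 H 0 :=
      hg.div (contDiffAt_id.add contDiffAt_const) (by simpa using hτ)
    have hH0 : H 0 = 0 := by simp [hH, hg0]
    have hgH : g =ᶠ[𝓝 0] fun u => H u * (u + τ) := by
      filter_upwards [hne] with u hu
      have : u + τ ≠ 0 := left_ne_zero_of_mul hu.ne'
      simp only [hH]
      field_simp
    have hHd : ∀ᶠ u in 𝓝 (0 : ℝ), HasDerivAt H (deriv H u) u :=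
      (hH2.eventually (by simp)).mono fun t ht => (ht.differentiableAt (by norm_num)).hasDerivAt
    have hHd2 : HasDerivAt (deriv H) (deriv (deriv H) 0) 0 :=
      ((hH2.derivWithin (m := 1) (by norm_num)).differentiableAt (by norm_num)).hasDerivAt
    have hgd : deriv g =ᶠ[𝓝 0] fun u => deriv H u * (u + τ) + H u * 1 := by
      filter_upwards [hgH.eventually_nhds, hHd] with u h1 h2
      rw [EventuallyEq.deriv_eq h1]
      exact (h2.mul ((hasDerivAt_id u).add_const τ)).deriv
    have hH1 : deriv H 0 = 0 := by
      have := hgd.self_of_nhds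
      simp only [hg1, hH0] at this
      simpa [hτ] using this.symm
    have hgd2 : deriv (deriv g) 0 = deriv (deriv H) 0 * τ := by
      rw [hgd.deriv_eq]
      have := (hHd2.mul ((hasDerivAt_id 0).add_const τ)).add (hHd.self_of_nhds.mul_const 1)
      have h3 := this.deriv
      simp only [hH1, mul_one, add_zero, id, zero_add] at h3
      simp only [mul_one]
      exact h3
    obtain ⟨J₁, J₂, hJ, h⟩ := jumpRep_fold hH2 hH0 hH1 (fun h0 => hg2 (by rw [hgd2, h0, zero_mul]))
    have hdiff : ∀ᶠ z : ℝ × ℝ in 𝓝 (0, 0), g z.2 = H z.2 * (z.2 + τ) ∧ 0 < (z.2 + τ) * τ :=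
      (continuous_snd.tendsto ((0 : ℝ), (0 : ℝ))).eventually (hgH.and hne)
    rcases lt_or_gt_of_ne hτ with hneg | hpos
    -- For τ < 0, dividing by the negative number u + τ exchanges the two sides, hence c and c'.
    · refine ⟨_, _, fun _ => ?_, fun h => absurd h hτ, hpolar _ _ (h A c' c ?_)⟩
      · rcases hJ with ⟨-, hJ⟩ | ⟨hJ, -⟩
        · exact .inr (mul_ne_zero (sub_ne_zero.2 hc.symm) hJ)
        · exact .inl (mul_ne_zero (sub_ne_zero.2 hc.symm) hJ)
      · filter_upwards [htend.eventually ha, hdiff] with z hz h1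
        have h2 : z.2 + τ < 0 := by nlinarith [h1.2]
        refine ⟨fun h3 => hz.2 ?_, fun h3 => hz.1 ?_⟩
        · simp only [h1.1]
          exact mul_lt_mul_of_neg_right h3 h2
        · simp only [h1.1]
          exact mul_lt_mul_of_neg_right h3 h2
    · refine ⟨_, _, fun _ => ?_, fun h => absurd h hτ, hpolar _ _ (h A c c' ?_)⟩
      · rcases hJ with ⟨-, hJ⟩ | ⟨hJ, -⟩
        · exact .inr (mul_ne_zero hc' hJ)
        · exact .inl (mul_ne_zero hc' hJ)
      · filter_upwards [htend.eventually ha, hdiff] with z hz h1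
        have h2 : 0 < z.2 + τ := by nlinarith [h1.2]
        refine ⟨fun h3 => hz.1 ?_, fun h3 => hz.2 ?_⟩
        · simp only [h1.1]
          exact mul_lt_mul_of_pos_right h3 h2
        · simp only [h1.1]
          exact mul_lt_mul_of_pos_right h3 h2

end Tangency

/-! ### Shared boundaries and multi-bang functions. -/

theorem IsHalfPlaneChart.mem_frontier_iff {Φ : OpenPartialHomeomorph Plane Plane} {V : Set Plane}
    {x z : Plane} (h : IsHalfPlaneChart Φ V x) (hz : z ∈ Φ.source) :
    z ∈ frontier V ↔ Φ z 1 = 0 := by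
  have himg : Φ.IsImage V {p | 0 < p 1} := fun z hz => (h.mem_iff z hz).symm
  rw [← himg.frontier hz]
  constructor
  · intro h1
    exact (frontier_lt_subset_eq continuous_const (continuous_coord 1) h1).symm
  · intro h1
    refine mem_frontier_of_ray (w := !₂[0, 1]) (isOpen_lt continuous_const (continuous_coord 1))
      ?_ ?_
    · simp [h1]
    · intro ε hε
      simpa [h1] using hε

/-- An open set which shares its boundary near `x` with a disjoint set of smooth boundary lies on
the other side of this boundary. -/
theorem IsHalfPlaneChart.eventually_mem_of_frontier_eq {Φ : OpenPartialHomeomorph Plane Plane}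
    {V U : Set Plane} {x : Plane} (h : IsHalfPlaneChart Φ V x) (hU : IsOpen U) (hd : Disjoint U V)
    (hx : x ∈ frontier U) (hfr : ∀ᶠ z in 𝓝 x, z ∈ frontier U ↔ z ∈ frontier V) :
    ∀ᶠ z in 𝓝 x, Φ z 1 < 0 → z ∈ U := by
  have hsymm : Tendsto Φ.symm (𝓝 0) (𝓝 x) := by
    simpa [h.symm_zero] using h.hasFDerivAt_symm.continuousAt.tendsto
  obtain ⟨ρ, hρ, hball⟩ := Metric.eventually_nhds_iff_ball.1
    ((hsymm.eventually hfr).and (Φ.open_target.mem_nhds h.zero_mem_target))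
  -- A half ball is convex, so its preimage under the chart is connected; it misses the frontier of
  -- U and meets U, hence lies in U.
  set N : Set Plane := Metric.ball 0 ρ ∩ {p | p 1 < 0} with hN
  have hNc : IsPreconnected N := by
    refine Convex.isPreconnected ((convex_ball 0 ρ).inter ?_)
    exact convex_halfSpace_lt (EuclideanSpace.proj (𝕜 := ℝ) (1 : Fin 2)).toLinearMap.isLinear 0
  have hWc : IsPreconnected (Φ.symm '' N) :=
    hNc.image _ (Φ.continuousOn_symm.mono fun p hp => (hball p hp.1).2)
  have hdisj : ∀ z ∈ Φ.symm '' N, z ∉ frontier U := by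
    rintro _ ⟨p, hp, rfl⟩ hpU
    have h1 := ((hball p hp.1).1.1 hpU)
    rw [h.mem_frontier_iff (Φ.map_target (hball p hp.1).2), Φ.right_inv (hball p hp.1).2] at h1
    exact (ne_of_lt hp.2) h1
  have hnear : ∀ᶠ z in 𝓝 x, z ∈ Φ.source ∧ Φ z ∈ Metric.ball 0 ρ := by
    refine Filter.Eventually.and (Φ.open_source.mem_nhds h.mem_source)
      (h.hasFDerivAt.continuousAt.eventually ?_)
    rw [h.map_base]
    exact Metric.ball_mem_nhds 0 hρ
  have hmemN : ∀ z, z ∈ Φ.source → Φ z ∈ Metric.ball 0 ρ → Φ z 1 < 0 → z ∈ Φ.symm '' N :=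
    fun z h1 h2 h3 => ⟨Φ z, ⟨h2, h3⟩, Φ.left_inv h1⟩
  -- Points of U accumulate at x; they are not in V by disjointness, and not on the curve since U is
  -- open.
  have hne : (Φ.symm '' N ∩ U).Nonempty := by
    have hfreq := mem_closure_iff_frequently.1 (frontier_subset_closure hx)
    obtain ⟨z, hzU, ⟨hz1, hz2⟩, hz3⟩ := (hfreq.and_eventually (hnear.and hfr)).exists
    refine ⟨z, hmemN z hz1 hz2 ?_, hzU⟩
    rcases lt_trichotomy (Φ z 1) 0 with h1 | h1 | h1
    · exact h1
    · have h2 := hz3.2 ((h.mem_frontier_iff hz1).2 h1)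
      rw [hU.frontier_eq] at h2
      exact absurd hzU h2.2
    · exact absurd ((h.mem_iff z hz1).2 h1) (disjoint_left.1 hd hzU)
  have hsub := hWc.subset_of_closure_inter_subset hU hne fun y hy => by
    by_contra hyU
    exact hdisj y hy.2 (by rw [hU.frontier_eq]; exact ⟨hy.1, hyU⟩)
  filter_upwards [hnear] with z hz h1 using hsub (hmemN z hz.1 hz.2 h1)

theorem isLineFamily_parallel (x : Plane) (ω : ℝ) :
    IsLineFamily (fun l => x + l • dirPerp ω) (fun _ => ω) ω where
  contDiff_base := by fun_prop
  contDiff_angle := contDiff_const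
  angle_zero := rfl
  transversal τ := by
    left
    intro k
    have h : HasDerivAt (fun l : ℝ => x + l • dirPerp ω) ((1 : ℝ) • dirPerp ω) 0 :=
      ((hasDerivAt_id (0 : ℝ)).smul_const (dirPerp ω)).const_add x
    rw [h.deriv]
    simpa using dirPerp_ne_smul_dir ω one_ne_zero k

theorem isLineFamily_rotating (y : Plane) (ω : ℝ) :
    IsLineFamily (fun _ => y) (fun l => ω + l) ω where
  contDiff_base := contDiff_const
  contDiff_angle := by fun_prop
  angle_zero := add_zero ω
  transversal τ := by
    by_cases hτ : τ = 0
    · right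
      intro l
      simp [lineMap, hτ]
    · left
      intro k
      simpa using dirPerp_ne_smul_dir ω hτ k

namespace IsMultiBang

variable {n : ℕ} {a : Plane → ℝ} {c : Fin n → ℝ} {Ω : Fin n → Set Plane}

theorem eq_of_mem (ha : IsMultiBang a c Ω) {s : Finset (Fin n)} {j : Fin n} (hj : j ∈ s) {z : Plane}
    (hz : z ∈ Ω j) : ∑ i ∈ s, (Ω i).indicator (fun _ => c i) z = c j := by
  rw [Finset.sum_eq_single_of_mem j hj, indicator_of_mem hz]
  intro i _ hij
  exact indicator_of_notMem (fun h' => disjoint_left.1 (ha.disjoint hij) h' hz) _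

section Family

variable {P : ℝ → Plane} {φ : ℝ → ℝ} {ω₀ τ : ℝ} {w : ℝ → ℝ} {w₀ : ℝ}

/-- The part of a multi-bang function coming from sets to which a line is not tangent. -/
theorem jumpRep_sum_indicator (ha : IsMultiBang a c Ω) (h : IsLineFamily P φ ω₀)
    (hw : Tendsto w (𝓝[≠] 0) (𝓝 w₀)) (s : Finset (Fin n))
    (ht : ∀ i ∈ s, ¬ IsTangentAt (Ω i) (lineMap P φ (0, τ)) ω₀) :
    ∃ j₁ j₂, JumpRep w (fun l r => ∑ i ∈ s, (Ω i).indicator (fun _ => c i) (lineMap P φ (l, r))) τ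
      (w₀ * j₁) (w₀ * j₂) ∧ ((∀ i ∈ s, ¬ HasCornerAt (Ω i) (lineMap P φ (0, τ))) → j₁ = j₂) := by
  have key : ∀ i, ∃ j₁ j₂, i ∈ s → JumpRep w
      (fun l r => (Ω i).indicator 1 (lineMap P φ (l, r))) τ (w₀ * j₁) (w₀ * j₂) ∧
      (¬ HasCornerAt (Ω i) (lineMap P φ (0, τ)) → j₁ = j₂) := fun i => by
    by_cases hi : i ∈ s
    · obtain ⟨j₁, j₂, h1⟩ := h.jumpRep_indicator hw (ha.boundary i) (ht i hi)
      exact ⟨j₁, j₂, fun _ => h1⟩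
    · exact ⟨0, 0, fun h' => absurd h' hi⟩
  choose j₁ j₂ hj using key
  refine ⟨∑ i ∈ s, c i * j₁ i, ∑ i ∈ s, c i * j₂ i, ?_, fun hc =>
    Finset.sum_congr rfl fun i hi => by rw [(hj i hi).2 (hc i hi)]⟩
  have h1 := JumpRep.sum s fun i hi => (hj i hi).1.const_mul (c i)
  rw [Finset.mul_sum, Finset.mul_sum]
  convert h1.congr (Eventually.of_forall fun z => ?_) using 1
  · exact Finset.sum_congr rfl fun i _ => by ring
  · exact Finset.sum_congr rfl fun i _ => by ring
  · refine Finset.sum_congr rfl fun i _ => ?_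
    by_cases hz : lineMap P φ (z.1, z.2) ∈ Ω i
    · simp [indicator_of_mem hz]
    · simp [indicator_of_notMem hz]

/-- Along a line, jumps of order zero only appear where the line is tangent to a boundary. -/
theorem jumpRep_of_sum_tangent (ha : IsMultiBang a c Ω) (h : IsLineFamily P φ ω₀)
    (hw : Tendsto w (𝓝[≠] 0) (𝓝 0)) (s : Finset (Fin n))
    (ht : ∀ i ∉ s, ¬ IsTangentAt (Ω i) (lineMap P φ (0, τ)) ω₀) {J₁ J₂ : ℝ}
    (hs : JumpRep w (fun l r => ∑ i ∈ s, (Ω i).indicator (fun _ => c i) (lineMap P φ (l, r))) τ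
      J₁ J₂) : JumpRep w (fun l r => a (lineMap P φ (l, r))) τ J₁ J₂ := by
  classical
  obtain ⟨j₁, j₂, hj, -⟩ := ha.jumpRep_sum_indicator h hw sᶜ
    (fun i hi => ht i (Finset.mem_compl.1 hi))
  have := hs.add hj
  rw [zero_mul, zero_mul, add_zero, add_zero] at this
  refine this.congr (Eventually.of_forall fun z => ?_)
  rw [ha.eq_sum, Finset.sum_add_sum_compl]

end Family

/-- Near a point of nonzero curvature, the sets touching it with a tangent boundary contribute two
different values, one on each side of the boundary. -/
theorem exists_graph (ha : IsMultiBang a c Ω) {j : Fin n} {x : Plane} {ω₀ : ℝ}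
    (hk : HasNonzeroCurvatureAt (Ω j) x) {s : Finset (Fin n)} (hjs : j ∈ s)
    (hs : ∀ i ∈ s, IsTangentAt (Ω i) x ω₀ ∧
      ∀ᶠ z in 𝓝 x, z ∈ frontier (Ω i) ↔ z ∈ frontier (Ω j)) :
    ∃ (g : ℝ → ℝ) (b b' : ℝ), ContDiffAt ℝ 2 g 0 ∧ g 0 = 0 ∧ deriv g 0 = 0 ∧
      deriv (deriv g) 0 ≠ 0 ∧ b ≠ b' ∧ ∀ᶠ z : ℝ × ℝ in 𝓝 (0, 0),
        (g z.1 < z.2 → ∑ i ∈ s, (Ω i).indicator (fun _ => c i)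
          (x + z.1 • dir ω₀ + z.2 • dirPerp ω₀) = b) ∧
        (z.2 < g z.1 → ∑ i ∈ s, (Ω i).indicator (fun _ => c i)
          (x + z.1 • dir ω₀ + z.2 • dirPerp ω₀) = b') := by
  obtain ⟨Φ, hΦ, hk⟩ := hk
  have hsrc := Φ.open_source.mem_nhds hΦ.mem_source
  -- A further set sharing the boundary fills the whole other side and contributes its own value;
  -- without one, the other side contributes 0. Both differ from c j, by distinctness and by
  -- nonvanishing of the values.
  obtain ⟨c', hc', hval⟩ : ∃ c', c j ≠ c' ∧ ∀ᶠ z in 𝓝 x,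
      (0 < Φ z 1 → ∑ i ∈ s, (Ω i).indicator (fun _ => c i) z = c j) ∧
      (Φ z 1 < 0 → ∑ i ∈ s, (Ω i).indicator (fun _ => c i) z = c') := by
    by_cases hex : ∃ i ∈ s, i ≠ j
    · obtain ⟨i, his, hij⟩ := hex
      refine ⟨c i, fun h => hij (ha.value_injective h.symm), ?_⟩
      filter_upwards [hsrc, hΦ.eventually_mem_of_frontier_eq (ha.isOpen i) (ha.disjoint hij)
        (hs i his).1.1 (hs i his).2] with z hz h1
      exact ⟨fun h2 => ha.eq_of_mem hjs ((hΦ.mem_iff z hz).2 h2), fun h2 => ha.eq_of_mem his (h1 h2)⟩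
    · refine ⟨0, ha.value_ne_zero j, ?_⟩
      filter_upwards [hsrc] with z hz
      refine ⟨fun h2 => ha.eq_of_mem hjs ((hΦ.mem_iff z hz).2 h2), fun h2 =>
        Finset.sum_eq_zero fun i hi => indicator_of_notMem (fun h3 => ?_) _⟩
      have hij : i = j := by_contra fun h4 => hex ⟨i, hi, h4⟩
      rw [hij] at h3
      exact lt_asymm h2 ((hΦ.mem_iff z hz).1 h3)
  have ht : fderiv ℝ Φ x (dir ω₀) 1 = 0 := by
    refine fderiv_coord_eq_zero_of_tangent hΦ.toIsSmoothChartAt ?_ (hs j hjs).1.2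
    filter_upwards [hsrc] with z hz
    exact (hΦ.mem_frontier_iff hz).1
  obtain ⟨g, ε, hε, hg, hg0, hg1, hg2, hgraph⟩ := hΦ.exists_graph hk ht
  have htend : Tendsto (fun z : ℝ × ℝ => x + z.1 • dir ω₀ + z.2 • dirPerp ω₀) (𝓝 (0, 0)) (𝓝 x) := by
    have : Continuous fun z : ℝ × ℝ => x + z.1 • dir ω₀ + z.2 • dirPerp ω₀ := by fun_prop
    simpa using this.tendsto (0, 0)
  have hneg : ∀ z : ℝ × ℝ, (Φ (x + z.1 • dir ω₀ + z.2 • dirPerp ω₀) 1 = 0 ↔ z.2 = g z.1) →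
      (0 < Φ (x + z.1 • dir ω₀ + z.2 • dirPerp ω₀) 1 ↔ 0 < ε * (z.2 - g z.1)) →
      ε * (z.2 - g z.1) < 0 → Φ (x + z.1 • dir ω₀ + z.2 • dirPerp ω₀) 1 < 0 := by
    intro z h1 h2 h3
    rcases lt_trichotomy (Φ (x + z.1 • dir ω₀ + z.2 • dirPerp ω₀) 1) 0 with h4 | h4 | h4
    · exact h4
    · rw [h1.1 h4, sub_self, mul_zero] at h3
      exact absurd h3 (lt_irrefl 0)
    · exact absurd (h2.1 h4) (lt_asymm h3)
  rcases lt_or_gt_of_ne hε with hε | hε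
  · refine ⟨g, c', c j, hg, hg0, hg1, hg2, hc'.symm, ?_⟩
    filter_upwards [htend.eventually hval, hgraph] with z h1 h2
    exact ⟨fun h3 => h1.2 (hneg z h2.1 h2.2 (by nlinarith)),
      fun h3 => h1.1 (h2.2.2 (by nlinarith))⟩
  · refine ⟨g, c j, c', hg, hg0, hg1, hg2, hc', ?_⟩
    filter_upwards [htend.eventually hval, hgraph] with z h1 h2
    exact ⟨fun h3 => h1.1 (h2.2.2 (by nlinarith)),
      fun h3 => h1.2 (hneg z h2.1 h2.2 (by nlinarith))⟩

end IsMultiBang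

/-! ### The transform as an attenuated integral along a family of lines. -/

theorem setIntegral_Ioi_comp_add (g : ℝ → ℝ) (t : ℝ) :
    ∫ r in Ioi (0 : ℝ), g (r + t) = ∫ r in Ioi t, g r := by
  have h := (MeasureTheory.measurePreserving_add_right MeasureTheory.volume t).setIntegral_preimage_emb
    (MeasurableEquiv.addRight t).measurableEmbedding g (Ioi t)
  rw [← h]
  congr 2
  ext r
  simp

/-- The attenuated Radon transform on the line with direction `ω` through `p`. -/
theorem attRadon_eq (a f : Plane → ℝ) {p : Plane} {s t₀ ω : ℝ}
    (hp : p = s • dirPerp ω + t₀ • dir ω) :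
    attRadon a f s ω =
      ∫ t : ℝ, f (p + t • dir ω) * exp (-∫ r in Ioi t, a (p + r • dir ω)) := by
  unfold attRadon beamTransform
  rw [← MeasureTheory.integral_add_right_eq_self _ t₀]
  refine MeasureTheory.integral_congr_ae (Eventually.of_forall fun t => ?_)
  have h : ∀ r : ℝ, p + r • dir ω = s • dirPerp ω + (r + t₀) • dir ω := fun r => by
    rw [hp]; module
  simp only [h]
  rw [← setIntegral_Ioi_comp_add (fun r : ℝ => a (s • dirPerp ω + (r + t₀) • dir ω)) t]
  have h' : ∀ r : ℝ, s • dirPerp ω + (t + t₀) • dir ω + r • dir ω =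
      s • dirPerp ω + (r + t + t₀) • dir ω := fun r => by module
  simp only [h']

theorem attRadon_add_eq_attIntegral (a f : Plane → ℝ) {x : Plane} {s₀ ω₀ : ℝ}
    (hx : x ∈ lineSet s₀ ω₀) (s : ℝ) : attRadon a f s ω₀ =
      attIntegral (fun z => f (lineMap (fun l => x + l • dirPerp ω₀) (fun _ => ω₀) z))
        (fun l r => a (lineMap (fun l => x + l • dirPerp ω₀) (fun _ => ω₀) (l, r))) (s - s₀) := by
  obtain ⟨t, ht⟩ := hx
  exact attRadon_eq a f (p := x + (s - s₀) • dirPerp ω₀) (t₀ := t) (by rw [ht]; module)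

/-- The inner product with `dirPerp ω` is the offset of the line through y; counting the line
parameter from y makes the family rotate about its parameter 0. -/
theorem attRadon_inner_eq_attIntegral (a f : Plane → ℝ) (y : Plane) (ω₀ ω : ℝ) :
    attRadon a f (inner ℝ y (dirPerp ω)) ω =
      attIntegral (fun z => f (lineMap (fun _ => y) (fun l => ω₀ + l) z))
        (fun l r => a (lineMap (fun _ => y) (fun l => ω₀ + l) (l, r))) (ω - ω₀) := by
  rw [attRadon_eq a f (p := y) (t₀ := inner ℝ y (dir ω))
    (by rw [add_comm]; exact eq_inner_dir_add y ω)]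
  simp only [attIntegral, lineMap, add_sub_cancel]

/-- Directions are unit vectors and the base points stay bounded for |l| ≤ 1, so the point with
parameter r has norm at least |r| minus a constant. -/
theorem IsLineFamily.exists_notMem_of_isBounded {P : ℝ → Plane} {φ : ℝ → ℝ} {ω₀ : ℝ}
    (h : IsLineFamily P φ ω₀) {B : Set Plane} (hB : Bornology.IsBounded B) :
    ∃ M : ℝ, ∀ l r : ℝ, |l| ≤ 1 → M ≤ |r| → lineMap P φ (l, r) ∉ B := by
  obtain ⟨K, hK⟩ := (isCompact_Icc (a := (-1 : ℝ)) (b := 1)).exists_bound_of_continuousOn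
    h.contDiff_base.continuous.continuousOn
  obtain ⟨R, hR⟩ := hB.exists_norm_le
  refine ⟨K + R + 1, fun l r hl hr hmem => ?_⟩
  have h1 := hR _ hmem
  have h2 := hK l (abs_le.1 hl)
  have h3 : ‖r • dir (φ l)‖ = |r| := by rw [norm_smul, norm_dir, mul_one, Real.norm_eq_abs]
  have h4 : r • dir (φ l) = lineMap P φ (l, r) - P l := by simp [lineMap]
  have h5 := norm_sub_le (lineMap P φ (l, r)) (P l)
  rw [← h4, h3] at h5
  linarith

namespace IsMultiBang

variable {n : ℕ} {a : Plane → ℝ} {c : Fin n → ℝ} {Ω : Fin n → Set Plane}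

theorem exists_bounds (ha : IsMultiBang a c Ω) {f : Plane → ℝ} (hf : ContDiff ℝ 1 f)
    (hfc : HasCompactSupport f) {P : ℝ → Plane} {φ : ℝ → ℝ} {ω₀ : ℝ} (h : IsLineFamily P φ ω₀) :
    ∃ M, StripSupported (fun z => f (lineMap P φ z)) M ∧
      IsAttenuation (fun l r => a (lineMap P φ (l, r))) M := by
  have hB : Bornology.IsBounded (tsupport f ∪ ⋃ j, Ω j) :=
    (IsCompact.isBounded hfc).union (Bornology.isBounded_iUnion.2 ha.isBounded)
  obtain ⟨M, hM⟩ := h.exists_notMem_of_isBounded hB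
  have hmeas : Measurable a := by
    have : a = fun x => ∑ j, (Ω j).indicator (fun _ => c j) x := funext ha.eq_sum
    rw [this]
    exact Finset.measurable_sum _ fun j _ => measurable_const.indicator (ha.isOpen j).measurableSet
  refine ⟨M, ⟨hf.comp h.contDiff_lineMap, fun l t hl ht => ?_⟩, ⟨fun l => ?_, ?_, fun l r hl hr => ?_⟩⟩
  · exact image_eq_zero_of_notMem_tsupport fun h' => hM l t hl ht (.inl h')
  · exact hmeas.comp (h.contDiff_lineMap.continuous.comp (by fun_prop)).measurable
  · refine ⟨∑ j, |c j|, fun l r => ?_⟩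
    rw [ha.eq_sum]
    refine (Finset.abs_sum_le_sum_abs _ _).trans (Finset.sum_le_sum fun j _ => ?_)
    by_cases hz : lineMap P φ (l, r) ∈ Ω j
    · rw [indicator_of_mem hz]
    · rw [indicator_of_notMem hz, abs_zero]
      exact abs_nonneg _
  · rw [ha.eq_sum]
    exact Finset.sum_eq_zero fun j _ => indicator_of_notMem
      (fun h' => hM l r hl hr (.inr (mem_iUnion.2 ⟨j, h'⟩))) _

end IsMultiBang

/-! ### Multi-bang functions at a corner. -/

theorem IsSmoothChartAt.mem_closure_of_quadrant {Φ : OpenPartialHomeomorph Plane Plane} {x : Plane}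
    {V : Set Plane} (h : IsSmoothChartAt Φ x)
    (hV : ∀ y ∈ Φ.source, 0 < Φ y 0 → 0 < Φ y 1 → y ∈ V) : x ∈ closure V := by
  have hmem : ∀ p ∈ Φ.target, 0 < p 0 → 0 < p 1 → Φ.symm p ∈ V := fun p hp h0 h1 =>
    hV _ (Φ.map_target hp) (by rwa [Φ.right_inv hp]) (by rwa [Φ.right_inv hp])
  have hlim : Tendsto (fun ε : ℝ => (!₂[ε, ε] : Plane)) (𝓝[>] 0) (𝓝 0) := by
    have hc : Continuous fun ε : ℝ => ε • (!₂[1, 1] : Plane) := by fun_prop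
    have := hc.tendsto 0
    rw [zero_smul] at this
    refine (this.mono_left nhdsWithin_le_nhds).congr fun ε => ?_
    ext i
    fin_cases i <;> simp
  have hsymm : Tendsto Φ.symm (𝓝 0) (𝓝 x) := by
    simpa [h.symm_zero] using h.hasFDerivAt_symm.continuousAt.tendsto
  refine mem_closure_of_tendsto (hsymm.comp hlim) ?_
  filter_upwards [hlim.eventually (Φ.open_target.mem_nhds h.zero_mem_target), self_mem_nhdsWithin]
    with ε h1 h2
  exact hmem _ h1 (by simpa using h2) (by simpa using h2)

namespace IsMultiBang

variable {n : ℕ} {a : Plane → ℝ} {c : Fin n → ℝ} {Ω : Fin n → Set Plane}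

theorem isOpen_region (ha : IsMultiBang a c Ω) (m : Option (Fin n)) : IsOpen (region Ω m) := by
  cases m with
  | none => exact (isClosed_iUnion_of_finite fun j => isClosed_closure).isOpen_compl
  | some j => exact ha.isOpen j

theorem disjoint_region (ha : IsMultiBang a c Ω) {m : Option (Fin n)} {j : Fin n} (hm : m ≠ some j) :
    Disjoint (region Ω m) (Ω j) := by
  cases m with
  | none => exact disjoint_left.2 fun z hz hj => hz (mem_iUnion.2 ⟨j, subset_closure hj⟩)
  | some i => exact ha.disjoint fun h => hm (congrArg some h)

/-- At a corner shared by two regions, a multi-bang function takes one value inside a sector and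
another one outside. -/
theorem exists_values_of_corner (ha : IsMultiBang a c Ω) {j : Fin n} {x : Plane}
    (hx : x ∈ closure (Ω j)) {l : Option (Fin n)} (hl : l ≠ some j)
    (hm : ∀ m : Option (Fin n), x ∈ frontier (region Ω m) → m = some j ∨ m = l) :
    ∃ b', c j ≠ b' ∧ ∀ᶠ z in 𝓝 x, (z ∈ Ω j → a z = c j) ∧ (z ∉ closure (Ω j) → a z = b') := by
  have hin : ∀ z ∈ Ω j, a z = c j := fun z hz => by
    rw [ha.eq_sum]
    exact ha.eq_of_mem (Finset.mem_univ j) hz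
  -- A third region does not have x on its frontier, nor in its interior, as it would then meet Ω j.
  have hfar : ∀ m : Option (Fin n), m ≠ some j → m ≠ l → ∀ᶠ z in 𝓝 x, z ∉ closure (region Ω m) := by
    intro m h1 h2
    refine isClosed_closure.isOpen_compl.mem_nhds fun h3 => ?_
    rcases hm m (by
      rw [(ha.isOpen_region m).frontier_eq]
      refine ⟨h3, fun h4 => ?_⟩
      obtain ⟨y, hy1, hy2⟩ := mem_closure_iff.1 hx _ (ha.isOpen_region m) h4
      exact disjoint_left.1 (ha.disjoint_region h1) hy1 hy2) with h5 | h5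
    · exact h1 h5
    · exact h2 h5
  cases l with
  | none =>
    refine ⟨0, ha.value_ne_zero j, ?_⟩
    have h1 : ∀ᶠ z in 𝓝 x, ∀ i, i ≠ j → z ∉ closure (Ω i) := eventually_all.2 fun i => by
      by_cases hij : i = j
      · exact Eventually.of_forall fun z h => absurd hij h
      · exact (hfar (some i) (fun h => hij (Option.some.inj h)) (by simp)).mono fun z hz _ => hz
    filter_upwards [h1] with z hz
    refine ⟨hin z, fun hzj => ?_⟩
    rw [ha.eq_sum]
    refine Finset.sum_eq_zero fun i _ => indicator_of_notMem (fun h2 => ?_) _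
    by_cases hij : i = j
    · exact hzj (subset_closure (hij ▸ h2))
    · exact hz i hij (subset_closure h2)
  | some k =>
    refine ⟨c k, fun h => hl (congrArg some (ha.value_injective h.symm)), ?_⟩
    have h1 : ∀ᶠ z in 𝓝 x, ∀ i, i ≠ j → i ≠ k → z ∉ closure (Ω i) := eventually_all.2 fun i => by
      by_cases hij : i = j
      · exact Eventually.of_forall fun z h => absurd hij h
      by_cases hik : i = k
      · exact Eventually.of_forall fun z _ h => absurd hik h
      · exact (hfar (some i) (fun h => hij (Option.some.inj h))
          (fun h => hik (Option.some.inj h))).mono fun z hz _ _ => hz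
    have h2 := hfar none (by simp) (by simp)
    filter_upwards [(h1.and h2).eventually_nhds] with z hz
    refine ⟨hin z, fun hzj => ?_⟩
    -- All points near z lie in the closure of Ω k, since every other region is excluded; Ω k being
    -- the interior of its closure, z belongs to it.
    have hzk : z ∈ Ω k := by
      rw [← ha.interior_closure k, mem_interior_iff_mem_nhds]
      filter_upwards [hz, isClosed_closure.isOpen_compl.mem_nhds hzj] with y hy hyj
      have h3 : y ∉ region Ω none := fun h => hy.2 (subset_closure h)
      simp only [region, mem_compl_iff, not_not, mem_iUnion] at h3
      obtain ⟨i, hi⟩ := h3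
      by_cases hik : i = k
      · exact hik ▸ hi
      · refine absurd hi (hy.1 i (fun hij => ?_) hik)
        exact hyj (hij ▸ hi)
    rw [ha.eq_sum]
    exact ha.eq_of_mem (Finset.mem_univ k) hzk

theorem jumpRep_of_corner (ha : IsMultiBang a c Ω) {j : Fin n} {x : Plane} {ω₀ : ℝ}
    (hx : IsCornerOfExactlyTwo Ω j x) (ht : ¬ IsTangentAt (Ω j) x ω₀) :
    ∃ j₁ j₂, j₁ ≠ j₂ ∧ JumpRep (fun _ => 1)
      (fun l r => a (lineMap (fun l => x + l • dirPerp ω₀) (fun _ => ω₀) (l, r))) 0 j₁ j₂ := by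
  obtain ⟨⟨Φ, hΦ, hq⟩, l, hl, -, hm⟩ := hx
  have hsrc := Φ.open_source.mem_nhds hΦ.mem_source
  have hxc : x ∈ closure (Ω j) := by
    refine hΦ.mem_closure_of_quadrant fun y hy h0 h1 => ?_
    rcases hq with hq | hq
    · exact (hq y hy).2 ⟨h0, h1⟩
    · exact (hq y hy).2 (.inl h0)
  have hxn : x ∉ Ω j := by
    intro h
    rcases hq with hq | hq
    · have := (hq x hΦ.mem_source).1 h
      simp [hΦ.coord_base] at this
    · have := (hq x hΦ.mem_source).1 h
      simp [hΦ.coord_base] at this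
  have hfr : x ∈ frontier (Ω j) := by
    rw [(ha.isOpen j).frontier_eq]
    exact ⟨hxc, hxn⟩
  obtain ⟨b', hb', hval⟩ := ha.exists_values_of_corner hxc hl hm
  have hcont : ∀ z ∈ Φ.source, ∀ i, ContinuousAt (fun y => Φ y i) z := fun z hz i =>
    (continuous_coord i).continuousAt.comp (Φ.continuousAt hz)
  have hcl : ∀ z ∈ Φ.source, (∀ᶠ y in 𝓝 z, y ∈ Φ.source → y ∉ Ω j) → z ∉ closure (Ω j) := by
    intro z hz h1 h2
    obtain ⟨y, hy1, hy2, hy3⟩ := ((mem_closure_iff_frequently.1 h2).and_eventually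
      (h1.and (Φ.open_source.mem_nhds hz))).exists
    exact hy2 hy3 hy1
  have hline := isLineFamily_parallel x ω₀
  have h0 : lineMap (fun l => x + l • dirPerp ω₀) (fun _ => ω₀) (0, 0) = x := by simp [lineMap]
  have hd := fderiv_coord_ne_zero_of_corner hΦ hq (Eventually.of_forall fun _ h => h)
    (fun h => ht ⟨hfr, h⟩)
  obtain ⟨j₁, j₂, hj, hne⟩ := hline.jumpRep_quadrant (τ := 0) (w := fun _ => 1) tendsto_const_nhds
    (by rwa [h0]) (by rwa [h0]) (a := a) (b := c j) (b' := b') (by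
      rw [h0]
      rcases hq with hq | hq
      · left
        filter_upwards [hsrc, hval] with z hz h1
        refine ⟨fun h2 h3 => h1.1 ((hq z hz).2 ⟨h2, h3⟩), fun h2 => h1.2 (hcl z hz ?_)⟩
        rcases h2 with h2 | h2
        · filter_upwards [(hcont z hz 0).eventually_lt continuousAt_const h2] with y hy hys h3
          exact lt_asymm hy ((hq y hys).1 h3).1
        · filter_upwards [(hcont z hz 1).eventually_lt continuousAt_const h2] with y hy hys h3
          exact lt_asymm hy ((hq y hys).1 h3).2
      · right
        filter_upwards [hsrc, hval] with z hz h1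
        refine ⟨fun h2 => h1.1 ((hq z hz).2 h2), fun h2 h3 => h1.2 (hcl z hz ?_)⟩
        filter_upwards [(hcont z hz 0).eventually_lt continuousAt_const h2,
          (hcont z hz 1).eventually_lt continuousAt_const h3] with y hy hy' hys h4
        rcases (hq y hys).1 h4 with h5 | h5
        · exact lt_asymm hy h5
        · exact lt_asymm hy' h5)
  rw [one_mul, one_mul] at hj
  refine ⟨j₁, j₂, hne (fun k => ?_) hb', hj⟩
  -- A translated family leaves no point fixed, which rules out the second alternative.
  rcases hline.transversal 0 with h | h
  · exact h k
  · have h1 := h 1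
    simp only [lineMap, one_smul, zero_smul, add_zero] at h1
    intro _
    exact dirPerp_ne_smul_dir ω₀ one_ne_zero 0 (by simpa using h1)

end IsMultiBang

/-! ### Conclusion: tangent lines and lines through a corner. -/

theorem lineMap_parallel_zero (x : Plane) (ω τ : ℝ) :
    lineMap (fun l => x + l • dirPerp ω) (fun _ => ω) (0, τ) = x + τ • dir ω := by
  simp [lineMap]

theorem lineMap_rotating_zero (y : Plane) (ω τ : ℝ) :
    lineMap (fun _ => y) (fun l => ω + l) (0, τ) = y + τ • dir ω := by
  simp [lineMap]

theorem add_smul_dir_mem_lineSet {x : Plane} {s ω : ℝ} (hx : x ∈ lineSet s ω) (τ : ℝ) :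
    x + τ • dir ω ∈ lineSet s ω := by
  obtain ⟨t, ht⟩ := hx
  exact ⟨t + τ, by rw [ht]; module⟩

theorem exists_eq_add_smul_dir {x y : Plane} {s ω : ℝ} (hx : x ∈ lineSet s ω)
    (hy : y ∈ lineSet s ω) : ∃ τ : ℝ, x = y + τ • dir ω := by
  obtain ⟨t, ht⟩ := hx
  obtain ⟨t', ht'⟩ := hy
  exact ⟨t - t', by rw [ht, ht']; module⟩

theorem add_smul_dir_eq_self_iff {x : Plane} {ω τ : ℝ} : x + τ • dir ω = x ↔ τ = 0 := by
  rw [add_eq_left, smul_eq_zero, or_iff_left]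
  intro h
  have := norm_dir ω
  rw [h, norm_zero] at this
  exact zero_ne_one this

theorem tendsto_sub_nhdsNE (s : ℝ) : Tendsto (fun t => t - s) (𝓝[≠] s) (𝓝[≠] 0) := by
  refine tendsto_nhdsWithin_iff.2 ⟨?_, ?_⟩
  · have h : Continuous fun t : ℝ => t - s := by fun_prop
    have := h.tendsto s
    rw [sub_self] at this
    exact this.mono_left nhdsWithin_le_nhds
  · filter_upwards [self_mem_nhdsWithin] with t ht using sub_ne_zero.2 ht

theorem tendsto_sub_nhdsLT (s : ℝ) : Tendsto (fun t => t - s) (𝓝[<] s) (𝓝[<] 0) := by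
  refine tendsto_nhdsWithin_iff.2 ⟨((tendsto_sub_nhdsNE s).mono_left (nhdsLT_le_nhdsNE s)).mono_right
    nhdsWithin_le_nhds, ?_⟩
  filter_upwards [self_mem_nhdsWithin] with t (ht : t < s) using sub_neg.2 ht

theorem tendsto_sub_nhdsGT (s : ℝ) : Tendsto (fun t => t - s) (𝓝[>] s) (𝓝[>] 0) := by
  refine tendsto_nhdsWithin_iff.2 ⟨((tendsto_sub_nhdsNE s).mono_left (nhdsGT_le_nhdsNE s)).mono_right
    nhdsWithin_le_nhds, ?_⟩
  filter_upwards [self_mem_nhdsWithin] with t (ht : s < t) using sub_pos.2 ht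

theorem eventually_differentiableAt_comp_sub {G : ℝ → ℝ} {s : ℝ}
    (h : ∀ᶠ l in 𝓝[≠] 0, DifferentiableAt ℝ G l) :
    ∀ᶠ t in 𝓝[≠] s, DifferentiableAt ℝ (fun t => G (t - s)) t :=
  ((tendsto_sub_nhdsNE s).eventually h).mono fun t ht =>
    DifferentiableAt.comp (g := G) (f := fun t => t - s) t ht (by fun_prop)

theorem tendsto_sqrt_abs {u : ℝ → ℝ} (hu : Continuous u) (h0 : u 0 = 0) :
    Tendsto (fun l => √|u l|) (𝓝[≠] 0) (𝓝 0) := by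
  have := (hu.abs.sqrt).tendsto 0
  rw [h0, abs_zero, sqrt_zero] at this
  exact this.mono_left nhdsWithin_le_nhds

namespace IsMultiBang

variable {n : ℕ} {f a : Plane → ℝ} {c : Fin n → ℝ} {Ω : Fin n → Set Plane}

section Tangent

variable {j : Fin n} {x : Plane} {s₀ ω₀ : ℝ}

/-- The representation, along a family of lines, of a multi-bang function at the points of a line
which is tangent to the boundaries at the single point with parameter `τ₀`. -/
theorem exists_jumpRep_of_tangent (ha : IsMultiBang a c Ω) {P : ℝ → Plane} {φ : ℝ → ℝ}
    (h : IsLineFamily P φ ω₀) {w : ℝ → ℝ} (hw : Tendsto w (𝓝[≠] 0) (𝓝 0)) {τ₀ : ℝ}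
    (s : Finset (Fin n))
    (ht : ∀ i τ, IsTangentAt (Ω i) (lineMap P φ (0, τ)) ω₀ → τ = τ₀ ∧ i ∈ s) {J₁ J₂ : ℝ}
    (hs : JumpRep w (fun l r => ∑ i ∈ s, (Ω i).indicator (fun _ => c i) (lineMap P φ (l, r))) τ₀
      J₁ J₂) :
    ∃ K₁ K₂ : ℝ → ℝ, (∀ τ, JumpRep w (fun l r => a (lineMap P φ (l, r))) τ (K₁ τ) (K₂ τ)) ∧
      (∀ τ ≠ τ₀, K₁ τ = 0 ∧ K₂ τ = 0) ∧ K₁ τ₀ = J₁ ∧ K₂ τ₀ = J₂ := by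
  classical
  refine ⟨fun τ => if τ = τ₀ then J₁ else 0, fun τ => if τ = τ₀ then J₂ else 0, fun τ => ?_,
    fun τ hτ => by simp [hτ], by simp, by simp⟩
  by_cases hτ : τ = τ₀
  · subst hτ
    simp only [if_true]
    exact ha.jumpRep_of_sum_tangent h hw s (fun i hi h' => hi (ht i τ h').2) hs
  · simp only [hτ, if_false]
    refine ha.jumpRep_of_sum_tangent h hw ∅ (fun i _ h' => hτ (ht i τ h').1) ?_
    exact JumpRep.of_eventually_const (C := 0) (by simp)

theorem derivHasSingularityOfOrder_attRadon (ha : IsMultiBang a c Ω) (hf : ContDiff ℝ 1 f)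
    (hfc : HasCompactSupport f) (hf0 : ∀ x, 0 ≤ f x) (hk : HasNonzeroCurvatureAt (Ω j) x)
    (hx : x ∈ lineSet s₀ ω₀) (hj : IsTangentAt (Ω j) x ω₀)
    (htan : ∀ (l : Fin n), ∀ y ∈ lineSet s₀ ω₀, IsTangentAt (Ω l) y ω₀ →
      y = x ∧ ∀ᶠ z in 𝓝 x, z ∈ frontier (Ω l) ↔ z ∈ frontier (Ω j))
    {t : ℝ} (ht : t < 0) (hpos : 0 < f (x + t • dir ω₀)) :
    DerivHasSingularityOfOrder (fun s => attRadon a f s ω₀) s₀ (1 / 2) := by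
  classical
  have hline := isLineFamily_parallel x ω₀
  -- The sets tangent at x are treated together, since their jumps come from the same curve; the
  -- others are transversal to the line and contribute nothing under a vanishing weight.
  set s : Finset (Fin n) := {i | IsTangentAt (Ω i) x ω₀} with hs
  have hmem : ∀ i, i ∈ s ↔ IsTangentAt (Ω i) x ω₀ := fun i => by simp [hs]
  obtain ⟨g, b, b', hg, hg0, hg1, hg2, hb, hval⟩ := ha.exists_graph hk ((hmem j).2 hj)
    fun i hi => ⟨(hmem i).1 hi, (htan i x hx ((hmem i).1 hi)).2⟩
  obtain ⟨J₁, J₂, hJ, hrep⟩ := jumpRep_parallel_tangent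
    (a := fun z => ∑ i ∈ s, (Ω i).indicator (fun _ => c i) z) hg hg0 hg1 hg2 hb hval
  have hw : Tendsto (fun l : ℝ => √|l|) (𝓝[≠] 0) (𝓝 0) := tendsto_sqrt_abs continuous_id rfl
  obtain ⟨K₁, K₂, hK, hK0, rfl, rfl⟩ := ha.exists_jumpRep_of_tangent hline hw s (fun i τ h => by
    rw [lineMap_parallel_zero] at h
    obtain ⟨h1, -⟩ := htan i _ (add_smul_dir_mem_lineSet hx τ) h
    have h2 := add_smul_dir_eq_self_iff.1 h1
    refine ⟨h2, (hmem i).2 ?_⟩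
    rwa [h1] at h) hrep
  obtain ⟨M, hF, hA⟩ := ha.exists_bounds hf hfc hline
  obtain ⟨hdiff, W, hW, hleft, hright⟩ := attIntegral_tendsto_of_isolated hw hF hA
    (fun z => hf0 _) hK hK0 ht (by simpa only [lineMap_parallel_zero] using hpos)
  simp only [DerivHasSingularityOfOrder, attRadon_add_eq_attIntegral a f hx, ← sqrt_eq_rpow]
  refine ⟨eventually_differentiableAt_comp_sub hdiff, K₁ 0 * W, K₂ 0 * W, ?_, ?_,
    hJ.imp (fun h => mul_ne_zero h hW.ne') (fun h => mul_ne_zero h hW.ne')⟩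
  · simp only [deriv_comp_sub_const]
    exact hleft.comp (tendsto_sub_nhdsLT s₀)
  · simp only [deriv_comp_sub_const]
    exact hright.comp (tendsto_sub_nhdsGT s₀)

/-- With x at parameter τ₀ from the pivot y, the one-sided limits are the jumps at τ₀ times a
positive factor; both jumps vanish if τ₀ = 0, and one is nonzero otherwise. -/
theorem deriv_attRadon_rotating (ha : IsMultiBang a c Ω) (hf : ContDiff ℝ 1 f)
    (hfc : HasCompactSupport f) (hf0 : ∀ x, 0 ≤ f x) (hk : HasNonzeroCurvatureAt (Ω j) x)
    (hx : x ∈ lineSet s₀ ω₀) (hj : IsTangentAt (Ω j) x ω₀)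
    (htan : ∀ (l : Fin n), ∀ y ∈ lineSet s₀ ω₀, IsTangentAt (Ω l) y ω₀ →
      y = x ∧ ∀ᶠ z in 𝓝 x, z ∈ frontier (Ω l) ↔ z ∈ frontier (Ω j))
    {t : ℝ} (ht : t < 0) (hpos : 0 < f (x + t • dir ω₀)) {y : Plane} (hy : y ∈ lineSet s₀ ω₀) :
    (∀ᶠ ω in 𝓝[≠] ω₀,
      DifferentiableAt ℝ (fun ω' => attRadon a f (inner ℝ y (dirPerp ω')) ω') ω) ∧
    (Tendsto (fun ω => |sin (ω - ω₀)| ^ (1 / 2 : ℝ) *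
        deriv (fun ω' => attRadon a f (inner ℝ y (dirPerp ω')) ω') ω) (𝓝[≠] ω₀) (𝓝 0) ↔
      y = x) := by
  classical
  have hline := isLineFamily_rotating y ω₀
  obtain ⟨τ₀, hτ₀⟩ := exists_eq_add_smul_dir hx hy
  set s : Finset (Fin n) := {i | IsTangentAt (Ω i) x ω₀} with hs
  have hmem : ∀ i, i ∈ s ↔ IsTangentAt (Ω i) x ω₀ := fun i => by simp [hs]
  obtain ⟨g, b, b', hg, hg0, hg1, hg2, hb, hval⟩ := ha.exists_graph hk ((hmem j).2 hj)
    fun i hi => ⟨(hmem i).1 hi, (htan i x hx ((hmem i).1 hi)).2⟩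
  obtain ⟨J₁, J₂, hJ, hJ', hrep⟩ := jumpRep_rotating_tangent
    (a := fun z => ∑ i ∈ s, (Ω i).indicator (fun _ => c i) z) hg hg0 hg1 hg2 hb hτ₀ hval
  have hw : Tendsto (fun l : ℝ => √|sin l|) (𝓝[≠] 0) (𝓝 0) :=
    tendsto_sqrt_abs continuous_sin sin_zero
  obtain ⟨K₁, K₂, hK, hK0, rfl, rfl⟩ := ha.exists_jumpRep_of_tangent hline hw s (fun i τ h => by
    rw [lineMap_rotating_zero] at h
    obtain ⟨h1, -⟩ := htan i _ (add_smul_dir_mem_lineSet hy τ) h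
    have h2 : x + (τ - τ₀) • dir ω₀ = x := by
      conv_rhs => rw [← h1]
      rw [hτ₀]
      module
    refine ⟨sub_eq_zero.1 (add_smul_dir_eq_self_iff.1 h2), (hmem i).2 ?_⟩
    rwa [h1] at h) hrep
  obtain ⟨M, hF, hA⟩ := ha.exists_bounds hf hfc hline
  -- Parameters are counted from y here, so the point x + t θ of the ray behind x has parameter τ₀ +
  -- t.
  obtain ⟨hdiff, W, hW, hleft, hright⟩ := attIntegral_tendsto_of_isolated hw hF hA
    (fun z => hf0 _) hK hK0 (t₀ := τ₀ + t) (by linarith) (by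
      rw [lineMap_rotating_zero, add_smul, ← add_assoc, ← hτ₀]
      exact hpos)
  simp only [attRadon_inner_eq_attIntegral a f y ω₀, ← sqrt_eq_rpow, deriv_comp_sub_const]
  refine ⟨eventually_differentiableAt_comp_sub hdiff, ?_⟩
  have hL := hleft.comp (tendsto_sub_nhdsLT ω₀)
  have hR := hright.comp (tendsto_sub_nhdsGT ω₀)
  constructor
  · intro h
    by_contra hne
    have hτ : τ₀ ≠ 0 := fun h0 => hne (by rw [hτ₀, h0, zero_smul, add_zero])
    have e1 := tendsto_nhds_unique hL (h.mono_left (nhdsLT_le_nhdsNE ω₀))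
    have e2 := tendsto_nhds_unique hR (h.mono_left (nhdsGT_le_nhdsNE ω₀))
    rcases hJ hτ with h1 | h1
    · exact mul_ne_zero h1 hW.ne' e1
    · exact mul_ne_zero h1 hW.ne' e2
  · rintro rfl
    obtain ⟨h1, h2⟩ := hJ' (add_smul_dir_eq_self_iff.1 hτ₀.symm)
    rw [h1, zero_mul] at hL
    rw [h2, zero_mul] at hR
    rw [← Iio_union_Ioi, nhdsWithin_union]
    exact hL.sup hR

end Tangent

theorem derivHasJump_attRadon (ha : IsMultiBang a c Ω) (hf : ContDiff ℝ 1 f)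
    (hfc : HasCompactSupport f) (hf0 : ∀ x, 0 ≤ f x) {j : Fin n} {x : Plane} {s₀ ω₀ : ℝ}
    (hcor : IsCornerOfExactlyTwo Ω j x) (hx : x ∈ lineSet s₀ ω₀)
    (hnc : ∀ (l : Fin n), ∀ y ∈ lineSet s₀ ω₀, y ≠ x → ¬ HasCornerAt (Ω l) y)
    (hnt : ∀ (l : Fin n), ∀ y ∈ lineSet s₀ ω₀, ¬ IsTangentAt (Ω l) y ω₀)
    {t : ℝ} (ht : t < 0) (hpos : 0 < f (x + t • dir ω₀)) :
    DerivHasJump (fun s => attRadon a f s ω₀) s₀ := by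
  have hline := isLineFamily_parallel x ω₀
  obtain ⟨M, hF, hA⟩ := ha.exists_bounds hf hfc hline
  have hJ : ∀ τ, ∃ J₁ J₂, JumpRep (fun _ => 1)
      (fun l r => a (lineMap (fun l => x + l • dirPerp ω₀) (fun _ => ω₀) (l, r))) τ J₁ J₂ ∧
      (τ ≠ 0 → J₁ = J₂) ∧ (τ = 0 → J₁ ≠ J₂) := by
    intro τ
    by_cases hτ : τ = 0
    · obtain ⟨J₁, J₂, hne, hJ⟩ := ha.jumpRep_of_corner hcor (hnt j x hx)
      exact ⟨J₁, J₂, hτ ▸ hJ, fun h => absurd hτ h, fun _ => hne⟩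
    · have hmem := add_smul_dir_mem_lineSet hx τ
      obtain ⟨J₁, J₂, hJ, heq⟩ := ha.jumpRep_sum_indicator hline (w := fun _ => 1) (w₀ := 1)
        tendsto_const_nhds (τ := τ) Finset.univ (fun i _ => by
          rw [lineMap_parallel_zero]; exact hnt i _ hmem)
      rw [one_mul, one_mul] at hJ
      refine ⟨J₁, J₂, hJ.congr (Eventually.of_forall fun z => ha.eq_sum _), fun _ => heq fun i _ => ?_,
        fun h => absurd h hτ⟩
      rw [lineMap_parallel_zero]
      exact hnc i _ hmem fun h => hτ (add_smul_dir_eq_self_iff.1 h)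
  choose J₁ J₂ hJ heq hne using hJ
  obtain ⟨hdiff, L₁, L₂, hL₁, hL₂, hL⟩ := attIntegral_derivHasJump hF hA (fun z => hf0 _) hJ
    heq (hne 0 rfl) ht (by simpa only [lineMap_parallel_zero] using hpos)
  simp only [DerivHasJump, attRadon_add_eq_attIntegral a f hx]
  refine ⟨eventually_differentiableAt_comp_sub hdiff, L₁, L₂, ?_, ?_, hL⟩
  · refine (hL₁.comp (tendsto_sub_nhdsLT s₀)).congr fun s => ?_
    rw [deriv_comp_sub_const]
    rfl
  · refine (hL₂.comp (tendsto_sub_nhdsGT s₀)).congr fun s => ?_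
    rw [deriv_comp_sub_const]
    rfl

end IsMultiBang

theorem theorem1 {n : ℕ} (f a : Plane → ℝ) (c : Fin n → ℝ) (Ω : Fin n → Set Plane)
    (hf : ContDiff ℝ 1 f) (hfc : HasCompactSupport f) (hf0 : ∀ x, 0 ≤ f x)
    (ha : IsMultiBang a c Ω) :
    -- first part: lines tangent to a boundary at a point of nonzero curvature
    (∀ (j : Fin n) (x : Plane) (s₀ ω₀ : ℝ),
      HasNonzeroCurvatureAt (Ω j) x →
      x ∈ lineSet s₀ ω₀ →
      IsTangentAt (Ω j) x ω₀ →
      (∀ (l : Fin n), ∀ y ∈ lineSet s₀ ω₀, IsTangentAt (Ω l) y ω₀ →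
        y = x ∧ ∀ᶠ z in 𝓝 x, z ∈ frontier (Ω l) ↔ z ∈ frontier (Ω j)) →
      (∃ t : ℝ, t < 0 ∧ 0 < f (x + t • dir ω₀)) →
      DerivHasSingularityOfOrder (fun s => attRadon a f s ω₀) s₀ (1 / 2) ∧
      ∀ y ∈ lineSet s₀ ω₀,
        (∀ᶠ ω in 𝓝[≠] ω₀,
          DifferentiableAt ℝ (fun ω' => attRadon a f (inner ℝ y (dirPerp ω')) ω') ω) ∧
        (Tendsto (fun ω => |sin (ω - ω₀)| ^ (1 / 2 : ℝ) *
            deriv (fun ω' => attRadon a f (inner ℝ y (dirPerp ω')) ω') ω) (𝓝[≠] ω₀) (𝓝 0) ↔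
          y = x)) ∧
    -- second part: lines through a corner
    (∀ (j : Fin n) (x : Plane) (s₀ ω₀ : ℝ),
      IsCornerOfExactlyTwo Ω j x →
      x ∈ lineSet s₀ ω₀ →
      (∀ (l : Fin n), ∀ y ∈ lineSet s₀ ω₀, y ≠ x → ¬ HasCornerAt (Ω l) y) →
      (∀ (l : Fin n), ∀ y ∈ lineSet s₀ ω₀, ¬ IsTangentAt (Ω l) y ω₀) →
      (∃ t : ℝ, t < 0 ∧ 0 < f (x + t • dir ω₀)) →
      DerivHasJump (fun s => attRadon a f s ω₀) s₀) := by
  refine ⟨fun j x s₀ ω₀ hk hx hj htan ⟨t, ht, hpos⟩ => ⟨?_, fun y hy => ?_⟩,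
    fun j x s₀ ω₀ hcor hx hnc hnt ⟨t, ht, hpos⟩ => ?_⟩
  · exact ha.derivHasSingularityOfOrder_attRadon hf hfc hf0 hk hx hj htan ht hpos
  · exact ha.deriv_attRadon_rotating hf hfc hf0 hk hx hj htan ht hpos hy
  · exact ha.derivHasJump_attRadon hf hfc hf0 hcor hx hnc hnt ht hpos
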